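/- **Setting.** Let $T\subset\mathbb R^2$ be a bounded open set with boundary of class $C^1$ and let $\psi:\mathbb R^3\to\mathbb R^3$ be of class $C^1$, injective on $\overline T\times[-h_0,h_0]$ for some $h_0>0$. Write $\psi_0(x)=\psi(x,0)$ for $x\in\mathbb R^2$, $\Omega=\psi_0(T)$, $\partial\Omega=\psi_0(\partial T)$, and $\Omega_h=\Omega\times(-h,h):=\psi(T\times(-h,h))$. Assume that on $\overline T$ the map $D\psi_0$ is injective and $\partial_{x_3}\psi(x,0)=\nu(\psi_0(x))$, where $\nu$ is a unit normal field of $\Omega$. Put $J=|\det D\psi|$, $J_0=\sqrt{\det(D\psi_0^TD\psi_0)}$ (so that $dS=J_0\,dx$ is the surface measure of $\Omega$), let $d\ell$ be arc length on $\partial\Omega$, and let $\boldsymbol n$ be the outward unit vector field on $\partial\Omega$ tangent to $\Omega$ and normal to $\partial\Omega$. Let $\mathscr L\subset\mathbb R^2$ be a lattice and $\Box\subset\mathbb R^2$ a bounded measurable cell of area $1$ whose $\mathscr L$-translates tile the plane. For $l>0$ and $\hat x\in l\mathscr L$ the cell $\hat x+l\Box$ is *full* if it is contained in $T$ and *partial*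 if it meets both $T$ and its complement; in the latter case $\Delta=\{y\in\Box:\hat x+ly\in T\}$. Let $l,h>0$ run through sequences tending to $0$, and let $\rho_{l,h}$ be continuous on $\Omega_h$ with $|\rho_{l,h}|\le M$ for a constant $M$ independent of $l,h$. With $\tilde\rho=((\rho_{l,h}\circ\psi)\,J)(\hat x+ly,hz)$ define, for $\hat x\in l\mathscr L$, $$J_0\,q^{(a,b)}_{l,h}=\frac1{l^ah^b}\int_\Box\!\int_{-1}^1\!\tilde\rho\,dz\,dy,\quad J_0\,\boldsymbol p_{l,h}=\int_\Box\!\int_{-1}^1\! y\,\tilde\rho\,dz\,dy,\quad J_0\,p_{3,l,h}=\int_\Box\!\int_{-1}^1\! z\,\tilde\rho\,dz\,dy,\quad J_0\,\sigma_{l,h}=\int_\Delta\!\int_{-1}^1\!\tilde\rho\,dz\,dy .$$ A bulk quantity $u_{l,h}$ *has the limit* $u$ on $T$ if $\sum_{\hat x\ \mathrm{full}}l^2\varphi(\hat x)J_0(\hat x)u_{l,h}(\hat x)\to\int_T\varphi\,u\,J_0\,dx$ for all continuous $\varphi$ on $\mathbb R^2$. The edge charges $\sigma_{l,h}$ *have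 the limit* $\sigma\in L^1(\partial\Omega)$ if $\sum_{\hat x\ \mathrm{partial}}l\,\varphi(\psi_0(\hat x))J_0(\hat x)\sigma_{l,h}(\hat x)\to\int_{\partial\Omega}\varphi\,\sigma\,d\ell$ for all continuous $\varphi$ on $\mathbb R^3$. In each part below the named functions are such limits: $q^{(a,b)}_{l,h}$ has the limit $q\circ\psi_0\in L^1(T)$ ("free charge of order $(a,b)$"), $p_{3,l,h}$ has the limit $p_3\circ\psi_0\in L^1(T)$, $\sigma_{l,h}$ has the limit $\sigma$, and $\boldsymbol p_{l,h}$ has a limit $\tilde{\boldsymbol p}:\mathbb R^2\to\mathbb R^2$ with $J_0\tilde{\boldsymbol p}$ of class $C^1$ on a neighbourhood of $\overline T$. The tangential polarization is the tangent field $\boldsymbol p_p\circ\psi_0=D\psi_0\,\tilde{\boldsymbol p}$, and its surface divergence is $\operatorname{div}_S\boldsymbol p_p=J_0^{-1}\operatorname{div}(J_0\tilde{\boldsymbol p})$ (in the parameter $x$). The products below are the distributions $\langle f\mathbb 1_\Omega,\varphi\rangle=\int_\Omega f\varphi\,dS$, $\langle f\mathbb 1_{\partial\Omega},\varphi\rangle=\int_{\partial\Omega}f\varphi\,d\ell$,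 $\langle f\,\partial\mathbb 1_\Omega/\partial\nu,\varphi\rangle=-\int_\Omega f\,\partial_\nu\varphi\,dS$. A solution of $-\Delta\Phi=S$ is a locally integrable function satisfying the equation in the sense of distributions on $\mathbb R^3$, with $\Phi(\boldsymbol r)\to0$ as $|\boldsymbol r|\to\infty$. "The problems $-\Delta\Phi_{l,h}=S_{l,h}$ have the limit $-\Delta\Phi_0=S_0$" means: all these problems have solutions, and for any choice of solutions, $\int\Phi_{l,h}\varphi\to\int\Phi_0\varphi$ for every continuous compactly supported $\varphi$ on $\mathbb R^3$, and $\Phi_{l,h}\to\Phi_0$ almost everywhere on $\mathbb R^3\setminus\overline\Omega$. **Theorem.** 1. If $h/l\to0$ and $q$ is the free charge of order $(1,0)$, then the problems $-\Delta\Phi_{l,h}=\dfrac{\rho_{l,h}}{lh}\mathbb 1_{\Omega_h}$ have the limit $$-\Delta\Phi_0=\left(q-\operatorname{div}_S\boldsymbol p_p\right)\mathbb 1_\Omega+(\sigma+\boldsymbol p_p\cdot\boldsymbol n)\mathbb 1_{\partial\Omega}.$$ 2. If $h/l\to\alpha<\infty$ and $q$ is the free charge of order $(1,0)$, then the problems $-\Delta\Phi_{l,h}=\dfrac{\rho_{l,h}}{l^2}\mathbb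 1_{\Omega_h}$ have the limit $$-\Delta\Phi_0=\alpha\left(q-\operatorname{div}_S\boldsymbol p_p\right)\mathbb 1_\Omega-\alpha^2p_3\frac{\partial\mathbb 1_\Omega}{\partial\nu}+\alpha(\sigma+\boldsymbol p_p\cdot\boldsymbol n)\mathbb 1_{\partial\Omega}.$$ If $q$ is instead the free charge of order $(0,1)$, the same holds with $q$ replaced by $\alpha q$ on the right. 3. If $l/h\to0$ and $q$ is the free charge of order $(0,1)$, then the problems $-\Delta\Phi_{l,h}=\dfrac{\rho_{l,h}}{h^2}\mathbb 1_{\Omega_h}$ have the limit $$-\Delta\Phi_0=q\,\mathbb 1_\Omega-p_3\frac{\partial\mathbb 1_\Omega}{\partial\nu}.$$ -/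

import Mathlib

open MeasureTheory Filter Topology Set
open scoped ContDiff RealInnerProductSpace

namespace ThinFilm

noncomputable section

/-- The parameter plane. -/
abbrev E2 : Type := EuclideanSpace ℝ (Fin 2)

/-- Physical space (and also the three-dimensional parameter space). -/
abbrev E3 : Type := EuclideanSpace ℝ (Fin 3)

/-- The point of three-dimensional parameter space with in-plane part `x` and height `t`. -/
def pt (x : E2) (t : ℝ) : E3 := !₂[x 0, x 1, t]

/-! ### Planar domains with boundary of class `C¹` -/

/-- `m` is the outward unit normal of `T` at `x`: near `x` the set `T` is the sublevel set
`{g < 0}` of a `C¹` function whose gradient at `x` is a positive multiple of the unit vector `m`. -/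
def IsOutwardNormal (T : Set E2) (x m : E2) : Prop :=
  ‖m‖ = 1 ∧ ∃ g : E2 → ℝ, ContDiffAt ℝ 1 g x ∧ (∃ c : ℝ, 0 < c ∧ gradient g x = c • m) ∧
    ∀ᶠ y in 𝓝 x, (y ∈ T ↔ g y < 0)

/-- A bounded open set of the plane with boundary of class `C¹`, lying locally on one side of it. -/
structure IsC1Domain (T : Set E2) : Prop where
  isOpen : IsOpen T
  isBounded : Bornology.IsBounded T
  boundary : ∀ x ∈ frontier T, ∃ m : E2, IsOutwardNormal T x m

/-! ### The surface, the film and their Jacobians -/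

/-- The parametrization `ψ₀ = ψ|_{x₃ = 0}` of the surface. -/
def mid (ψ : E3 → E3) (x : E2) : E3 := ψ (pt x 0)

/-- The surface `Ω = ψ₀(T)`. -/
def surface (ψ : E3 → E3) (T : Set E2) : Set E3 := mid ψ '' T

/-- The boundary curve `∂Ω = ψ₀(∂T)` of the surface. -/
def surfaceBoundary (ψ : E3 → E3) (T : Set E2) : Set E3 := mid ψ '' frontier T

/-- The film `Ω_h = Ω × (-h, h) = ψ(T × (-h, h))`. -/
def film (ψ : E3 → E3) (T : Set E2) (h : ℝ) : Set E3 :=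
  image2 (fun x t => ψ (pt x t)) T (Ioo (-h) h)

/-- The derivative `Dψ₀(x)`; its range is the tangent plane of the surface at `ψ₀(x)`. -/
def D0 (ψ : E3 → E3) (x : E2) : E2 →L[ℝ] E3 := fderiv ℝ (mid ψ) x

/-- The surface Jacobian `J₀ = √(det (Dψ₀ᵀ Dψ₀))`. -/
def J0 (ψ : E3 → E3) (x : E2) : ℝ :=
  Real.sqrt ((ContinuousLinearMap.adjoint (D0 ψ x)) ∘L (D0 ψ x)).det

/-- The volume Jacobian `J = |det Dψ|`. -/
def J (ψ : E3 → E3) (y : E3) : ℝ := |(fderiv ℝ ψ y).det|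

/-- `ψ` parametrizes a neighbourhood of a surface `Ω = ψ₀(T)` with unit normal field `ν`: it is
`C¹`, injective on a thin closed slab over the closure of `T`, its restriction to the plane
`x₃ = 0` is an immersion there, and `x₃` measures height in the direction of the normal,
`∂ψ/∂x₃ = ν` on `x₃ = 0`. -/
structure IsFilmChart (ψ : E3 → E3) (T : Set E2) (ν : E3 → E3) : Prop where
  contDiff : ContDiff ℝ 1 ψ
  injOn : ∃ h₀ : ℝ, 0 < h₀ ∧
    InjOn (fun z : E2 × ℝ => ψ (pt z.1 z.2)) (closure T ×ˢ Icc (-h₀) h₀)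
  immersion : ∀ x ∈ closure T, Function.Injective (D0 ψ x)
  norm_normal : ∀ x ∈ closure T, ‖ν (mid ψ x)‖ = 1
  normal_orthogonal : ∀ x ∈ closure T, ∀ v : E2, ⟪ν (mid ψ x), D0 ψ x v⟫ = 0
  vertical : ∀ x ∈ closure T, HasDerivAt (fun t : ℝ => ψ (pt x t)) (ν (mid ψ x)) 0

/-- `n` is the outward unit conormal of the surface at the boundary point `ψ₀(x)`, `x ∈ ∂T`: a unit
vector in the tangent plane of `Ω`, orthogonal to the tangent line of `∂Ω`, pointing out of `Ω`. -/
def IsOutwardConormal (ψ : E3 → E3) (T : Set E2) (x : E2) (n : E3) : Prop :=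
  ‖n‖ = 1 ∧ n ∈ range (D0 ψ x) ∧ ∃ m : E2, IsOutwardNormal T x m ∧
    (∀ τ : E2, ⟪m, τ⟫ = 0 → ⟪n, D0 ψ x τ⟫ = 0) ∧ 0 < ⟪n, D0 ψ x m⟫

/-- Divergence of a vector field in the parameter plane. -/
def planarDiv (F : E2 → E2) (x : E2) : ℝ :=
  ∑ i : Fin 2, (fderiv ℝ F x (EuclideanSpace.single i 1)) i

/-- The surface divergence, at `ψ₀(x)`, of the tangent field whose components in the
parametrization `ψ₀` are `P`, that is `J₀⁻¹ ∂ᵢ(J₀ Pⁱ)`. -/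
def surfaceDiv (ψ : E3 → E3) (P : E2 → E2) (x : E2) : ℝ :=
  (J0 ψ x)⁻¹ * planarDiv (fun y => J0 ψ y • P y) x

/-! ### Lattice and cells -/

/-- The lattice point `n¹ e₁ + n² e₂`. -/
def latticePt (e : Module.Basis (Fin 2) ℝ E2) (n : Fin 2 → ℤ) : E2 := ∑ i, (n i : ℝ) • e i

/-- An admissible unit cell: bounded, measurable, of unit area, its lattice translates
tiling the plane. -/
structure IsUnitCell (e : Module.Basis (Fin 2) ℝ E2) (B : Set E2) : Prop where
  measurableSet : MeasurableSet B
  isBounded : Bornology.IsBounded B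
  area : volume B = 1
  tiling : ∀ x : E2, ∃! n : Fin 2 → ℤ, x - latticePt e n ∈ B

/-- The corner `x̂ ∈ lℒ` of the cell with index `n`. -/
def corner (e : Module.Basis (Fin 2) ℝ E2) (l : ℝ) (n : Fin 2 → ℤ) : E2 := l • latticePt e n

/-- Indices of the full cells `x̂ ⊕ lB ⊆ T`. -/
def fullCells (e : Module.Basis (Fin 2) ℝ E2) (B T : Set E2) (l : ℝ) : Set (Fin 2 → ℤ) :=
  {n | ∀ y ∈ B, corner e l n + l • y ∈ T}

/-- Indices of the partial cells: `x̂ ⊕ lB` meets both `T` and its complement. -/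
def partialCells (e : Module.Basis (Fin 2) ℝ E2) (B T : Set E2) (l : ℝ) : Set (Fin 2 → ℤ) :=
  {n | (∃ y ∈ B, corner e l n + l • y ∈ T) ∧ ∃ y ∈ B, corner e l n + l • y ∉ T}

/-! ### Microscopic free charge, polarization and surface charge -/

/-- The rescaled charge density `(ρ ∘ ψ) J` at `x + l y + h z e₃`. -/
def pulled (ψ : E3 → E3) (ρ : E3 → ℝ) (l h : ℝ) (x y : E2) (z : ℝ) : ℝ :=
  ρ (ψ (pt (x + l • y) (h * z))) * J ψ (pt (x + l • y) (h * z))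

/-- Free charge of order `(a, b)` of the cell with corner `x`:
`J₀ q = l⁻ᵃ h⁻ᵇ ∫_B ∫_{-1}^1 (ρ ∘ ψ) J dz dy`. -/
def freeCharge (ψ : E3 → E3) (B : Set E2) (a b : ℕ) (ρ : E3 → ℝ) (l h : ℝ) (x : E2) : ℝ :=
  (J0 ψ x)⁻¹ * ((l ^ a * h ^ b)⁻¹ * ∫ y in B, ∫ z in Ioo (-1 : ℝ) 1, pulled ψ ρ l h x y z)

/-- In-plane polarization: `J₀ p = ∫_B ∫_{-1}^1 y (ρ ∘ ψ) J dz dy`. -/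
def planePol (ψ : E3 → E3) (B : Set E2) (ρ : E3 → ℝ) (l h : ℝ) (x : E2) : E2 :=
  (J0 ψ x)⁻¹ • ∫ y in B, ∫ z in Ioo (-1 : ℝ) 1, pulled ψ ρ l h x y z • y

/-- Normal polarization: `J₀ p₃ = ∫_B ∫_{-1}^1 z (ρ ∘ ψ) J dz dy`. -/
def normalPol (ψ : E3 → E3) (B : Set E2) (ρ : E3 → ℝ) (l h : ℝ) (x : E2) : ℝ :=
  (J0 ψ x)⁻¹ * ∫ y in B, ∫ z in Ioo (-1 : ℝ) 1, z * pulled ψ ρ l h x y z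

/-- Charge of a partial cell, `J₀ σ = ∫_Δ ∫_{-1}^1 (ρ ∘ ψ) J dz dy`, where `Δ` is the part of `B`
for which `x + l y` lies in `T`. -/
def edgeCharge (ψ : E3 → E3) (B T : Set E2) (ρ : E3 → ℝ) (l h : ℝ) (x : E2) : ℝ :=
  (J0 ψ x)⁻¹ *
    ∫ y in {y | y ∈ B ∧ x + l • y ∈ T}, ∫ z in Ioo (-1 : ℝ) 1, pulled ψ ρ l h x y z

/-- Weak convergence of cell quantities `u k` to a density `u₀` on `T`: for continuous `φ`,
`∑_{full cells} l² φ(x̂) J₀(x̂) u k (x̂) → ∫_T φ u₀ J₀ dx`. -/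
def BulkLimit {V : Type} [NormedAddCommGroup V] [NormedSpace ℝ V] (ψ : E3 → E3)
    (e : Module.Basis (Fin 2) ℝ E2) (B T : Set E2) (l : ℕ → ℝ) (u : ℕ → E2 → V) (u₀ : E2 → V) :
    Prop :=
  ∀ φ : E2 → ℝ, Continuous φ →
    Tendsto (fun k => ∑ᶠ n ∈ fullCells e B T (l k),
        (l k ^ 2 * φ (corner e (l k) n) * J0 ψ (corner e (l k) n)) • u k (corner e (l k) n))
      atTop (𝓝 (∫ x in T, (φ x * J0 ψ x) • u₀ x))

/-- Weak convergence of the charges of the partial cells to a line density `σ` on `∂Ω` (with respect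
to arc length): for continuous `φ`,
`∑_{partial cells} l φ(ψ₀(x̂)) J₀(x̂) u k (x̂) → ∫_{∂Ω} φ σ dℓ`. -/
def EdgeLimit (ψ : E3 → E3) (e : Module.Basis (Fin 2) ℝ E2) (B T : Set E2) (l : ℕ → ℝ)
    (u : ℕ → E2 → ℝ) (σ : E3 → ℝ) : Prop :=
  ∀ φ : E3 → ℝ, Continuous φ →
    Tendsto (fun k => ∑ᶠ n ∈ partialCells e B T (l k),
        l k * φ (mid ψ (corner e (l k) n)) * J0 ψ (corner e (l k) n) * u k (corner e (l k) n))
      atTop (𝓝 (∫ r in surfaceBoundary ψ T, φ r * σ r ∂(μH[1])))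

/-! ### Sources and Poisson's equation

A source is given by its action on test functions `φ`. -/

/-- The source given by a function. -/
def volumeSource (f : E3 → ℝ) (φ : E3 → ℝ) : ℝ := ∫ r, f r * φ r

/-- The source `f 𝟙_Ω`: the surface `Ω` carries the density `f`, given as a function of the
parameter, with respect to the surface measure `J₀ dx`. -/
def surfaceSource (ψ : E3 → E3) (T : Set E2) (f : E2 → ℝ) (φ : E3 → ℝ) : ℝ :=
  ∫ x in T, f x * φ (mid ψ x) * J0 ψ x

/-- The source `f 𝟙_{∂Ω}`: the curve `∂Ω` carries the density `f` with respect to arc length. -/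
def lineSource (ψ : E3 → E3) (T : Set E2) (f : E3 → ℝ) (φ : E3 → ℝ) : ℝ :=
  ∫ r in surfaceBoundary ψ T, f r * φ r ∂(μH[1])

/-- The double layer `f ∂𝟙_Ω/∂ν`, the distribution `φ ↦ -∫_Ω f ∂φ/∂ν dS`. -/
def doubleLayer (ψ : E3 → E3) (T : Set E2) (ν : E3 → E3) (f : E3 → ℝ) (φ : E3 → ℝ) : ℝ :=
  -∫ x in T, f (mid ψ x) * fderiv ℝ φ (mid ψ x) (ν (mid ψ x)) * J0 ψ x

/-- `Φ` solves `-ΔΦ = S` in the sense of distributions on `ℝ³`, and `Φ → 0` at infinity. -/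
structure SolvesPoisson (Φ : E3 → ℝ) (S : (E3 → ℝ) → ℝ) : Prop where
  locallyIntegrable : LocallyIntegrable Φ volume
  equation : ∀ φ : E3 → ℝ, ContDiff ℝ ∞ φ → HasCompactSupport φ →
    -∫ r, Φ r * Laplacian.laplacian φ r = S φ
  decay : Tendsto Φ (cocompact E3) (𝓝 0)

/-- The Poisson problems with sources `S k` have the limit problem with source `S₀`: all of them are
solvable, and for every choice of solutions `Φ k` of the given problems and every solution `Φ₀` of
the limit problem, `Φ k` converges to `Φ₀`, both weakly on `ℝ³` and, away from the closure of `Ω`,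
pointwise almost everywhere. -/
def HomogenizesTo (Ω : Set E3) (S : ℕ → (E3 → ℝ) → ℝ) (S₀ : (E3 → ℝ) → ℝ) : Prop :=
  (∀ k, ∃ Φ, SolvesPoisson Φ (S k)) ∧ (∃ Φ₀, SolvesPoisson Φ₀ S₀) ∧
  ∀ (Φ : ℕ → E3 → ℝ) (Φ₀ : E3 → ℝ), (∀ k, SolvesPoisson (Φ k) (S k)) → SolvesPoisson Φ₀ S₀ →
    (∀ φ : E3 → ℝ, Continuous φ → HasCompactSupport φ →
      Tendsto (fun k => ∫ r, Φ k r * φ r) atTop (𝓝 (∫ r, Φ₀ r * φ r))) ∧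
    ∀ᵐ r, r ∉ closure Ω → Tendsto (fun k => Φ k r) atTop (𝓝 (Φ₀ r))

end

end ThinFilm

open ThinFilm

/-! The proof turns convergence of potentials into convergence of sources on `C¹` functions, and
then computes the latter by a Taylor expansion cell by cell.

Duality. If `Φ` is the Newton potential of a source `S`, then `∫ Φ f = S (potential f)`, and the
Newton potential of a continuous compactly supported `f` is of class `C¹` (`contDiff_potential`).
Weak convergence of the potentials therefore follows from `S k u → S₀ u` for every `C¹` function
`u`. For a point `r` off the closed surface, the value of the potential at `r` is `S` applied to `s
↦ newton (s - r)`. Cutting this kernel off near `r` makes it `C¹` without changing it near the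
carriers, so pointwise convergence follows from the same hypothesis (`homogenizesTo_of_tendsto`).
Newton potentials are solutions because the potential of `-Δφ` is `φ` (`potential_neg_laplacian`).
Any other solution vanishing at infinity agrees with them almost everywhere: mollifying the
difference gives a smooth harmonic function vanishing at infinity, to which the maximum principle
applies (`SolvesPoisson.ae_eq`).

Expansion. In the coordinates of the rescaled slab the source is a prefactor times the integral of a
bounded density `g` against `V (x, h z)`, where `V = u ∘ ψ ∘ pt`. Expanding `V` to first order at
the corner of each cell gives `chargeSum + l * planeSum + h * normalSum + l * edgeSum + o(l + h)`
(`eventually_abs_integral_sub_le`). The full cells have total area at most that of `T`, so their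
Taylor errors add up to `o(l + h)`. The partial cells lie in a strip of area `O(l)` along the
boundary, so there are `O(1 / l)` of them; each has area `l²`, hence the order of magnitude `l` of
their charges, and order zero of the expansion suffices for them. The hypotheses on free charge,
polarization and edge charge say exactly that the four sums, suitably scaled, converge. Dividing by
`l` or by `h` decides which of them survive in each regime.

Polarization charges. The limit of `planeSum` is the integral over `T` of the derivative of `u ∘ mid
ψ` along `J0 • P`. The planar divergence theorem converts it into `-div_S p` on the surface and `p ·
n` on its boundary (`setIntegral_fderiv_polarization`). The boundary term has to be read with
respect to arc length in space. This uses the area formula for curves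
(`hausdorffMeasure_image_curve`) and a Gram determinant identity, by which the length element times
the conormal component equals the planar flux (`inner_conormal_mul_norm`,
`norm_deriv_mul_fluxDensity`). -/

namespace ThinFilm

noncomputable section

/-! ### The Newton kernel -/

/-- The Newton kernel `1 / (4π|w|)`. -/
def newton (w : E3) : ℝ := (4 * Real.pi)⁻¹ * ‖w‖⁻¹

/-- The gradient of the Newton kernel. -/
def gradNewton (w : E3) : E3 := (-((4 * Real.pi)⁻¹ * (‖w‖ ^ 3)⁻¹)) • w

/-- The regularized distance `√(|w|² + ε²)`. -/
def regNorm (ε : ℝ) (w : E3) : ℝ := Real.sqrt (‖w‖ ^ 2 + ε ^ 2)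

/-- The regularized Newton kernel. -/
def regNewton (ε : ℝ) (w : E3) : ℝ := (4 * Real.pi)⁻¹ * (regNorm ε w)⁻¹

/-- The gradient of the regularized Newton kernel. -/
def gradRegNewton (ε : ℝ) (w : E3) : E3 := (-((4 * Real.pi)⁻¹ * (regNorm ε w ^ 3)⁻¹)) • w

lemma regNorm_pos {ε : ℝ} (hε : 0 < ε) (w : E3) : 0 < regNorm ε w := by
  unfold regNorm; positivity

lemma regNorm_sq (ε : ℝ) (w : E3) : regNorm ε w ^ 2 = ‖w‖ ^ 2 + ε ^ 2 :=
  Real.sq_sqrt (by positivity)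

lemma norm_le_regNorm (ε : ℝ) (w : E3) : ‖w‖ ≤ regNorm ε w :=
  Real.le_sqrt_of_sq_le (by nlinarith [sq_nonneg ε])

lemma le_regNorm (ε : ℝ) (w : E3) : ε ≤ regNorm ε w :=
  Real.le_sqrt_of_sq_le (by nlinarith [sq_nonneg ‖w‖])

lemma hasFDerivAt_regNorm {ε : ℝ} (hε : 0 < ε) (w : E3) :
    HasFDerivAt (regNorm ε) ((regNorm ε w)⁻¹ • innerSL ℝ w) w := by
  have h1 : HasFDerivAt (fun w : E3 => ‖w‖ ^ 2 + ε ^ 2) (2 • innerSL ℝ w) w :=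
    (hasStrictFDerivAt_norm_sq w).hasFDerivAt.add_const _
  have h2 := h1.sqrt (by positivity)
  refine h2.congr_fderiv ?_
  ext v
  have := (regNorm_pos hε w).ne'
  simp only [regNorm] at this ⊢
  simp
  field_simp

lemma continuous_regNorm (ε : ℝ) : Continuous (regNorm ε) := by
  unfold regNorm; fun_prop

lemma hasFDerivAt_regNewton {ε : ℝ} (hε : 0 < ε) (w : E3) :
    HasFDerivAt (regNewton ε) (innerSL ℝ (gradRegNewton ε w)) w := by
  have h0 := (regNorm_pos hε w).ne'
  have h1 := ((hasDerivAt_inv h0).comp_hasFDerivAt w (hasFDerivAt_regNorm hε w)).const_mul ((4 * Real.pi)⁻¹)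
  refine h1.congr_fderiv ?_
  ext v
  simp [gradRegNewton]
  field_simp

lemma continuous_regNewton {ε : ℝ} (hε : 0 < ε) : Continuous (regNewton ε) :=
  continuous_iff_continuousAt.2 fun w => (hasFDerivAt_regNewton hε w).continuousAt

lemma continuous_gradRegNewton {ε : ℝ} (hε : 0 < ε) : Continuous (gradRegNewton ε) := by
  have h := continuous_regNorm ε
  have h0 : ∀ w, regNorm ε w ^ 3 ≠ 0 := fun w => pow_ne_zero _ (regNorm_pos hε w).ne'
  unfold gradRegNewton
  fun_prop (disch := exact h0 _)

lemma regNewton_nonneg {ε : ℝ} (w : E3) : 0 ≤ regNewton ε w := by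
  unfold regNewton regNorm; positivity

lemma regNewton_le_newton {ε : ℝ} {w : E3} (hw : w ≠ 0) : regNewton ε w ≤ newton w := by
  unfold regNewton newton
  have := norm_pos_iff.2 hw
  gcongr
  exact norm_le_regNorm ε w

lemma norm_gradNewton (w : E3) : ‖gradNewton w‖ = (4 * Real.pi)⁻¹ * (‖w‖ ^ 2)⁻¹ := by
  have : (0 : ℝ) < (4 * Real.pi)⁻¹ := by positivity
  rcases eq_or_ne w 0 with rfl | hw
  · simp [gradNewton]
  have := norm_pos_iff.2 hw
  rw [gradNewton, norm_smul, norm_neg, Real.norm_of_nonneg (by positivity)]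
  field_simp

lemma norm_gradRegNewton_le {ε : ℝ} (w : E3) : ‖gradRegNewton ε w‖ ≤ ‖gradNewton w‖ := by
  rcases eq_or_ne w 0 with rfl | hw
  · simp [gradNewton, gradRegNewton]
  have := norm_pos_iff.2 hw
  have hr := norm_le_regNorm ε w
  have h0 := this.trans_le hr
  rw [gradNewton, gradRegNewton, norm_smul, norm_smul, norm_neg, norm_neg,
    Real.norm_of_nonneg (by positivity), Real.norm_of_nonneg (by positivity)]
  gcongr

lemma tendsto_regNorm (w : E3) : Tendsto (fun ε => regNorm ε w) (𝓝 0) (𝓝 ‖w‖) := by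
  have : Continuous fun ε : ℝ => regNorm ε w := by unfold regNorm; fun_prop
  simpa [regNorm] using this.tendsto 0

lemma tendsto_regNewton {w : E3} (hw : w ≠ 0) :
    Tendsto (fun ε => regNewton ε w) (𝓝 0) (𝓝 (newton w)) :=
  ((tendsto_regNorm w).inv₀ (norm_ne_zero_iff.2 hw)).const_mul _

lemma tendsto_gradRegNewton {w : E3} (hw : w ≠ 0) :
    Tendsto (fun ε => gradRegNewton ε w) (𝓝 0) (𝓝 (gradNewton w)) :=
  ((((tendsto_regNorm w).pow 3).inv₀ (pow_ne_zero _ (norm_ne_zero_iff.2 hw))).const_mul _).neg.smul_const _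

lemma measurable_newton : Measurable newton := by
  unfold newton; fun_prop

lemma measurable_gradNewton : Measurable gradNewton := by
  unfold gradNewton; fun_prop

/-- In polar coordinates of three-dimensional space the weight `y ^ 2` absorbs a singularity of
order at most two. This covers both the kernel (order one) and its gradient (order two). -/
lemma integrableOn_ball_of_le_norm_zpow {f : E3 → ℝ} (hf : Measurable f) {C : ℝ} {k : ℕ} (hk : k ≤ 2)
    (hle : ∀ w, ‖f w‖ ≤ C * (‖w‖ ^ k)⁻¹) (R : ℝ) : IntegrableOn f (Metric.ball 0 R) := by
  have h : IntegrableOn (fun w : E3 => (fun y : ℝ => C * (y ^ k)⁻¹) ‖w‖) (Metric.ball 0 R) := by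
    refine (integrableOn_fun_norm_addHaar volume (f := fun y : ℝ => C * (y ^ k)⁻¹)).2 ?_
    have h3 : Module.finrank ℝ E3 = 3 := by simp
    rw [h3]
    have : EqOn (fun y : ℝ => y ^ (3 - 1) • (C * (y ^ k)⁻¹)) (fun y => C * y ^ (2 - k)) (Ioo 0 R) := by
      intro y hy
      have hy0 : y ≠ 0 := hy.1.ne'
      have : y ^ 2 = y ^ (2 - k) * y ^ k := by rw [← pow_add]; congr 1; omega
      simp only [smul_eq_mul, Nat.add_one_sub_one]
      rw [this]; field_simp
    rw [integrableOn_congr_fun this measurableSet_Ioo]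
    exact (Continuous.integrableOn_Icc (by fun_prop)).mono_set Ioo_subset_Icc_self
  exact Integrable.mono' h hf.aestronglyMeasurable (Eventually.of_forall hle)

lemma integrableOn_newton (R : ℝ) : IntegrableOn newton (Metric.ball 0 R) := by
  refine integrableOn_ball_of_le_norm_zpow measurable_newton (C := (4 * Real.pi)⁻¹) (k := 1)
    (by norm_num) (fun w => ?_) R
  rw [newton, Real.norm_of_nonneg (by positivity)]; simp

lemma integrableOn_gradNewton (R : ℝ) : IntegrableOn gradNewton (Metric.ball 0 R) := by
  rw [IntegrableOn, ← integrable_norm_iff measurable_gradNewton.aestronglyMeasurable]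
  refine integrableOn_ball_of_le_norm_zpow measurable_gradNewton.norm (C := (4 * Real.pi)⁻¹) (k := 2)
    le_rfl (fun w => ?_) R
  rw [norm_norm, norm_gradNewton]

lemma locallyIntegrable_of_ball {V : Type*} [NormedAddCommGroup V] {f : E3 → V}
    (h : ∀ R : ℝ, IntegrableOn f (Metric.ball 0 R)) : LocallyIntegrable f := by
  intro x
  exact ⟨Metric.ball 0 (‖x‖ + 1), Metric.isOpen_ball.mem_nhds (by simp), h _⟩

lemma locallyIntegrable_newton : LocallyIntegrable newton :=
  locallyIntegrable_of_ball integrableOn_newton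

lemma locallyIntegrable_gradNewton : LocallyIntegrable gradNewton :=
  locallyIntegrable_of_ball integrableOn_gradNewton

/-! ### Newton potentials of continuous functions -/

/-- The Newton potential of `f`. -/
def potential (f : E3 → ℝ) (s : E3) : ℝ := ∫ r, f r * newton (s - r)

/-- The gradient of the Newton potential of `f`. -/
def gradPotential (f : E3 → ℝ) (s : E3) : E3 := ∫ r, f r • gradNewton (s - r)

lemma potential_eq (f : E3 → ℝ) (s : E3) : potential f s = ∫ w, f (s - w) * newton w := by
  rw [potential, ← integral_sub_left_eq_self _ volume s]; simp

lemma gradPotential_eq (f : E3 → ℝ) (s : E3) :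
    gradPotential f s = ∫ w, f (s - w) • gradNewton w := by
  rw [gradPotential, ← integral_sub_left_eq_self _ volume s]; simp

lemma continuous_gradPotential {f : E3 → ℝ} (hf : Continuous f) (hc : HasCompactSupport f) :
    Continuous (gradPotential f) :=
  hc.continuous_convolution_left (ContinuousLinearMap.lsmul ℝ ℝ) hf locallyIntegrable_gradNewton

lemma integrable_mul_of_locallyIntegrable {V : Type*} [NormedAddCommGroup V] [NormedSpace ℝ V]
    {f : E3 → ℝ} (hf : Continuous f) (hc : HasCompactSupport f) {k : E3 → V}
    (hk : LocallyIntegrable k) (s : E3) : Integrable fun w => f (s - w) • k w := by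
  have h1 : Continuous fun w => f (s - w) := by fun_prop
  have h2 : HasCompactSupport fun w => f (s - w) := hc.comp_homeomorph (Homeomorph.subLeft s)
  exact hk.integrable_smul_left_of_hasCompactSupport h1 h2

lemma exists_ball_of_hasCompactSupport {f : E3 → ℝ} (hc : HasCompactSupport f) :
    ∃ R : ℝ, 0 < R ∧ ∀ r, R ≤ ‖r‖ → f r = 0 := by
  obtain ⟨R, hR, h⟩ := hc.isCompact.isBounded.exists_pos_norm_lt
  exact ⟨R, hR, fun r hr => image_eq_zero_of_notMem_tsupport fun h' => absurd (h r h') (by linarith)⟩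

lemma tendsto_regPotential {f : E3 → ℝ} (hf : Continuous f) (hc : HasCompactSupport f) (s : E3)
    {ε : ℕ → ℝ} (hε0 : ∀ n, 0 < ε n) (hε : Tendsto ε atTop (𝓝 0)) :
    Tendsto (fun n => ∫ w, f (s - w) * regNewton (ε n) w) atTop (𝓝 (potential f s)) := by
  rw [potential_eq]
  have hne : ∀ᵐ w : E3, w ≠ 0 := by
    simp [ae_iff]
  refine tendsto_integral_of_dominated_convergence (fun w => ‖f (s - w) * newton w‖) ?_ ?_ ?_ ?_
  · intro n
    have := continuous_regNewton (hε0 n)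
    exact (by fun_prop : Continuous fun w => f (s - w) * regNewton (ε n) w).aestronglyMeasurable
  · exact (integrable_mul_of_locallyIntegrable hf hc locallyIntegrable_newton s).norm
  · intro n
    filter_upwards [hne] with w hw
    rw [norm_mul, norm_mul]
    gcongr
    rw [Real.norm_of_nonneg (regNewton_nonneg w)]
    exact (regNewton_le_newton hw).trans (le_abs_self _)
  · filter_upwards [hne] with w hw
    exact ((tendsto_regNewton hw).comp hε).const_mul _

/-- Dominated convergence with majorant `2 ‖gradNewton‖`. Convergence of the kernels in `L¹` on
balls is what makes the gradients of the regularized potentials converge uniformly. -/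
lemma tendsto_integral_gradRegNewton_sub (R : ℝ) {ε : ℕ → ℝ} (hε0 : ∀ n, 0 < ε n)
    (hε : Tendsto ε atTop (𝓝 0)) :
    Tendsto (fun n => ∫ w in Metric.ball (0 : E3) R, ‖gradRegNewton (ε n) w - gradNewton w‖) atTop
      (𝓝 0) := by
  have hne : ∀ᵐ w ∂(volume.restrict (Metric.ball (0 : E3) R)), w ≠ 0 :=
    ae_restrict_of_ae (by simp [ae_iff])
  have h := tendsto_integral_of_dominated_convergence
    (F := fun n w => ‖gradRegNewton (ε n) w - gradNewton w‖) (f := fun _ => (0 : ℝ))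
    (μ := volume.restrict (Metric.ball (0 : E3) R)) (fun w => 2 * ‖gradNewton w‖) ?_ ?_ ?_ ?_
  · simpa using h
  · intro n
    exact ((continuous_gradRegNewton (hε0 n)).measurable.sub
      measurable_gradNewton).norm.aestronglyMeasurable
  · exact (integrableOn_gradNewton R).norm.const_mul 2
  · intro n
    refine Eventually.of_forall fun w => ?_
    rw [norm_norm]
    have := norm_gradRegNewton_le (ε := ε n) w
    linarith [norm_sub_le (gradRegNewton (ε n) w) (gradNewton w)]
  · filter_upwards [hne] with w hw
    have := (((tendsto_gradRegNewton hw).comp hε).sub_const (gradNewton w)).norm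
    simpa using this

/-- Since `f` is merely continuous, the derivative has to fall on the kernel. The regularized kernel
has a gradient bounded by a multiple of `ε⁻²`, so differentiation under the integral is legitimate.
-/
lemma hasFDerivAt_regPotential {f : E3 → ℝ} (hf : Continuous f) (hc : HasCompactSupport f)
    {ε : ℝ} (hε : 0 < ε) (s : E3) :
    HasFDerivAt (fun s => ∫ w, f (s - w) * regNewton ε w)
      (innerSL ℝ (∫ w, f (s - w) • gradRegNewton ε w)) s := by
  have e1 : (fun s => ∫ w, f (s - w) * regNewton ε w) = fun s => ∫ r, f r * regNewton ε (s - r) := by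
    ext s; rw [← integral_sub_left_eq_self _ volume s]; simp
  have e2 : ∫ w, f (s - w) • gradRegNewton ε w = ∫ r, f r • gradRegNewton ε (s - r) := by
    rw [← integral_sub_left_eq_self _ volume s]; simp
  have hcn := continuous_regNewton hε
  have hcg := continuous_gradRegNewton hε
  have hint : Integrable fun r => f r • gradRegNewton ε (s - r) :=
    Continuous.integrable_of_hasCompactSupport (by fun_prop) hc.smul_right
  have hb : ∀ w, ‖gradRegNewton ε w‖ ≤ (4 * Real.pi)⁻¹ * (ε ^ 2)⁻¹ := by
    intro w
    have h0 := regNorm_pos hε w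
    have : ‖gradRegNewton ε w‖ ≤ (4 * Real.pi)⁻¹ * (regNorm ε w ^ 3)⁻¹ * regNorm ε w := by
      rw [gradRegNewton, norm_smul, norm_neg, Real.norm_of_nonneg (by positivity)]
      gcongr
      exact norm_le_regNorm ε w
    calc _ ≤ _ := this
      _ = (4 * Real.pi)⁻¹ * (regNorm ε w ^ 2)⁻¹ := by field_simp
      _ ≤ _ := by gcongr; exact le_regNorm ε w
  rw [e1, e2, ← (innerSL ℝ : E3 →L[ℝ] _).integral_comp_comm hint]
  refine hasFDerivAt_integral_of_dominated_of_fderiv_le (s := univ)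
    (F' := fun s r => innerSL ℝ (f r • gradRegNewton ε (s - r)))
    (bound := fun r => ‖f r‖ * ((4 * Real.pi)⁻¹ * (ε ^ 2)⁻¹)) univ_mem ?_ ?_ ?_ ?_ ?_ ?_
  · refine Eventually.of_forall fun s => ?_
    exact (by fun_prop : Continuous fun r => f r * regNewton ε (s - r)).aestronglyMeasurable
  · exact Continuous.integrable_of_hasCompactSupport (by fun_prop) hc.mul_right
  · exact (by fun_prop : Continuous fun r => innerSL ℝ (f r • gradRegNewton ε (s - r))).aestronglyMeasurable
  · refine Eventually.of_forall fun r s _ => ?_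
    rw [innerSL_apply_norm, norm_smul]
    gcongr
    exact hb _
  · exact (hf.integrable_of_hasCompactSupport hc).norm.mul_const _
  · refine Eventually.of_forall fun r s _ => ?_
    have h1 : HasFDerivAt (fun s => regNewton ε (s - r)) (innerSL ℝ (gradRegNewton ε (s - r))) s := by
      have h2 := (hasFDerivAt_regNewton hε (s - r)).comp s ((hasFDerivAt_id s).sub_const r)
      rwa [ContinuousLinearMap.comp_id] at h2
    refine (h1.const_mul (f r)).congr_fderiv ?_
    simp

/-- The Newton potential of a continuous function of compact support is differentiable. -/
lemma hasFDerivAt_potential {f : E3 → ℝ} (hf : Continuous f) (hc : HasCompactSupport f) (s : E3) :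
    HasFDerivAt (potential f) (innerSL ℝ (gradPotential f s)) s := by
  obtain ⟨R, hR, hfR⟩ := exists_ball_of_hasCompactSupport hc
  obtain ⟨C, hC⟩ := hf.bounded_above_of_compact_support hc
  have hC0 : 0 ≤ C := (norm_nonneg _).trans (hC 0)
  let ε : ℕ → ℝ := fun n => 1 / ((n : ℝ) + 1)
  have hε0 : ∀ n, 0 < ε n := fun n => by positivity
  have hε : Tendsto ε atTop (𝓝 0) := tendsto_one_div_add_atTop_nhds_zero_nat
  let Q : ℝ := ‖s‖ + 1
  refine hasFDerivAt_of_tendstoUniformlyOn (l := atTop) (s := Metric.ball (0 : E3) Q)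
    (f := fun n s => ∫ w, f (s - w) * regNewton (ε n) w)
    (f' := fun n s => innerSL ℝ (∫ w, f (s - w) • gradRegNewton (ε n) w))
    (g' := fun s => innerSL ℝ (gradPotential f s))
    Metric.isOpen_ball ?_ (fun n x _ => hasFDerivAt_regPotential hf hc (hε0 n) x)
    (fun x _ => tendsto_regPotential hf hc x hε0 hε) (by simp [Q])
  -- For `x` in the ball of radius `Q` only `w` in the ball of radius `Q + R` contribute, so the
  -- gradients differ by at most `sup |f|` times the `L¹` distance of the kernels on that ball,
  -- whatever `x` is.
  rw [Metric.tendstoUniformlyOn_iff]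
  intro δ hδ
  have ht := (tendsto_integral_gradRegNewton_sub (Q + R) hε0 hε).const_mul C
  rw [mul_zero] at ht
  filter_upwards [ht.eventually_lt_const hδ] with n hn x hx
  refine lt_of_le_of_lt ?_ hn
  rw [dist_eq_norm, ← map_sub, innerSL_apply_norm, gradPotential_eq, ← integral_sub]
  rotate_left
  · exact integrable_mul_of_locallyIntegrable hf hc locallyIntegrable_gradNewton x
  · exact integrable_mul_of_locallyIntegrable hf hc
      (continuous_gradRegNewton (hε0 n)).locallyIntegrable x
  have hz : ∀ w, w ∉ Metric.ball (0 : E3) (Q + R) → f (x - w) = 0 := by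
    intro w hw
    apply hfR
    simp only [Metric.mem_ball, dist_zero_right, not_lt] at hw hx
    have := norm_sub_norm_le w x
    rw [norm_sub_rev] at this
    linarith
  rw [← setIntegral_eq_integral_of_forall_compl_eq_zero (s := Metric.ball (0 : E3) (Q + R))
    (fun w hw => by simp [hz w hw]), ← integral_const_mul]
  refine norm_integral_le_of_norm_le ?_ (Eventually.of_forall fun w => ?_)
  · have h1 : IntegrableOn (gradRegNewton (ε n)) (Metric.ball 0 (Q + R)) :=
      ((continuous_gradRegNewton (hε0 n)).locallyIntegrable.integrableOn_isCompact
        (isCompact_closedBall 0 (Q + R))).mono_set Metric.ball_subset_closedBall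
    exact (h1.sub (integrableOn_gradNewton _)).norm.const_mul C
  · rw [← smul_sub, norm_smul, norm_sub_rev]
    gcongr
    exact hC _

/-- This fixes the class of test functions for the sources: it is enough that they converge on `C¹`
functions, and a first-order Taylor expansion is available for these. -/
lemma contDiff_potential {f : E3 → ℝ} (hf : Continuous f) (hc : HasCompactSupport f) :
    ContDiff ℝ 1 (potential f) := by
  rw [contDiff_one_iff_fderiv]
  refine ⟨fun s => (hasFDerivAt_potential hf hc s).differentiableAt, ?_⟩
  have : fderiv ℝ (potential f) = fun s => innerSL ℝ (gradPotential f s) :=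
    funext fun s => (hasFDerivAt_potential hf hc s).fderiv
  rw [this]
  have := continuous_gradPotential hf hc
  fun_prop

/-! ### The Newton potential inverts the Laplacian -/

lemma two_le_infty : (2 : ℕ∞ω) ≤ ∞ :=
  WithTop.coe_le_coe.2 (le_top : (2 : ℕ∞) ≤ ⊤)

/-- The partial derivative in the `i`-th coordinate direction. -/
def partialD {n : ℕ} (i : Fin n) (f : EuclideanSpace ℝ (Fin n) → ℝ) (x : EuclideanSpace ℝ (Fin n)) :
    ℝ :=
  fderiv ℝ f x (EuclideanSpace.single i 1)

lemma contDiff_partialD {n : ℕ} {f : EuclideanSpace ℝ (Fin n) → ℝ} (hf : ContDiff ℝ ∞ f)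
    (i : Fin n) : ContDiff ℝ ∞ (partialD i f) :=
  (hf.fderiv_right (m := ∞) (by norm_num)).clm_apply contDiff_const

lemma hasCompactSupport_partialD {n : ℕ} {f : EuclideanSpace ℝ (Fin n) → ℝ}
    (hf : HasCompactSupport f) (i : Fin n) : HasCompactSupport (partialD i f) :=
  hf.fderiv_apply ℝ _

lemma laplacian_eq_sum_partialD {f : E3 → ℝ} (hf : ContDiff ℝ 2 f) (x : E3) :
    Laplacian.laplacian f x = ∑ i, partialD i (partialD i f) x := by
  rw [InnerProductSpace.laplacian_eq_iteratedFDeriv_orthonormalBasis f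
    (EuclideanSpace.basisFun (Fin 3) ℝ)]
  refine Finset.sum_congr rfl fun i _ => ?_
  have h1 : DifferentiableAt ℝ (fderiv ℝ f) x :=
    ((hf.fderiv_right (m := 1) (by norm_num)).differentiable (by norm_num)).differentiableAt
  rw [iteratedFDeriv_two_apply]
  simp only [partialD, EuclideanSpace.basisFun_apply]
  have h2 := h1.hasFDerivAt.clm_apply (hasFDerivAt_const (EuclideanSpace.single i (1 : ℝ)) x)
  unfold partialD
  rw [h2.fderiv]
  simp

lemma continuous_laplacian {f : E3 → ℝ} (hf : ContDiff ℝ ∞ f) :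
    Continuous (Laplacian.laplacian f) := by
  have : Laplacian.laplacian f = fun x => ∑ i, partialD i (partialD i f) x :=
    funext fun x => laplacian_eq_sum_partialD (hf.of_le two_le_infty) x
  rw [this]
  exact continuous_finsetSum _ fun i _ => (contDiff_partialD (contDiff_partialD hf i) i).continuous

lemma hasCompactSupport_laplacian {f : E3 → ℝ} (hf : ContDiff ℝ ∞ f) (hc : HasCompactSupport f) :
    HasCompactSupport (Laplacian.laplacian f) := by
  have : Laplacian.laplacian f = fun x => ∑ i, partialD i (partialD i f) x :=
    funext fun x => laplacian_eq_sum_partialD (hf.of_le two_le_infty) x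
  rw [this]
  refine hc.mono' fun x hx => ?_
  by_contra h
  apply hx
  refine Finset.sum_eq_zero fun i _ => ?_
  have h1 := tsupport_fderiv_apply_subset ℝ (f := f) (EuclideanSpace.single i (1 : ℝ))
  have h2 := tsupport_fderiv_apply_subset ℝ (f := partialD i f) (EuclideanSpace.single i (1 : ℝ))
  exact image_eq_zero_of_notMem_tsupport (f := partialD i (partialD i f))
    fun h' => h (h1 (h2 h'))

/-! ### The Laplacian of the regularized kernel as an approximate identity. -/

/-- The (positive) Laplacian of the regularized Newton kernel. -/
def bumpNewton (ε : ℝ) (w : E3) : ℝ := (4 * Real.pi)⁻¹ * (3 * ε ^ 2 * (regNorm ε w ^ 5)⁻¹)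

lemma hasFDerivAt_gradRegNewton_apply {ε : ℝ} (hε : 0 < ε) (i : Fin 3) (w : E3) :
    ∃ L : E3 →L[ℝ] ℝ, HasFDerivAt (fun w => gradRegNewton ε w i) L w ∧
      L (EuclideanSpace.single i 1) =
        -(4 * Real.pi)⁻¹ * ((regNorm ε w ^ 3)⁻¹ - 3 * w i ^ 2 * (regNorm ε w ^ 5)⁻¹) := by
  have h0 := regNorm_pos hε w
  have h1 := ((hasDerivAt_pow 3 (regNorm ε w)).fun_inv (pow_ne_zero 3 h0.ne')).comp_hasFDerivAt w
    (hasFDerivAt_regNorm hε w)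
  have h2 := (h1.const_mul ((4 * Real.pi)⁻¹)).neg.mul
    (EuclideanSpace.proj (𝕜 := ℝ) (ι := Fin 3) i).hasFDerivAt
  refine ⟨_, h2, ?_⟩
  simp [EuclideanSpace.inner_single_right]
  field_simp
  ring

lemma continuous_partialD {n : ℕ} {f : EuclideanSpace ℝ (Fin n) → ℝ} (hf : ContDiff ℝ 1 f)
    (i : Fin n) : Continuous (partialD i f) :=
  (hf.continuous_fderiv (by norm_num)).clm_apply continuous_const

lemma integral_mul_partialD {u g : E3 → ℝ} (hu : ContDiff ℝ 1 u) (hg : ContDiff ℝ 1 g)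
    (hc : HasCompactSupport g) (i : Fin 3) :
    ∫ r, u r * partialD i g r = -∫ r, partialD i u r * g r := by
  have h1 := hu.continuous
  have h2 := hg.continuous
  have h3 := continuous_partialD hu i
  have h4 := continuous_partialD hg i
  have c4 := hasCompactSupport_partialD hc i
  refine integral_mul_fderiv_eq_neg_fderiv_mul_of_integrable
    (Continuous.integrable_of_hasCompactSupport (h3.mul h2) hc.mul_left)
    (Continuous.integrable_of_hasCompactSupport (h1.mul h4) c4.mul_left)
    (Continuous.integrable_of_hasCompactSupport (h1.mul h2) hc.mul_left)
    (fun r _ => (hu.differentiable (by norm_num)).differentiableAt)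
    (fun r _ => (hg.differentiable (by norm_num)).differentiableAt)

lemma integral_mul_laplacian {u φ : E3 → ℝ} (hu : ContDiff ℝ 2 u)
    (hu' : ∀ i, ContDiff ℝ 1 (partialD i u)) (hφ : ContDiff ℝ ∞ φ) (hc : HasCompactSupport φ) :
    ∫ r, u r * Laplacian.laplacian φ r = ∫ r, (∑ i, partialD i (partialD i u) r) * φ r := by
  have hu1 : ContDiff ℝ 1 u := hu.of_le (by norm_num)
  have hφ1 : ContDiff ℝ 1 φ := hφ.of_le (by norm_num)
  have d1 := fun i => contDiff_partialD hφ i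
  have d1' : ∀ i, ContDiff ℝ 1 (partialD i φ) := fun i => (d1 i).of_le (by norm_num)
  have c1 := fun i => hasCompactSupport_partialD hc i
  simp_rw [laplacian_eq_sum_partialD (hφ.of_le two_le_infty), Finset.mul_sum,
    Finset.sum_mul]
  rw [integral_finsetSum, integral_finsetSum]
  · refine Finset.sum_congr rfl fun i _ => ?_
    rw [integral_mul_partialD hu1 (d1' i) (c1 i), integral_mul_partialD (hu' i) hφ1 hc, neg_neg]
  · intro i _
    exact Continuous.integrable_of_hasCompactSupport
      ((continuous_partialD (hu' i) i).mul hφ1.continuous) hc.mul_left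
  · intro i _
    exact Continuous.integrable_of_hasCompactSupport
      (hu.continuous.mul (continuous_partialD (d1' i) i))
      (hasCompactSupport_partialD (c1 i) i).mul_left

lemma contDiff_regNorm {ε : ℝ} (hε : 0 < ε) {n : ℕ∞ω} : ContDiff ℝ n (regNorm ε) :=
  ((contDiff_norm_sq ℝ).add contDiff_const).sqrt fun w => by positivity

lemma contDiff_regNewton {ε : ℝ} (hε : 0 < ε) {n : ℕ∞ω} : ContDiff ℝ n (regNewton ε) :=
  contDiff_const.mul ((contDiff_regNorm hε).inv fun w => (regNorm_pos hε w).ne')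

lemma contDiff_gradRegNewton_apply {ε : ℝ} (hε : 0 < ε) {n : ℕ∞ω} (i : Fin 3) :
    ContDiff ℝ n (fun w => gradRegNewton ε w i) := by
  have h1 : ContDiff ℝ n (fun w => (regNorm ε w ^ 3)⁻¹) :=
    ((contDiff_regNorm hε).pow 3).inv fun w => pow_ne_zero _ (regNorm_pos hε w).ne'
  have h2 : ContDiff ℝ n (fun w : E3 => w i) := by fun_prop
  simp only [gradRegNewton, PiLp.smul_apply, smul_eq_mul]
  fun_prop

/-- Integration by parts twice, then the trace of the Hessian of the regularized kernel. With `ρ =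
regNorm ε w`, summing `ρ⁻³ - 3 wᵢ² ρ⁻⁵` gives `3 (ρ² - ‖w‖²) ρ⁻⁵ = 3 ε² ρ⁻⁵`. -/
lemma integral_laplacian_mul_regNewton {φ : E3 → ℝ} (hφ : ContDiff ℝ ∞ φ) (hc : HasCompactSupport φ)
    {ε : ℝ} (hε : 0 < ε) (s : E3) :
    ∫ r, Laplacian.laplacian φ r * regNewton ε (s - r) = -∫ r, bumpNewton ε (s - r) * φ r := by
  have hsub : ∀ r : E3, HasFDerivAt (fun r => s - r) (-ContinuousLinearMap.id ℝ E3) r := fun r =>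
    (hasFDerivAt_id r).const_sub s
  have h1 : ∀ i, partialD i (fun r => regNewton ε (s - r)) = fun r => -gradRegNewton ε (s - r) i := by
    intro i
    ext r
    have hd : HasFDerivAt (fun r => regNewton ε (s - r)) _ r :=
      (hasFDerivAt_regNewton hε (s - r)).comp r (hsub r)
    rw [partialD, hd.fderiv]
    simp [EuclideanSpace.inner_single_right]
  have h2 : ∀ i, partialD i (fun r => -gradRegNewton ε (s - r) i) = fun r =>
      -((4 * Real.pi)⁻¹ * ((regNorm ε (s - r) ^ 3)⁻¹
          - 3 * (s - r) i ^ 2 * (regNorm ε (s - r) ^ 5)⁻¹)) := by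
    intro i
    ext r
    obtain ⟨L, hL, hL'⟩ := hasFDerivAt_gradRegNewton_apply hε i (s - r)
    have hd : HasFDerivAt (fun r => -gradRegNewton ε (s - r) i) _ r := (hL.comp r (hsub r)).fun_neg
    rw [partialD, hd.fderiv]
    simp only [ContinuousLinearMap.comp_apply, neg_apply,
        ContinuousLinearMap.id_apply, map_neg, hL']
    ring
  have hc1 : ∀ i, ContDiff ℝ 1 (partialD i fun r => regNewton ε (s - r)) := by
    intro i
    rw [h1]
    exact ((contDiff_gradRegNewton_apply hε i).comp (contDiff_const.sub contDiff_id)).neg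
  simp_rw [mul_comm (Laplacian.laplacian φ _)]
  rw [integral_mul_laplacian (u := fun r => regNewton ε (s - r))
    ((contDiff_regNewton hε).comp (contDiff_const.sub contDiff_id)) hc1 hφ hc, ← integral_neg]
  congr 1
  ext r
  simp_rw [h1, h2]
  have h5 := regNorm_sq ε (s - r)
  have h0 := regNorm_pos hε (s - r)
  rw [EuclideanSpace.norm_sq_eq] at h5
  simp only [Fin.sum_univ_three, bumpNewton, Real.norm_eq_abs, sq_abs] at h5 ⊢
  have h6 : (regNorm ε (s - r) ^ 3)⁻¹ = regNorm ε (s - r) ^ 2 * (regNorm ε (s - r) ^ 5)⁻¹ := by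
    field_simp
  rw [h6, h5]
  ring

/-- The integrand has the primitive `(y / √(y² + 1)) ^ 3`, which rises from `0` to `1`. -/
lemma integrable_one_add_sq_pow : IntegrableOn (fun y : ℝ => 3 * y ^ 2 * (Real.sqrt (y ^ 2 + 1) ^ 5)⁻¹)
      (Ioi 0) ∧ ∫ y in Ioi (0 : ℝ), 3 * y ^ 2 * (Real.sqrt (y ^ 2 + 1) ^ 5)⁻¹ = 1 := by
  have hd : ∀ y : ℝ, HasDerivAt (fun y : ℝ => (y / Real.sqrt (y ^ 2 + 1)) ^ 3)
      (3 * y ^ 2 * (Real.sqrt (y ^ 2 + 1) ^ 5)⁻¹) y := by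
    intro y
    have h0 : (0 : ℝ) < y ^ 2 + 1 := by positivity
    have h1 := ((hasDerivAt_pow 2 y).add_const (1 : ℝ)).sqrt h0.ne'
    have h2 := ((hasDerivAt_id y).div h1 (Real.sqrt_pos.2 h0).ne').pow 3
    refine h2.congr_deriv ?_
    have h3 := Real.sq_sqrt h0.le
    have h4 := Real.sqrt_pos.2 h0
    simp
    field_simp
    rw [h3]; ring
  have ht : Tendsto (fun y : ℝ => (y / Real.sqrt (y ^ 2 + 1)) ^ 3) atTop (𝓝 1) := by
    have h1 : Tendsto (fun y : ℝ => 1 / Real.sqrt (1 + (y⁻¹) ^ 2)) atTop (𝓝 1) := by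
      have : Continuous fun t : ℝ => 1 / Real.sqrt (1 + t ^ 2) := by
        fun_prop (disch := intros; positivity)
      simpa [Function.comp_def] using (this.tendsto 0).comp tendsto_inv_atTop_zero
    have h2 := h1.pow 3
    rw [one_pow] at h2
    refine h2.congr' ?_
    filter_upwards [eventually_gt_atTop 0] with y hy
    congr 1
    have : y ^ 2 + 1 = y ^ 2 * (1 + (y⁻¹) ^ 2) := by field_simp
    rw [this, Real.sqrt_mul (by positivity), Real.sqrt_sq hy.le]
    field_simp
  have hpos : ∀ y ∈ Ioi (0 : ℝ), 0 ≤ 3 * y ^ 2 * (Real.sqrt (y ^ 2 + 1) ^ 5)⁻¹ :=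
    fun y _ => by positivity
  refine ⟨integrableOn_Ioi_deriv_of_nonneg' (fun y _ => hd y) hpos ht, ?_⟩
  rw [integral_Ioi_of_hasDerivAt_of_nonneg' (fun y _ => hd y) hpos ht]
  simp

lemma bumpNewton_one_eq (w : E3) :
    bumpNewton 1 w = (fun y : ℝ => (4 * Real.pi)⁻¹ * (3 * (Real.sqrt (y ^ 2 + 1) ^ 5)⁻¹)) ‖w‖ := by
  simp [bumpNewton, regNorm]

lemma integrable_bumpNewton_one : Integrable (bumpNewton 1) := by
  simp_rw [funext bumpNewton_one_eq]
  refine (integrable_fun_norm_addHaar volume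
    (f := fun y : ℝ => (4 * Real.pi)⁻¹ * (3 * (Real.sqrt (y ^ 2 + 1) ^ 5)⁻¹))).2 ?_
  refine (integrable_one_add_sq_pow.1.const_mul ((4 * Real.pi)⁻¹)).congr
    (Eventually.of_forall fun y => ?_)
  simp; ring

/-- The area `4π` of the unit sphere, here three times the volume of the ball, cancels the
normalization of the kernel. -/
lemma integral_bumpNewton_one : ∫ w, bumpNewton 1 w = 1 := by
  simp_rw [funext bumpNewton_one_eq]
  rw [integral_fun_norm_addHaar volume
    (f := fun y : ℝ => (4 * Real.pi)⁻¹ * (3 * (Real.sqrt (y ^ 2 + 1) ^ 5)⁻¹))]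
  have hv : (volume : Measure E3).real (Metric.ball 0 1) = 4 / 3 * Real.pi := by
    rw [measureReal_def, EuclideanSpace.volume_ball_fin_three]
    simp
    rw [ENNReal.toReal_ofReal (by positivity)]; ring
  have : ∫ y in Ioi (0 : ℝ), y ^ (Module.finrank ℝ E3 - 1) • ((4 * Real.pi)⁻¹ *
      (3 * (Real.sqrt (y ^ 2 + 1) ^ 5)⁻¹)) = (4 * Real.pi)⁻¹ := by
    conv_rhs => rw [← mul_one (4 * Real.pi)⁻¹, ← integrable_one_add_sq_pow.2, ← integral_const_mul]
    refine integral_congr_ae (Eventually.of_forall fun y => ?_)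
    simp; ring
  rw [this, hv]
  have := Real.pi_pos
  simp
  field_simp

/-- Scaling by `ε` replaces the concentrating weight by the fixed integrable weight `bumpNewton 1`,
evaluated against `φ (s - ε w)`; dominated convergence applies. -/
lemma tendsto_integral_bumpNewton {φ : E3 → ℝ} (hφ : Continuous φ) (hc : HasCompactSupport φ) (s : E3)
    {ε : ℕ → ℝ} (hε0 : ∀ n, 0 < ε n) (hε : Tendsto ε atTop (𝓝 0)) :
    Tendsto (fun n => ∫ r, bumpNewton (ε n) (s - r) * φ r) atTop (𝓝 (φ s)) := by
  obtain ⟨C, hC⟩ := hφ.bounded_above_of_compact_support hc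
  have hm : Measurable (bumpNewton 1) := by
    have := (continuous_regNorm 1).measurable
    unfold bumpNewton; fun_prop
  have e : ∀ n, ∫ r, bumpNewton (ε n) (s - r) * φ r = ∫ w, bumpNewton 1 w * φ (s - ε n • w) := by
    intro n
    rw [← integral_sub_left_eq_self _ volume s]
    have h1 := Measure.integral_comp_smul (volume : Measure E3)
      (fun w => bumpNewton (ε n) w * φ (s - w)) (ε n)
    simp only [sub_sub_cancel]
    have hp := hε0 n
    have h3 : Module.finrank ℝ E3 = 3 := by simp
    have h4 : ∫ w, bumpNewton (ε n) w * φ (s - w) =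
        ε n ^ 3 * ∫ w, bumpNewton (ε n) (ε n • w) * φ (s - ε n • w) := by
      rw [h1, h3, abs_of_pos (by positivity)]
      simp only [smul_eq_mul]
      field_simp
    rw [h4, ← integral_const_mul]
    congr 1
    ext w
    have h5 : regNorm (ε n) (ε n • w) = ε n * regNorm 1 w := by
      rw [regNorm, regNorm, norm_smul, Real.norm_of_nonneg hp.le, ← Real.sqrt_sq hp.le,
        ← Real.sqrt_mul (by positivity), Real.sqrt_sq hp.le]
      congr 1; ring
    rw [bumpNewton, bumpNewton, h5]
    have := regNorm_pos one_pos w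
    field_simp
  simp_rw [e]
  have hlim : φ s = ∫ w, bumpNewton 1 w * φ s := by
    rw [integral_mul_const, integral_bumpNewton_one, one_mul]
  rw [hlim]
  refine tendsto_integral_of_dominated_convergence (fun w => C * ‖bumpNewton 1 w‖) ?_ ?_ ?_ ?_
  · intro n
    exact (hm.mul (by fun_prop)).aestronglyMeasurable
  · exact integrable_bumpNewton_one.norm.const_mul C
  · intro n
    refine Eventually.of_forall fun w => ?_
    rw [norm_mul, mul_comm]
    gcongr
    exact hC _
  · refine Eventually.of_forall fun w => Tendsto.const_mul _ ?_
    have : Continuous fun t : ℝ => φ (s - t • w) := by fun_prop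
    simpa [Function.comp_def] using (this.tendsto 0).comp hε

/-- Green's representation: the Newton potential of `-Δφ` is `φ`. -/
theorem potential_neg_laplacian {φ : E3 → ℝ} (hφ : ContDiff ℝ ∞ φ) (hc : HasCompactSupport φ) :
    potential (fun r => -Laplacian.laplacian φ r) = φ := by
  ext s
  let ε : ℕ → ℝ := fun n => 1 / ((n : ℝ) + 1)
  have hε0 : ∀ n, 0 < ε n := fun n => by positivity
  have hε : Tendsto ε atTop (𝓝 0) := tendsto_one_div_add_atTop_nhds_zero_nat
  have h1 := tendsto_regPotential (continuous_laplacian hφ).neg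
    (hasCompactSupport_laplacian hφ hc).neg s hε0 hε
  refine tendsto_nhds_unique h1 ((tendsto_integral_bumpNewton hφ.continuous hc s hε0 hε).congr
    fun n => ?_)
  rw [← integral_sub_left_eq_self (fun w => _ * regNewton (ε n) w) volume s]
  simp only [sub_sub_cancel, Pi.neg_apply, neg_mul]
  rw [integral_neg, integral_laplacian_mul_regNewton hφ hc (hε0 n), neg_neg]

/-! ### Uniqueness for Poisson's equation -/

/-- If the second derivative along the line were positive, the point would also be a local minimum
on the line, hence the function constant there and its second derivative zero. -/
lemma partialD_partialD_nonpos_of_isLocalMax {v : E3 → ℝ} (hv : ContDiff ℝ 1 v) {y : E3} (i : Fin 3)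
    (hv' : DifferentiableAt ℝ (partialD i v) y) (hy : IsLocalMax v y) :
    partialD i (partialD i v) y ≤ 0 := by
  by_contra! hpos
  let e : E3 := EuclideanSpace.single i 1
  have hl : ∀ t : ℝ, HasDerivAt (fun t : ℝ => y + t • e) e t := fun t => by
    simpa using ((hasDerivAt_id t).smul_const e).const_add y
  have hd : ∀ t, HasDerivAt (fun t : ℝ => v (y + t • e)) (partialD i v (y + t • e)) t := fun t =>
    (hv.differentiable (by norm_num)).differentiableAt.hasFDerivAt.comp_hasDerivAt t (hl t)
  have hd1 : deriv (fun t : ℝ => v (y + t • e)) = fun t => partialD i v (y + t • e) :=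
    funext fun t => (hd t).deriv
  have hd2 : HasDerivAt (fun t : ℝ => partialD i v (y + t • e)) (partialD i (partialD i v) y) 0 := by
    have h0 : HasFDerivAt (partialD i v) (fderiv ℝ (partialD i v) y) (y + (0 : ℝ) • e) := by
      simpa using hv'.hasFDerivAt
    exact h0.comp_hasDerivAt (0 : ℝ) (hl 0)
  have hmax : IsLocalMax (fun t : ℝ => v (y + t • e)) 0 := by
    have hc : ContinuousAt (fun t : ℝ => y + t • e) 0 := (hl 0).continuousAt
    have : Tendsto (fun t : ℝ => y + t • e) (𝓝 0) (𝓝 y) := by simpa [ContinuousAt] using hc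
    have h1 := this.eventually hy
    simpa [IsLocalMax, IsMaxFilter] using h1
  have hmin : IsLocalMin (fun t : ℝ => v (y + t • e)) 0 :=
    isLocalMin_of_deriv_deriv_pos (by rw [hd1, hd2.deriv]; exact hpos) hmax.deriv_eq_zero
      (hd 0).continuousAt
  have hconst : (fun t : ℝ => v (y + t • e)) =ᶠ[𝓝 0] fun _ => v (y + (0 : ℝ) • e) := by
    filter_upwards [hmax, hmin] with t h1 h2 using le_antisymm h1 h2
  have h3 : deriv (deriv (fun t : ℝ => v (y + t • e))) 0 = 0 := by
    rw [hconst.deriv.deriv_eq]; simp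
  rw [hd1, hd2.deriv] at h3
  exact hpos.ne' h3

lemma partialD_add_const_mul_norm_sq {u : E3 → ℝ} (hu : Differentiable ℝ u) (ε : ℝ) (i : Fin 3) :
    partialD i (fun x => u x + ε * ‖x‖ ^ 2) = fun x => partialD i u x + ε * (2 * x i) := by
  ext x
  have h1 : HasFDerivAt (fun x => u x + ε * ‖x‖ ^ 2) _ x :=
    (hu x).hasFDerivAt.add ((hasStrictFDerivAt_norm_sq x).hasFDerivAt.const_mul ε)
  rw [partialD, h1.fderiv]
  simp [partialD, EuclideanSpace.inner_single_right]

/-- The maximum principle for functions vanishing at infinity. -/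
lemma nonpos_of_sum_partialD_eq_zero {u : E3 → ℝ} (hu : ContDiff ℝ 2 u)
    (hu' : ∀ i, ContDiff ℝ 1 (partialD i u)) (hz : ∀ x, ∑ i, partialD i (partialD i u) x = 0)
    (h0 : Tendsto u (cocompact E3) (𝓝 0)) (x : E3) : u x ≤ 0 := by
  by_contra! hx
  have h1 := h0.eventually_lt_const (half_pos hx)
  rw [Filter.Eventually, mem_cocompact] at h1
  obtain ⟨K, hK, hKs⟩ := h1
  obtain ⟨R₀, hR₀⟩ := hK.isBounded.subset_closedBall 0
  let R : ℝ := max R₀ ‖x‖ + 1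
  have hR : ∀ y : E3, R ≤ ‖y‖ → u y < u x / 2 := by
    intro y hy
    refine hKs fun hyK => ?_
    have h2 := hR₀ hyK
    rw [mem_closedBall_zero_iff] at h2
    have := le_max_left R₀ ‖x‖
    simp only [R] at hy
    linarith
  have hxR : ‖x‖ < R := by
    have := le_max_right R₀ ‖x‖
    simp only [R]; linarith
  have hR0 : 0 < R := (norm_nonneg x).trans_lt hxR
  -- On the ball of radius `R` the term `ε ‖y‖²` is at most `u x / 4`, while `u < u x / 2` from the
  -- sphere outwards. The maximum of `v` is therefore interior, where the Laplacian of `v` equals `6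
  -- ε > 0`.
  let ε : ℝ := u x / (4 * R ^ 2)
  have hε : 0 < ε := by positivity
  have hεR : ε * R ^ 2 = u x / 4 := by simp only [ε]; field_simp
  let v : E3 → ℝ := fun y => u y + ε * ‖y‖ ^ 2
  have hvc : ContDiff ℝ 1 v := (hu.of_le (by norm_num)).add (contDiff_const.mul (contDiff_norm_sq ℝ))
  obtain ⟨y, hyB, hy⟩ := (isCompact_closedBall (0 : E3) R).exists_isMaxOn
    ⟨x, by simpa using hxR.le⟩ hvc.continuous.continuousOn
  have hvx : u x ≤ v y := by
    have := hy (show x ∈ Metric.closedBall 0 R by simpa using hxR.le)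
    have h3 : u x ≤ v x := by simp only [v]; nlinarith [sq_nonneg ‖x‖]
    exact h3.trans this
  have hyR : ‖y‖ < R := by
    by_contra! hge
    rw [mem_closedBall_zero_iff] at hyB
    have h4 := hR y hge
    have h5 : ‖y‖ ^ 2 ≤ R ^ 2 := by gcongr
    have h6 : v y ≤ u y + ε * R ^ 2 := by simp only [v]; gcongr
    linarith
  have hloc : IsLocalMax v y := by
    refine hy.isLocalMax ?_
    exact mem_of_superset (Metric.isOpen_ball.mem_nhds (by simpa using hyR))
      Metric.ball_subset_closedBall
  have hp : ∀ i, partialD i v = fun x => partialD i u x + ε * (2 * x i) := fun i =>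
    partialD_add_const_mul_norm_sq (hu.differentiable (by norm_num)) ε i
  have hd : ∀ i, HasFDerivAt (partialD i v)
      (fderiv ℝ (partialD i u) y + ε • ((2 : ℝ) • EuclideanSpace.proj (𝕜 := ℝ) (ι := Fin 3) i)) y := by
    intro i
    rw [hp]
    exact ((hu' i).differentiable (by norm_num)).differentiableAt.hasFDerivAt.add
      (((EuclideanSpace.proj (𝕜 := ℝ) (ι := Fin 3) i).hasFDerivAt.const_mul 2).const_mul ε)
  have hs : ∀ i, partialD i (partialD i u) y + ε * 2 ≤ 0 := by
    intro i
    have := partialD_partialD_nonpos_of_isLocalMax hvc i (hd i).differentiableAt hloc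
    rw [partialD, (hd i).fderiv] at this
    simpa [partialD] using this
  have := Finset.sum_le_sum fun i (_ : i ∈ Finset.univ) => hs i
  rw [Finset.sum_add_distrib, hz] at this
  simp at this
  linarith

/-! ### Mollification and weakly harmonic functions. -/

/-- The mollification of `w` by `η`. -/
def mollify (w η : E3 → ℝ) (x : E3) : ℝ := ∫ t, w t * η (x - t)

lemma contDiff_mollify {w η : E3 → ℝ} (hw : LocallyIntegrable w) (hη : ContDiff ℝ ∞ η)
    (hc : HasCompactSupport η) : ContDiff ℝ ∞ (mollify w η) :=
  hc.contDiff_convolution_right (ContinuousLinearMap.mul ℝ ℝ) hw hη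

lemma partialD_mollify {w η : E3 → ℝ} (hw : LocallyIntegrable w) (hη : ContDiff ℝ ∞ η)
    (hc : HasCompactSupport η) (i : Fin 3) :
    partialD i (mollify w η) = mollify w (partialD i η) := by
  ext x
  have h1 := hc.hasFDerivAt_convolution_right (ContinuousLinearMap.mul ℝ ℝ) hw
    (hη.of_le (by norm_num)) x
  have h2 := (hc.fderiv ℝ).convolutionExists_right ((ContinuousLinearMap.mul ℝ ℝ).precompR E3) hw
    (hη.continuous_fderiv (by norm_num)) x
  have h3 : HasFDerivAt (mollify w η) _ x := h1
  rw [partialD, h3.fderiv, convolution_def, ContinuousLinearMap.integral_apply h2]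
  rfl

lemma partialD_comp_sub_left {g : E3 → ℝ} (hg : Differentiable ℝ g) (i : Fin 3) (x : E3) :
    partialD i (fun t => g (x - t)) = fun t => -partialD i g (x - t) := by
  ext t
  have h1 : HasFDerivAt (fun t => g (x - t)) _ t :=
    (hg (x - t)).hasFDerivAt.comp t ((hasFDerivAt_id t).const_sub x)
  rw [partialD, h1.fderiv]
  simp [partialD]

lemma laplacian_comp_sub_left {g : E3 → ℝ} (hg : ContDiff ℝ ∞ g) (x t : E3) :
    Laplacian.laplacian (fun t => g (x - t)) t = Laplacian.laplacian g (x - t) := by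
  have hgs : ContDiff ℝ 2 fun t => g (x - t) :=
    (hg.of_le two_le_infty).comp (contDiff_const.sub contDiff_id)
  rw [laplacian_eq_sum_partialD (hg.of_le two_le_infty), laplacian_eq_sum_partialD hgs]
  refine Finset.sum_congr rfl fun i _ => ?_
  have hgi := contDiff_partialD hg i
  have h2 := partialD_comp_sub_left (hgi.neg.differentiable (by norm_num)) i x
  have h3 : partialD i (fun t => -partialD i g t) = fun t => -partialD i (partialD i g) t := by
    ext t; rw [partialD, fderiv_fun_neg]; rfl
  rw [partialD_comp_sub_left (hg.differentiable (by norm_num))]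
  refine (congrFun h2 t).trans ?_
  rw [h3, neg_neg]

/-- The support of `η` lies in a ball of radius `Rη`, so for `x` far out only values of `w` far out
enter the average. -/
lemma tendsto_mollify {w η : E3 → ℝ} (h0 : Tendsto w (cocompact E3) (𝓝 0)) (hη : Continuous η)
    (hc : HasCompactSupport η) : Tendsto (mollify w η) (cocompact E3) (𝓝 0) := by
  have hI := (hη.integrable_of_hasCompactSupport hc (μ := (volume : Measure E3))).norm
  have hI0 : 0 ≤ ∫ t, ‖η t‖ := integral_nonneg fun t => norm_nonneg _
  obtain ⟨Rη, hRη, hη0⟩ := exists_ball_of_hasCompactSupport hc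
  rw [Metric.tendsto_nhds]
  intro δ hδ
  have hδ' : 0 < δ / ((∫ t, ‖η t‖) + 1) := by positivity
  have h1 := (Metric.tendsto_nhds.1 h0) _ hδ'
  rw [Filter.Eventually, mem_cocompact] at h1
  obtain ⟨K, hK, hKs⟩ := h1
  obtain ⟨R₀, hR₀⟩ := hK.isBounded.subset_closedBall 0
  rw [Filter.Eventually, mem_cocompact]
  refine ⟨Metric.closedBall 0 (R₀ + Rη), isCompact_closedBall _ _, fun x hx => ?_⟩
  simp only [mem_compl_iff, mem_closedBall_zero_iff, not_le] at hx
  rw [mem_ofPred, dist_zero_right]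
  have hb : ‖mollify w η x‖ ≤ ∫ t, δ / ((∫ t, ‖η t‖) + 1) * ‖η (x - t)‖ := by
    refine norm_integral_le_of_norm_le ((hI.comp_sub_left x).const_mul _)
      (Eventually.of_forall fun t => ?_)
    rw [norm_mul]
    rcases eq_or_ne (η (x - t)) 0 with h | h
    · simp [h]
    gcongr
    have h2 : ‖x - t‖ < Rη := by
      by_contra! h3; exact h (hη0 _ h3)
    have h3 : t ∈ Kᶜ := by
      intro htK
      have := hR₀ htK
      rw [mem_closedBall_zero_iff] at this
      have := norm_sub_norm_le x t
      linarith
    have := hKs h3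
    rw [mem_ofPred, dist_zero_right] at this
    exact this.le
  rw [integral_const_mul, integral_sub_left_eq_self (fun t => ‖η t‖) volume x] at hb
  refine hb.trans_lt ?_
  rw [div_mul_eq_mul_div, div_lt_iff₀ (by positivity)]
  nlinarith

/-- Every mollification of `w` is smooth, harmonic and vanishes at infinity, hence is nonpositive by
the maximum principle. Evaluating the mollifications by `t ↦ g (-t)` and by its negative at the
origin yields both inequalities. -/
lemma integral_mul_eq_zero_of_weaklyHarmonic {w : E3 → ℝ} (hw : LocallyIntegrable w)
    (h0 : Tendsto w (cocompact E3) (𝓝 0))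
    (hz : ∀ φ : E3 → ℝ, ContDiff ℝ ∞ φ → HasCompactSupport φ →
      ∫ r, w r * Laplacian.laplacian φ r = 0)
    {g : E3 → ℝ} (hg : ContDiff ℝ ∞ g) (hc : HasCompactSupport g) : ∫ r, w r * g r = 0 := by
  have key : ∀ η : E3 → ℝ, ContDiff ℝ ∞ η → HasCompactSupport η → ∀ x, mollify w η x ≤ 0 := by
    intro η hη hcη
    have hs := contDiff_mollify hw hη hcη
    refine nonpos_of_sum_partialD_eq_zero (hs.of_le two_le_infty)
      (fun i => (contDiff_partialD hs i).of_le (by norm_num)) (fun x => ?_)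
      (tendsto_mollify h0 hη.continuous hcη)
    have h1 : ∀ i, partialD i (partialD i (mollify w η)) x =
        ∫ t, w t * partialD i (partialD i η) (x - t) := by
      intro i
      rw [partialD_mollify hw hη hcη,
        partialD_mollify hw (contDiff_partialD hη i) (hasCompactSupport_partialD hcη i)]
      rfl
    rw [Finset.sum_congr rfl fun i _ => h1 i, ← integral_finsetSum]
    · have h2 := hz (fun t => η (x - t)) (hη.comp (contDiff_const.sub contDiff_id))
        (hcη.comp_homeomorph (Homeomorph.subLeft x))
      rw [← h2]
      congr 1
      ext t
      rw [laplacian_comp_sub_left hη, laplacian_eq_sum_partialD (hη.of_le two_le_infty),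
        Finset.mul_sum]
    · intro i _
      have hdd := contDiff_partialD (contDiff_partialD hη i) i
      exact (hasCompactSupport_partialD (hasCompactSupport_partialD hcη i) i).convolutionExists_right
        (ContinuousLinearMap.mul ℝ ℝ) hw hdd.continuous x
  have hη : ContDiff ℝ ∞ fun t => g (-t) := hg.comp contDiff_neg
  have hcη : HasCompactSupport fun t => g (-t) := hc.comp_homeomorph (Homeomorph.neg E3)
  have e1 : mollify w (fun t => g (-t)) 0 = ∫ r, w r * g r := by simp [mollify]
  have e2 : mollify w (fun t => -g (-t)) 0 = -∫ r, w r * g r := by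
    simp [mollify, integral_neg]
  have h1 := key _ hη hcη 0
  have h2 := key _ hη.neg hcη.neg 0
  rw [e1] at h1
  have h3 : mollify w (fun t => -g (-t)) 0 ≤ 0 := h2
  rw [e2] at h3
  linarith

/-- Solutions of Poisson's equation that vanish at infinity are unique. -/
theorem SolvesPoisson.ae_eq {Φ Φ' : E3 → ℝ} {S : (E3 → ℝ) → ℝ} (h : SolvesPoisson Φ S)
    (h' : SolvesPoisson Φ' S) : Φ =ᵐ[volume] Φ' := by
  have hi : ∀ {F : E3 → ℝ}, LocallyIntegrable F → ∀ {g : E3 → ℝ}, Continuous g →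
      HasCompactSupport g → Integrable fun r => F r * g r := by
    intro F hF g hg hc
    simpa [mul_comm] using hF.integrable_smul_left_of_hasCompactSupport hg hc
  refine ae_eq_of_integral_contDiff_smul_eq h.locallyIntegrable h'.locallyIntegrable
    fun g hg hc => ?_
  have h1 := integral_mul_eq_zero_of_weaklyHarmonic (w := fun r => Φ r - Φ' r)
    (h.locallyIntegrable.sub h'.locallyIntegrable) (by simpa using h.decay.sub h'.decay) ?_ hg hc
  · simp_rw [sub_mul] at h1
    rw [integral_sub (hi h.locallyIntegrable hg.continuous hc)
      (hi h'.locallyIntegrable hg.continuous hc)] at h1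
    simp_rw [smul_eq_mul, mul_comm (g _)]
    linarith
  · intro φ hφ hcφ
    simp_rw [sub_mul]
    have hL := continuous_laplacian hφ
    have hcL := hasCompactSupport_laplacian hφ hcφ
    rw [integral_sub (hi h.locallyIntegrable hL hcL) (hi h'.locallyIntegrable hL hcL)]
    have := h.equation φ hφ hcφ
    have := h'.equation φ hφ hcφ
    linarith

/-! ### Potentials of sources -/

lemma hasFDerivAt_newton {w : E3} (hw : w ≠ 0) :
    HasFDerivAt newton (innerSL ℝ (gradNewton w)) w := by
  have h0 : ‖w‖ ≠ 0 := norm_ne_zero_iff.2 hw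
  have h1 : HasFDerivAt (fun w : E3 => Real.sqrt (‖w‖ ^ 2)) _ w :=
    (hasStrictFDerivAt_norm_sq w).hasFDerivAt.sqrt (pow_ne_zero 2 h0)
  simp_rw [Real.sqrt_sq (norm_nonneg _)] at h1
  have h2 : HasFDerivAt newton _ w :=
    ((hasDerivAt_inv h0).comp_hasFDerivAt w h1).const_mul ((4 * Real.pi)⁻¹)
  refine h2.congr_fderiv ?_
  ext v
  simp [gradNewton]
  field_simp

lemma contDiffAt_newton {w : E3} (hw : w ≠ 0) : ContDiffAt ℝ 1 newton w :=
  contDiffAt_const.mul ((contDiffAt_norm ℝ hw).inv (norm_ne_zero_iff.2 hw))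

/-- `Φ` is the Newton potential of the source `S`, which is carried by `C`. -/
structure HasPotential (C : Set E3) (S : (E3 → ℝ) → ℝ) (Φ : E3 → ℝ) : Prop where
  locallyIntegrable : LocallyIntegrable Φ
  decay : Tendsto Φ (cocompact E3) (𝓝 0)
  duality : ∀ f : E3 → ℝ, Continuous f → HasCompactSupport f →
    ∫ r, Φ r * f r = S (potential f)
  -- The kernel is singular at `r`, so `S` is evaluated on any `u` that agrees with it near `C`;
  -- agreement of germs is needed because dipoles see derivatives.
  apply_eq : ∀ r ∉ C, ∀ u : E3 → ℝ, (∀ s ∈ C, u =ᶠ[𝓝 s] fun s => newton (s - r)) → S u = Φ r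

lemma HasPotential.solvesPoisson {C : Set E3} {S : (E3 → ℝ) → ℝ} {Φ : E3 → ℝ}
    (h : HasPotential C S Φ) : SolvesPoisson Φ S where
  locallyIntegrable := h.locallyIntegrable
  decay := h.decay
  equation φ hφ hc := by
    have := h.duality (fun r => -Laplacian.laplacian φ r) (continuous_laplacian hφ).neg
      (hasCompactSupport_laplacian hφ hc).neg
    rw [potential_neg_laplacian hφ hc] at this
    rw [← this, ← integral_neg]
    simp

lemma LocallyIntegrable.integrable_mul {F g : E3 → ℝ} (hF : LocallyIntegrable F)
    (hg : Continuous g) (hc : HasCompactSupport g) : Integrable fun r => F r * g r := by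
  simpa [mul_comm] using hF.integrable_smul_left_of_hasCompactSupport hg hc

lemma HasPotential.add {C : Set E3} {S S' : (E3 → ℝ) → ℝ} {Φ Φ' : E3 → ℝ}
    (h : HasPotential C S Φ) (h' : HasPotential C S' Φ') :
    HasPotential C (fun φ => S φ + S' φ) (fun r => Φ r + Φ' r) where
  locallyIntegrable := h.locallyIntegrable.add h'.locallyIntegrable
  decay := by simpa using h.decay.add h'.decay
  duality f hf hc := by
    simp_rw [add_mul]
    rw [integral_add (LocallyIntegrable.integrable_mul h.locallyIntegrable hf hc)
      (LocallyIntegrable.integrable_mul h'.locallyIntegrable hf hc), h.duality f hf hc,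
      h'.duality f hf hc]
  apply_eq r hr u hu := by rw [h.apply_eq r hr u hu, h'.apply_eq r hr u hu]

lemma HasPotential.const_mul {C : Set E3} {S : (E3 → ℝ) → ℝ} {Φ : E3 → ℝ}
    (h : HasPotential C S Φ) (c : ℝ) : HasPotential C (fun φ => c * S φ) (fun r => c * Φ r) where
  locallyIntegrable := h.locallyIntegrable.smul c
  decay := by simpa using h.decay.const_mul c
  duality f hf hc := by
    simp_rw [mul_assoc]
    rw [integral_const_mul, h.duality f hf hc]
  apply_eq r hr u hu := by rw [h.apply_eq r hr u hu]

/-- The hypothesis of Fubini's theorem for the duality. The convolution of `|f|` with `|k|` is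
continuous, hence bounded on the ball that contains the carrier, and the density `c` is integrable.
-/
lemma integrable_prod_mul_kernel {X : Type*} [MeasurableSpace X] {lam : Measure X} [SFinite lam]
    {γ : X → E3} (hγ : Measurable γ) {R : ℝ} (hR : ∀ᵐ x ∂lam, ‖γ x‖ ≤ R) {c : X → ℝ}
    (hci : Integrable c lam) {k : E3 → ℝ} (hkm : Measurable k) (hk : LocallyIntegrable k)
    {f : E3 → ℝ} (hf : Continuous f) (hc : HasCompactSupport f) :
    Integrable (fun p : E3 × X => f p.1 * (c p.2 * k (γ p.2 - p.1))) (volume.prod lam) := by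
  have hm : AEStronglyMeasurable (fun p : E3 × X => f p.1 * (c p.2 * k (γ p.2 - p.1)))
      (volume.prod lam) := by
    have h1 : AEStronglyMeasurable (fun p : E3 × X => f p.1) (volume.prod lam) :=
      (hf.measurable.comp measurable_fst).aestronglyMeasurable
    have h2 : AEStronglyMeasurable (fun p : E3 × X => c p.2) (volume.prod lam) :=
      hci.aestronglyMeasurable.comp_snd
    have h3 : AEStronglyMeasurable (fun p : E3 × X => k (γ p.2 - p.1)) (volume.prod lam) :=
      (hkm.comp ((hγ.comp measurable_snd).sub measurable_fst)).aestronglyMeasurable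
    exact h1.mul (h2.mul h3)
  have hint : ∀ s, Integrable fun r => f r * k (s - r) := fun s => by
    have := (integrable_mul_of_locallyIntegrable hf hc hk s).comp_sub_left s
    simpa using this
  let g : E3 → ℝ := fun s => ∫ r, ‖f r‖ * ‖k (s - r)‖
  have hg : Continuous g :=
    hc.norm.continuous_convolution_left (ContinuousLinearMap.mul ℝ ℝ) hf.norm
      (g := fun w => ‖k w‖) (fun x => (hk x).norm)
  obtain ⟨B, hB⟩ := (isCompact_closedBall (0 : E3) R).exists_bound_of_continuousOn hg.continuousOn
  rw [integrable_prod_iff' hm]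
  constructor
  · refine Eventually.of_forall fun x => ?_
    refine ((hint (γ x)).const_mul (c x)).congr (Eventually.of_forall fun r => ?_)
    simp only; ring
  · have e : (fun x => ∫ r, ‖f r * (c x * k (γ x - r))‖) = fun x => ‖c x‖ * g (γ x) := by
      ext x
      rw [← integral_const_mul]
      congr 1
      ext r
      simp only [norm_mul]; ring
    rw [e]
    refine (hci.norm.mul_const B).mono'
      (hci.norm.aestronglyMeasurable.mul (hg.measurable.comp hγ).aestronglyMeasurable) ?_
    filter_upwards [hR] with x hx
    rw [norm_mul, norm_norm]
    gcongr
    exact hB _ (by simpa using hx)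

lemma integrable_prod_inner_kernel {X : Type*} [MeasurableSpace X] {lam : Measure X} [SFinite lam]
    {γ : X → E3} (hγ : Measurable γ) {R : ℝ} (hR : ∀ᵐ x ∂lam, ‖γ x‖ ≤ R) {b : X → E3}
    (hb : Integrable b lam) {f : E3 → ℝ} (hf : Continuous f) (hc : HasCompactSupport f) :
    Integrable (fun p : E3 × X => f p.1 * ⟪gradNewton (γ p.2 - p.1), b p.2⟫) (volume.prod lam) := by
  have h := integrable_prod_mul_kernel hγ hR hb.norm measurable_gradNewton.norm
    (fun x => (locallyIntegrable_gradNewton x).norm) hf hc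
  refine h.mono ?_ (Eventually.of_forall fun p => ?_)
  · have h1 : AEStronglyMeasurable (fun p : E3 × X => f p.1) (volume.prod lam) :=
      (hf.measurable.comp measurable_fst).aestronglyMeasurable
    have h2 : AEStronglyMeasurable (fun p : E3 × X => b p.2) (volume.prod lam) :=
      hb.aestronglyMeasurable.comp_snd
    have h3 : AEStronglyMeasurable (fun p : E3 × X => gradNewton (γ p.2 - p.1)) (volume.prod lam) :=
      (measurable_gradNewton.comp ((hγ.comp measurable_snd).sub measurable_fst)).aestronglyMeasurable
    exact h1.mul (h3.inner h2)
  · rw [norm_mul, norm_mul, norm_mul, norm_norm, norm_norm, mul_comm ‖b p.2‖]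
    gcongr
    exact norm_inner_le_norm _ _

/-- A source carried by a parametrized bounded set, with a simple and a dipole density. -/
theorem hasPotential_integral {X : Type*} [MeasurableSpace X] {lam : Measure X} [SFinite lam]
    {γ : X → E3} (hγ : Measurable γ) {C : Set E3} (hC : Bornology.IsBounded C)
    (hγC : ∀ᵐ x ∂lam, γ x ∈ C) {a : X → ℝ} (ha : Integrable a lam) {b : X → E3}
    (hb : Integrable b lam) :
    HasPotential C (fun φ => ∫ x, (a x * φ (γ x) + fderiv ℝ φ (γ x) (b x)) ∂lam)
      (fun r => ∫ x, (a x * newton (γ x - r) + ⟪gradNewton (γ x - r), b x⟫) ∂lam) := by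
  obtain ⟨R, hR⟩ := hC.subset_closedBall 0
  have hR' : ∀ᵐ x ∂lam, ‖γ x‖ ≤ R := by
    filter_upwards [hγC] with x hx
    simpa using hR hx
  have hprod : ∀ f : E3 → ℝ, Continuous f → HasCompactSupport f → Integrable (fun p : E3 × X =>
      f p.1 * (a p.2 * newton (γ p.2 - p.1) + ⟪gradNewton (γ p.2 - p.1), b p.2⟫))
      (volume.prod lam) := by
    intro f hf hc
    refine ((integrable_prod_mul_kernel hγ hR' ha measurable_newton locallyIntegrable_newton hf
      hc).add (integrable_prod_inner_kernel hγ hR' hb hf hc)).congr (Eventually.of_forall fun p => ?_)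
    simp only [Pi.add_apply]; ring
  refine ⟨?_, ?_, ?_, ?_⟩
  · refine locallyIntegrable_of_ball fun Q => ?_
    rcases le_or_gt Q 0 with hQ | hQ
    · rw [Metric.ball_eq_empty.2 hQ]; exact integrableOn_empty
    -- Local integrability comes from the same Fubini argument, with `f` replaced by a bump equal to
    -- one on the ball.
    let χ : ContDiffBump (0 : E3) := ⟨Q, Q + 1, hQ, by linarith⟩
    have h1 := (hprod χ χ.continuous χ.hasCompactSupport).integral_prod_left
    refine (h1.integrableOn (s := Metric.ball 0 Q)).congr_fun (fun r hr => ?_)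
      Metric.isOpen_ball.measurableSet
    simp only
    rw [integral_const_mul, χ.one_of_mem_closedBall (Metric.ball_subset_closedBall hr), one_mul]
  · have hI : Integrable (fun x => |a x| + ‖b x‖) lam := ha.abs.add hb.norm
    have hlim : Tendsto (fun r : E3 => (4 * Real.pi)⁻¹ * (∫ x, (|a x| + ‖b x‖) ∂lam) * (‖r‖ - R)⁻¹)
        (cocompact E3) (𝓝 0) := by
      have h1 : Tendsto (fun r : E3 => ‖r‖ - R) (cocompact E3) atTop :=
        tendsto_atTop_add_const_right _ _ (tendsto_norm_cocompact_atTop (E := E3))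
      simpa using (tendsto_inv_atTop_zero.comp h1).const_mul
        ((4 * Real.pi)⁻¹ * ∫ x, (|a x| + ‖b x‖) ∂lam)
    refine squeeze_zero_norm' ?_ hlim
    -- At distance at least one from the carrier the inverse square is dominated by the inverse
    -- distance, so one bound serves kernel and gradient.
    have h2 := (tendsto_norm_cocompact_atTop (E := E3)).eventually_ge_atTop (R + 1)
    filter_upwards [h2] with r hr
    have e : (4 * Real.pi)⁻¹ * (∫ x, (|a x| + ‖b x‖) ∂lam) * (‖r‖ - R)⁻¹ =
        ∫ x, (4 * Real.pi)⁻¹ * (‖r‖ - R)⁻¹ * (|a x| + ‖b x‖) ∂lam := by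
      rw [integral_const_mul]; ring
    rw [e]
    refine norm_integral_le_of_norm_le (hI.const_mul _) ?_
    filter_upwards [hR'] with x hx
    have h3 : ‖r‖ - R ≤ ‖γ x - r‖ := by
      have := norm_sub_norm_le r (γ x)
      rw [norm_sub_rev] at this
      linarith
    have h4 : 1 ≤ ‖r‖ - R := by linarith
    have h5 : ‖newton (γ x - r)‖ ≤ (4 * Real.pi)⁻¹ * (‖r‖ - R)⁻¹ := by
      rw [newton, Real.norm_of_nonneg (by positivity)]
      gcongr
    have h6 : ‖gradNewton (γ x - r)‖ ≤ (4 * Real.pi)⁻¹ * (‖r‖ - R)⁻¹ := by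
      rw [norm_gradNewton]
      gcongr
      nlinarith
    calc ‖a x * newton (γ x - r) + ⟪gradNewton (γ x - r), b x⟫‖
        ≤ |a x| * ‖newton (γ x - r)‖ + ‖gradNewton (γ x - r)‖ * ‖b x‖ := by
          refine (norm_add_le _ _).trans (add_le_add ?_ (norm_inner_le_norm _ _))
          rw [norm_mul, Real.norm_eq_abs (a x)]
      _ ≤ |a x| * ((4 * Real.pi)⁻¹ * (‖r‖ - R)⁻¹) + (4 * Real.pi)⁻¹ * (‖r‖ - R)⁻¹ * ‖b x‖ := by
          gcongr
      _ = _ := by ring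
  · intro f hf hc
    have h1 := hprod f hf hc
    have e1 : ∫ r, (∫ x, (a x * newton (γ x - r) + ⟪gradNewton (γ x - r), b x⟫) ∂lam) * f r =
        ∫ r, ∫ x, f r * (a x * newton (γ x - r) + ⟪gradNewton (γ x - r), b x⟫) ∂lam := by
      congr 1
      ext r
      rw [integral_const_mul, mul_comm]
    rw [e1, integral_integral_swap h1]
    congr 1
    ext x
    have i1 : Integrable fun r => f r * newton (γ x - r) := by
      have := (integrable_mul_of_locallyIntegrable hf hc locallyIntegrable_newton (γ x)).comp_sub_left
        (γ x)
      simpa using this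
    have i2 : Integrable fun r => f r • gradNewton (γ x - r) := by
      have := (integrable_mul_of_locallyIntegrable hf hc locallyIntegrable_gradNewton
        (γ x)).comp_sub_left (γ x)
      simpa using this
    rw [(hasFDerivAt_potential hf hc _).fderiv, innerSL_apply_apply, gradPotential, real_inner_comm,
      ← integral_inner i2, potential, ← integral_const_mul, ← integral_add]
    · congr 1
      ext r
      rw [inner_smul_right, real_inner_comm]; ring
    · exact i1.const_mul _
    · exact i2.const_inner (b x)
  · intro r hr u hu
    refine integral_congr_ae ?_
    filter_upwards [hγC] with x hx
    have h1 := hu _ hx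
    have h2 : γ x - r ≠ 0 := fun h => hr (by rwa [← sub_eq_zero.1 h])
    have h3 : HasFDerivAt (fun s => newton (s - r)) (innerSL ℝ (gradNewton (γ x - r))) (γ x) := by
      have := (hasFDerivAt_newton h2).comp (γ x) ((hasFDerivAt_id (γ x)).sub_const r)
      rwa [ContinuousLinearMap.comp_id] at this
    rw [h1.eq_of_nhds, h1.fderiv_eq, h3.fderiv, innerSL_apply_apply]

/-- Weak convergence of sources on `C¹` functions, with carriers shrinking to the closure of `Ω`,
implies homogenization. -/
theorem homogenizesTo_of_tendsto {Ω C₀ : Set E3} {C : ℕ → Set E3} {S : ℕ → (E3 → ℝ) → ℝ}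
    {S₀ : (E3 → ℝ) → ℝ} {Ψ : ℕ → E3 → ℝ} {Ψ₀ : E3 → ℝ} (h : ∀ k, HasPotential (C k) (S k) (Ψ k))
    (h₀ : HasPotential C₀ S₀ Ψ₀) (hC₀ : C₀ ⊆ closure Ω)
    (hC : ∀ r ∉ closure Ω, ∃ δ > 0, ∀ᶠ k in atTop, Disjoint (C k) (Metric.ball r δ))
    (hS : ∀ u : E3 → ℝ, ContDiff ℝ 1 u → Tendsto (fun k => S k u) atTop (𝓝 (S₀ u))) :
    HomogenizesTo Ω S S₀ := by
  refine ⟨fun k => ⟨_, (h k).solvesPoisson⟩, ⟨_, h₀.solvesPoisson⟩, fun Φ Φ₀ hΦ hΦ₀ => ?_⟩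
  have e₀ := hΦ₀.ae_eq h₀.solvesPoisson
  have e : ∀ k, Φ k =ᵐ[volume] Ψ k := fun k => (hΦ k).ae_eq (h k).solvesPoisson
  constructor
  · intro f hf hc
    have e1 : ∀ k, ∫ r, Φ k r * f r = S k (potential f) := by
      intro k
      rw [← (h k).duality f hf hc]
      refine integral_congr_ae ?_
      filter_upwards [e k] with r hr
      rw [hr]
    have e2 : ∫ r, Φ₀ r * f r = S₀ (potential f) := by
      rw [← h₀.duality f hf hc]
      refine integral_congr_ae ?_
      filter_upwards [e₀] with r hr
      rw [hr]
    simp_rw [e1, e2]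
    exact hS _ (contDiff_potential hf hc)
  · have eall : ∀ᵐ r, ∀ k, Φ k r = Ψ k r := ae_all_iff.2 e
    filter_upwards [e₀, eall] with r hr₀ hrk hr
    obtain ⟨δ, hδ, hCk⟩ := hC r hr
    obtain ⟨δ', hδ', hd⟩ := Metric.isOpen_iff.1 isClosed_closure.isOpen_compl r hr
    let m : ℝ := min δ δ'
    have hm : 0 < m := lt_min hδ hδ'
    -- The kernel with pole `r` is cut off inside the ball of radius `m`, which for large `k` avoids
    -- all carriers. The result is `C¹` on the whole space and still has the germs of the kernel on
    -- the carriers.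
    let χ : ContDiffBump r := ⟨m / 3, m / 2, by positivity, by linarith⟩
    let u : E3 → ℝ := fun s => (1 - χ s) * newton (s - r)
    have hu : ContDiff ℝ 1 u := by
      rw [contDiff_iff_contDiffAt]
      intro s
      rcases eq_or_ne s r with rfl | hs
      · have : u =ᶠ[𝓝 s] fun _ => 0 := by
          filter_upwards [Metric.ball_mem_nhds s (show 0 < m / 3 by positivity)] with y hy
          simp [u, χ.one_of_mem_closedBall (Metric.ball_subset_closedBall hy)]
        exact contDiffAt_const.congr_of_eventuallyEq this
      · have h1 : ContDiffAt ℝ 1 (fun s => newton (s - r)) s :=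
          ContDiffAt.comp (g := newton) s (contDiffAt_newton (sub_ne_zero.2 hs))
            (contDiffAt_id.sub contDiffAt_const)
        exact (contDiffAt_const.sub χ.contDiffAt).mul h1
    have hloc : ∀ K : Set E3, Disjoint K (Metric.ball r m) → ∀ s ∈ K,
        u =ᶠ[𝓝 s] fun s => newton (s - r) := by
      intro K hK s hs
      have h1 : s ∈ (Metric.closedBall r (m / 2))ᶜ := by
        intro h2
        exact disjoint_left.1 hK hs (Metric.closedBall_subset_ball (by linarith) h2)
      filter_upwards [Metric.isClosed_closedBall.isOpen_compl.mem_nhds h1] with y hy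
      have : χ y = 0 := χ.zero_of_le_dist (by
        simp only [mem_compl_iff, Metric.mem_closedBall, not_le] at hy; exact hy.le)
      simp [u, this]
    have hdis₀ : Disjoint C₀ (Metric.ball r m) := by
      refine disjoint_left.2 fun s hs hsb => ?_
      exact hd (Metric.ball_subset_ball (min_le_right _ _) hsb) (hC₀ hs)
    have hr' : r ∉ C₀ := fun h => hr (hC₀ h)
    rw [hr₀, ← h₀.apply_eq r hr' u (hloc _ hdis₀)]
    refine (hS u hu).congr' ?_
    filter_upwards [hCk] with k hk
    have hk' : Disjoint (C k) (Metric.ball r m) :=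
      hk.mono_right (Metric.ball_subset_ball (min_le_left _ _))
    rw [hrk, (h k).apply_eq r (fun h => disjoint_left.1 hk' h (Metric.mem_ball_self hm)) u
      (hloc _ hk')]

/-! ### Arc length is the one-dimensional Hausdorff measure -/

section ArcLength

open scoped ENNReal NNReal

variable {E : Type*} [NormedAddCommGroup E] [NormedSpace ℝ E] {γ : ℝ → E}

/-- The mean value inequality for `t ↦ γ t - t • v`: where the velocity is nearly `v`, the curve is
nearly affine, hence bi-Lipschitz if `v` is not too small. -/
lemma norm_sub_sub_smul_le (hγ : ContDiff ℝ 1 γ) {J : Set ℝ} (hJ : Convex ℝ J) {v : E} {ε : ℝ}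
    (h : ∀ t ∈ J, ‖deriv γ t - v‖ ≤ ε) {x y : ℝ} (hx : x ∈ J) (hy : y ∈ J) :
    ‖γ x - γ y - (x - y) • v‖ ≤ ε * |x - y| := by
  have h1 : ∀ t ∈ J, HasDerivWithinAt (fun t => γ t - t • v) (deriv γ t - v) J t := fun t _ => by
    have h2 := (hγ.differentiable (by norm_num)).differentiableAt.hasDerivAt (x := t)
    simpa using! (h2.sub ((hasDerivAt_id t).smul_const v)).hasDerivWithinAt
  have h3 := hJ.norm_image_sub_le_of_norm_hasDerivWithin_le h1 h hy hx
  have h4 : γ x - x • v - (γ y - y • v) = γ x - γ y - (x - y) • v := by rw [sub_smul]; abel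
  rwa [h4, Real.norm_eq_abs] at h3

/-- The velocity is uniformly continuous on the compact interval, so it is nearly constant on short
pieces. Half-open pieces indexed by `ℤ` are disjoint and cover the interval. -/
lemma exists_partition_deriv (hγ : ContDiff ℝ 1 γ) (a b : ℝ) {ε : ℝ} (hε : 0 < ε) :
    ∃ (J : ℤ → Set ℝ) (v : ℤ → E), (∀ n, Convex ℝ (J n)) ∧ (∀ n, MeasurableSet (J n)) ∧
      Pairwise (Function.onFun Disjoint J) ∧ (Icc a b ⊆ ⋃ n, J n) ∧
      ∀ n, ∀ t ∈ J n, ‖deriv γ t - v n‖ ≤ ε := by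
  have hu := (isCompact_Icc (a := a) (b := b)).uniformContinuousOn_of_continuous
    (hγ.continuous_deriv (by norm_num)).continuousOn
  rw [Metric.uniformContinuousOn_iff_le] at hu
  obtain ⟨δ, hδ, hu⟩ := hu ε hε
  let I : ℤ → Set ℝ := fun n => Ico (0 + n • δ) (0 + (n + 1) • δ)
  let J : ℤ → Set ℝ := fun n => I n ∩ Icc a b
  have hv : ∀ n, ∃ v : E, ∀ t ∈ J n, ‖deriv γ t - v‖ ≤ ε := by
    intro n
    rcases (J n).eq_empty_or_nonempty with h | ⟨s, hs⟩
    · exact ⟨0, by simp [h]⟩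
    refine ⟨deriv γ s, fun t ht => ?_⟩
    rw [← dist_eq_norm]
    refine hu t ht.2 _ hs.2 ?_
    have h1 := ht.1
    have h2 := hs.1
    simp only [I, mem_Ico, zero_add, zsmul_eq_mul, Int.cast_add, Int.cast_one] at h1 h2
    rw [Real.dist_eq, abs_le]
    constructor <;> nlinarith
  choose v hv using hv
  refine ⟨J, v, fun n => (convex_Ico _ _).inter (convex_Icc _ _),
    fun n => measurableSet_Ico.inter measurableSet_Icc, fun m n hmn => ?_, fun t ht => ?_, hv⟩
  · exact ((pairwise_disjoint_Ico_add_zsmul (0 : ℝ) δ) hmn).mono inter_subset_left inter_subset_left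
  · have h1 : t ∈ ⋃ n : ℤ, Ico (0 + n • δ) (0 + (n + 1) • δ) := by
      rw [iUnion_Ico_add_zsmul hδ]; trivial
    obtain ⟨n, hn⟩ := mem_iUnion.1 h1
    exact mem_iUnion.2 ⟨n, hn, ht⟩

variable [MeasurableSpace E] [BorelSpace E]

lemma hausdorffMeasure_image_le_of_deriv (hγ : ContDiff ℝ 1 γ) {J : Set ℝ} (hJ : Convex ℝ J) {v : E}
    {ε : ℝ} (hε : 0 ≤ ε) (h : ∀ t ∈ J, ‖deriv γ t - v‖ ≤ ε) {A : Set ℝ} (hA : A ⊆ J) :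
    μH[1] (γ '' A) ≤ ENNReal.ofReal (‖v‖ + ε) * volume A := by
  have hL : LipschitzOnWith (Real.toNNReal (‖v‖ + ε)) γ A := by
    refine LipschitzOnWith.of_dist_le_mul fun x hx y hy => ?_
    rw [Real.coe_toNNReal _ (by positivity), dist_eq_norm, Real.dist_eq]
    have h1 := norm_sub_sub_smul_le hγ hJ h (hA hx) (hA hy)
    have h2 := norm_add_le (γ x - γ y - (x - y) • v) ((x - y) • v)
    rw [sub_add_cancel, norm_smul, Real.norm_eq_abs] at h2
    linarith
  have := hL.hausdorffMeasure_image_le (d := 1) zero_le_one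
  rwa [ENNReal.rpow_one, hausdorffMeasure_real] at this

/-- If `‖v‖ > ε`, then `γ` is injective on `A` with an inverse of Lipschitz constant `(‖v‖ - ε)⁻¹`,
and Lipschitz maps control Hausdorff measure. Otherwise the left side is zero. -/
lemma le_hausdorffMeasure_image_of_deriv (hγ : ContDiff ℝ 1 γ) {J : Set ℝ} (hJ : Convex ℝ J) {v : E}
    {ε : ℝ} (h : ∀ t ∈ J, ‖deriv γ t - v‖ ≤ ε) {A : Set ℝ} (hA : A ⊆ J) :
    ENNReal.ofReal (‖v‖ - ε) * volume A ≤ μH[1] (γ '' A) := by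
  rcases le_or_gt (‖v‖ - ε) 0 with hle | hpos
  · simp [ENNReal.ofReal_of_nonpos hle]
  have hlow : ∀ x ∈ A, ∀ y ∈ A, (‖v‖ - ε) * |x - y| ≤ ‖γ x - γ y‖ := by
    intro x hx y hy
    have h1 := norm_sub_sub_smul_le hγ hJ h (hA hx) (hA hy)
    have h2 := norm_sub_norm_le ((x - y) • v) ((x - y) • v - (γ x - γ y))
    rw [sub_sub_cancel, norm_smul, Real.norm_eq_abs, norm_sub_rev ((x - y) • v)] at h2
    linarith
  have hinj : InjOn γ A := by
    intro x hx y hy hxy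
    have := hlow x hx y hy
    rw [hxy, sub_self, norm_zero] at this
    have h3 : |x - y| ≤ 0 := by
      by_contra! h4
      nlinarith
    exact sub_eq_zero.1 (abs_nonpos_iff.1 h3)
  have hL : LipschitzOnWith (Real.toNNReal (‖v‖ - ε)⁻¹) (Function.invFunOn γ A) (γ '' A) := by
    refine LipschitzOnWith.of_dist_le_mul ?_
    rintro _ ⟨x, hx, rfl⟩ _ ⟨y, hy, rfl⟩
    rw [hinj.leftInvOn_invFunOn hx, hinj.leftInvOn_invFunOn hy,
      Real.coe_toNNReal _ (by positivity), dist_eq_norm (γ x), Real.dist_eq, inv_mul_eq_div,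
      le_div_iff₀ hpos, mul_comm]
    exact hlow x hx y hy
  have h5 := hL.hausdorffMeasure_image_le (d := 1) zero_le_one
  rw [ENNReal.rpow_one, hausdorffMeasure_real, hinj.invFunOn_image Subset.rfl] at h5
  have h6 : ENNReal.ofReal (‖v‖ - ε) * (Real.toNNReal (‖v‖ - ε)⁻¹ : ℝ≥0∞) = 1 := by
    change _ * ENNReal.ofReal _ = 1
    rw [← ENNReal.ofReal_mul hpos.le, mul_inv_cancel₀ hpos.ne', ENNReal.ofReal_one]
  calc _ ≤ ENNReal.ofReal (‖v‖ - ε) * ((Real.toNNReal (‖v‖ - ε)⁻¹ : ℝ≥0∞) * μH[1] (γ '' A)) := by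
        gcongr
    _ = _ := by rw [← mul_assoc, h6, one_mul]

lemma measurableSet_image_curve (hγ : ContDiff ℝ 1 γ) {a b : ℝ} (hinj : InjOn γ (Icc a b)) {A : Set ℝ}
    (hA : MeasurableSet A) (hAI : A ⊆ Icc a b) : MeasurableSet (γ '' A) :=
  hA.image_of_continuousOn_injOn hγ.continuous.continuousOn (hinj.mono hAI)

/-- The estimates for nearly constant velocity are summed over the pieces. One `ε` is the defect of
the Lipschitz bound, the other the difference between `‖v n‖` and the actual speed. Injectivity
makes the images of the pieces disjoint, so their measures add up. -/
lemma hausdorffMeasure_image_le_lintegral_deriv (hγ : ContDiff ℝ 1 γ) {a b : ℝ}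
    (hinj : InjOn γ (Icc a b)) {A : Set ℝ} (hA : MeasurableSet A) (hAI : A ⊆ Icc a b) {ε : ℝ}
    (hε : 0 < ε) :
    μH[1] (γ '' A) ≤ ∫⁻ t in A, ENNReal.ofReal (‖deriv γ t‖ + 2 * ε) ∧
      ∫⁻ t in A, ENNReal.ofReal (‖deriv γ t‖ - 2 * ε) ≤ μH[1] (γ '' A) := by
  obtain ⟨J, v, hconv, hmeas, hdisj, hcov, hJ⟩ := exists_partition_deriv hγ a b hε
  have hAe : A = ⋃ n, A ∩ J n := by
    rw [← inter_iUnion, inter_eq_left.2 (hAI.trans hcov)]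
  have hdisjA : Pairwise (Function.onFun Disjoint fun n => A ∩ J n) := fun m n hmn =>
    (hdisj hmn).mono inter_subset_right inter_subset_right
  have hmA : ∀ n, MeasurableSet (A ∩ J n) := fun n => hA.inter (hmeas n)
  have him : μH[1] (γ '' A) = ∑' n, μH[1] (γ '' (A ∩ J n)) := by
    conv_lhs => rw [hAe, image_iUnion]
    refine measure_iUnion (fun m n hmn => ?_) fun n =>
      measurableSet_image_curve hγ hinj (hmA n) (inter_subset_left.trans hAI)
    refine disjoint_left.2 ?_
    rintro _ ⟨x, hx, rfl⟩ ⟨y, hy, hxy⟩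
    have : y = x := hinj (hAI hy.1) (hAI hx.1) hxy
    exact disjoint_left.1 (hdisjA hmn) hx (this ▸ hy)
  have hint : ∀ g : ℝ → ℝ≥0∞, ∫⁻ t in A, g t = ∑' n, ∫⁻ t in A ∩ J n, g t := by
    intro g
    conv_lhs => rw [hAe]
    exact lintegral_iUnion hmA hdisjA g
  rw [him, hint, hint]
  constructor
  · refine ENNReal.tsum_le_tsum fun n => ?_
    refine (hausdorffMeasure_image_le_of_deriv hγ (hconv n) hε.le (hJ n) inter_subset_right).trans ?_
    rw [← setLIntegral_const]
    refine setLIntegral_mono' (hmA n) fun t ht => ENNReal.ofReal_le_ofReal ?_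
    have := hJ n t ht.2
    have := norm_sub_norm_le (v n) (deriv γ t)
    rw [norm_sub_rev] at this
    linarith
  · refine ENNReal.tsum_le_tsum fun n => ?_
    refine le_trans ?_ (le_hausdorffMeasure_image_of_deriv hγ (hconv n) (hJ n) inter_subset_right)
    rw [← setLIntegral_const]
    refine setLIntegral_mono' (hmA n) fun t ht => ENNReal.ofReal_le_ofReal ?_
    have := hJ n t ht.2
    have := norm_sub_norm_le (deriv γ t) (v n)
    linarith

/-- The one-dimensional area formula for injective `C¹` curves. -/
theorem hausdorffMeasure_image_curve (hγ : ContDiff ℝ 1 γ) {a b : ℝ} (hinj : InjOn γ (Icc a b))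
    {A : Set ℝ} (hA : MeasurableSet A) (hAI : A ⊆ Icc a b) :
    μH[1] (γ '' A) = ∫⁻ t in A, ENNReal.ofReal ‖deriv γ t‖ := by
  have hvol : volume A ≠ ⊤ := ((measure_mono hAI).trans_lt measure_Icc_lt_top).ne
  have hlim : ∀ c : ℝ≥0∞, Tendsto (fun ε : ℝ => c + ENNReal.ofReal (2 * ε) * volume A) (𝓝[>] 0)
      (𝓝 c) := by
    intro c
    have h1 : Tendsto (fun ε : ℝ => ENNReal.ofReal (2 * ε)) (𝓝[>] 0) (𝓝 0) := by
      have h2 : Continuous fun ε : ℝ => ENNReal.ofReal (2 * ε) :=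
        ENNReal.continuous_ofReal.comp (by fun_prop)
      have h3 := h2.tendsto 0
      simp only [mul_zero, ENNReal.ofReal_zero] at h3
      exact h3.mono_left nhdsWithin_le_nhds
    have h4 := (ENNReal.Tendsto.mul_const h1 (Or.inr hvol) : Tendsto _ _ (𝓝 (0 * volume A)))
    simpa using h4.const_add c
  have hm : Measurable fun t => ‖deriv γ t‖ := (hγ.continuous_deriv (by norm_num)).norm.measurable
  refine le_antisymm (ge_of_tendsto (hlim _) ?_) (ge_of_tendsto (hlim _) ?_)
  · filter_upwards [self_mem_nhdsWithin] with ε hε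
    refine (hausdorffMeasure_image_le_lintegral_deriv hγ hinj hA hAI hε).1.trans ?_
    rw [← setLIntegral_const, ← lintegral_add_right _ measurable_const]
    exact lintegral_mono fun t => ENNReal.ofReal_add_le
  · filter_upwards [self_mem_nhdsWithin] with ε hε
    refine le_trans ?_ (add_le_add_left
      (hausdorffMeasure_image_le_lintegral_deriv hγ hinj hA hAI hε).2 _)
    rw [← setLIntegral_const, ← lintegral_add_right _ measurable_const]
    refine lintegral_mono fun t => ?_
    refine le_trans (le_of_eq ?_) ENNReal.ofReal_add_le
    rw [sub_add_cancel]

/-- The area formula as an equality of measures, from which integrability and integrals can be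
transferred. It is phrased on the subtype of `A` because only the restriction of `γ` to `A` is a
measurable embedding. -/
theorem map_arcLength_eq_hausdorffMeasure (hγ : ContDiff ℝ 1 γ) {a b : ℝ}
    (hinj : InjOn γ (Icc a b)) {A : Set ℝ} (hA : MeasurableSet A) (hAI : A ⊆ Icc a b) :
    Measure.map (A.domRestrict γ) (Measure.comap (↑)
      (volume.withDensity fun t => ENNReal.ofReal ‖deriv γ t‖)) = μH[1].restrict (γ '' A) := by
  have hm := (hγ.continuous.continuousOn (s := A)).measurableEmbedding hA (hinj.mono hAI)
  ext V hV
  rw [hm.map_apply, (MeasurableEmbedding.subtype_coe hA).comap_apply, Measure.restrict_apply hV]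
  have e1 : ((↑) : A → ℝ) '' (A.domRestrict γ ⁻¹' V) = A ∩ γ ⁻¹' V := by
    ext t
    simp only [mem_image, mem_preimage, domRestrict_apply, Subtype.exists, exists_and_right,
      exists_eq_right, mem_inter_iff]
    tauto
  have e2 : V ∩ γ '' A = γ '' (A ∩ γ ⁻¹' V) := by rw [image_inter_preimage, inter_comm]
  have hm2 : MeasurableSet (A ∩ γ ⁻¹' V) := hA.inter (hγ.continuous.measurable hV)
  rw [e1, e2, withDensity_apply _ hm2,
    hausdorffMeasure_image_curve hγ hinj hm2 (inter_subset_left.trans hAI)]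

theorem integrableOn_image_curve_iff (hγ : ContDiff ℝ 1 γ) {a b : ℝ}
    (hinj : InjOn γ (Icc a b)) {A : Set ℝ} (hA : MeasurableSet A) (hAI : A ⊆ Icc a b) (g : E → ℝ) :
    IntegrableOn g (γ '' A) μH[1] ↔ IntegrableOn (fun t => ‖deriv γ t‖ * g (γ t)) A := by
  have hd := (hγ.continuous_deriv (by norm_num)).norm.measurable
  have hm := (hγ.continuous.continuousOn (s := A)).measurableEmbedding hA (hinj.mono hAI)
  rw [IntegrableOn, ← map_arcLength_eq_hausdorffMeasure hγ hinj hA hAI, hm.integrable_map_iff]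
  simp only [Set.domRestrict_eq, ← Function.comp_assoc, ENNReal.ofReal]
  rw [← (MeasurableEmbedding.subtype_coe hA).integrable_map_iff, map_comap_subtype_coe hA,
    restrict_withDensity hA, integrable_withDensity_iff_integrable_coe_smul₀]
  · simp_rw [IntegrableOn, Real.coe_toNNReal _ (norm_nonneg _), Function.comp_apply, smul_eq_mul]
  · exact hd.real_toNNReal.aemeasurable

theorem setIntegral_image_curve (hγ : ContDiff ℝ 1 γ) {a b : ℝ}
    (hinj : InjOn γ (Icc a b)) {A : Set ℝ} (hA : MeasurableSet A) (hAI : A ⊆ Icc a b) (g : E → ℝ) :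
    ∫ r in γ '' A, g r ∂μH[1] = ∫ t in A, ‖deriv γ t‖ * g (γ t) := by
  have hd := (hγ.continuous_deriv (by norm_num)).norm.measurable
  have hm := (hγ.continuous.continuousOn (s := A)).measurableEmbedding hA (hinj.mono hAI)
  rw [← map_arcLength_eq_hausdorffMeasure hγ hinj hA hAI, hm.integral_map]
  simp only [Set.domRestrict_apply, ← Function.comp_apply (f := g), ENNReal.ofReal]
  rw [← (MeasurableEmbedding.subtype_coe hA).integral_map, map_comap_subtype_coe hA,
    setIntegral_withDensity_eq_setIntegral_smul₀ hd.real_toNNReal.aemeasurable _ hA]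
  congr with x
  rw [NNReal.smul_def, Real.coe_toNNReal _ (norm_nonneg _), smul_eq_mul, Function.comp_apply]

end ArcLength

/-! ### The boundary of a planar `C¹` domain is locally a graph -/

/-- Rotation by a right angle. -/
def rot (m : E2) : E2 := !₂[-m 1, m 0]

/-- Cartesian coordinates with origin `x` and axes `rot m`, `m`. -/
def frame (x m : E2) (s t : ℝ) : E2 := x + s • rot m + t • m

lemma inner_E2 (v w : E2) : ⟪v, w⟫ = v 0 * w 0 + v 1 * w 1 := by
  rw [PiLp.inner_apply, Fin.sum_univ_two]
  simp [mul_comm]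

lemma inner_rot_self (m : E2) : ⟪m, rot m⟫ = 0 := by
  rw [inner_E2]; simp [rot]; ring

lemma inner_self_eq_one {m : E2} (hm : ‖m‖ = 1) : ⟪m, m⟫ = 1 := by
  rw [real_inner_self_eq_norm_sq, hm, one_pow]

lemma inner_rot_rot {m : E2} (hm : ‖m‖ = 1) : ⟪rot m, rot m⟫ = 1 := by
  rw [← inner_self_eq_one hm, inner_E2, inner_E2]; simp [rot]; ring

lemma norm_rot {m : E2} (hm : ‖m‖ = 1) : ‖rot m‖ = 1 := by
  have := inner_rot_rot hm
  rw [real_inner_self_eq_norm_sq] at this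
  nlinarith [norm_nonneg (rot m)]

lemma inner_rot_frame_sub {m : E2} (hm : ‖m‖ = 1) (x : E2) (s t : ℝ) :
    ⟪rot m, frame x m s t - x⟫ = s := by
  have h1 : frame x m s t - x = s • rot m + t • m := by simp only [frame]; abel
  rw [h1, inner_add_right, inner_smul_right, inner_smul_right, inner_rot_rot hm,
    real_inner_comm, inner_rot_self]
  ring

lemma inner_frame_sub {m : E2} (hm : ‖m‖ = 1) (x : E2) (s t : ℝ) :
    ⟪m, frame x m s t - x⟫ = t := by
  have h1 : frame x m s t - x = s • rot m + t • m := by simp only [frame]; abel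
  rw [h1, inner_add_right, inner_smul_right, inner_smul_right, inner_self_eq_one hm,
    inner_rot_self]
  ring

lemma frame_inner_inner {m : E2} (hm : ‖m‖ = 1) (x y : E2) :
    frame x m ⟪rot m, y - x⟫ ⟪m, y - x⟫ = y := by
  have h := inner_self_eq_one hm
  rw [inner_E2] at h
  have h0 : y 0 - x 0 = (m 0 * m 0 + m 1 * m 1) * (y 0 - x 0) := by rw [h, one_mul]
  have h1 : y 1 - x 1 = (m 0 * m 0 + m 1 * m 1) * (y 1 - x 1) := by rw [h, one_mul]
  ext i
  fin_cases i
  · simp [frame, inner_E2, rot]; linear_combination -h0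
  · simp [frame, inner_E2, rot]; linear_combination -h1

lemma contDiff_frame (x m : E2) {n : ℕ∞ω} : ContDiff ℝ n fun p : ℝ × ℝ => frame x m p.1 p.2 := by
  unfold frame; fun_prop

/-- An open set does not contain its frontier points, so `g x` is not negative; were it positive, a
neighbourhood of `x` would miss `T`. -/
lemma eq_zero_of_mem_frontier {T : Set E2} (hT : IsOpen T) {x : E2} (hx : x ∈ frontier T)
    {g : E2 → ℝ} (hg : ContinuousAt g x) (h : ∀ᶠ y in 𝓝 x, (y ∈ T ↔ g y < 0)) : g x = 0 := by
  have hxT : x ∉ T := by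
    rw [hT.frontier_eq] at hx; exact hx.2
  have h1 : ¬ g x < 0 := fun h' => hxT (h.self_of_nhds.2 h')
  by_contra h0
  have h2 : 0 < g x := lt_of_le_of_ne (not_lt.1 h1) (Ne.symm h0)
  have h3 : ∀ᶠ y in 𝓝 x, y ∉ T := by
    filter_upwards [h, hg.eventually_const_lt h2] with y hy hy' hyT
    exact absurd (hy.1 hyT) (by linarith)
  have h4 := frontier_subset_closure hx
  rw [mem_closure_iff_frequently] at h4
  exact h4 h3

lemma hasDerivAt_comp_line {g : E2 → ℝ} {x : E2} (hg : DifferentiableAt ℝ g x) (v : E2) :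
    HasDerivAt (fun t : ℝ => g (x + t • v)) ⟪gradient g x, v⟫ 0 := by
  have h1 : HasDerivAt (fun t : ℝ => x + t • v) v 0 := by
    simpa using ((hasDerivAt_id (0 : ℝ)).smul_const v).const_add x
  have h2 : HasFDerivAt g (innerSL ℝ (gradient g x)) (x + (0 : ℝ) • v) := by
    rw [zero_smul, add_zero]
    exact hg.hasGradientAt.hasFDerivAt
  exact h2.comp_hasDerivAt (0 : ℝ) h1

/-- The outward unit normal is unique. -/
lemma IsOutwardNormal.unique {T : Set E2} (hT : IsOpen T) {x m m' : E2} (hx : x ∈ frontier T)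
    (h : IsOutwardNormal T x m) (h' : IsOutwardNormal T x m') : m = m' := by
  obtain ⟨hm, g, hg, ⟨c, hc, hgc⟩, hgT⟩ := h
  obtain ⟨hm', g', hg', ⟨c', hc', hgc'⟩, hgT'⟩ := h'
  by_contra hne
  have hlt : ⟪m, m'⟫ < 1 := inner_lt_one_iff_real_of_norm_eq_one hm hm' |>.2 hne
  have z := eq_zero_of_mem_frontier hT hx hg.continuousAt hgT
  have z' := eq_zero_of_mem_frontier hT hx hg'.continuousAt hgT'
  -- If the unit vectors differ, moving in the direction `m' - m` makes `g` negative and `g'`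
  -- positive at once, although both describe `T`.
  have d := hasDerivAt_comp_line (hg.differentiableAt (by norm_num)) (m' - m)
  have d' := hasDerivAt_comp_line (hg'.differentiableAt (by norm_num)) (m' - m)
  have hneg : ⟪gradient g x, m' - m⟫ < 0 := by
    rw [hgc, inner_smul_left, inner_sub_right, inner_self_eq_one hm]
    have : ⟪m, m'⟫ - 1 < 0 := by linarith
    simpa using mul_neg_of_pos_of_neg hc this
  have hpos : 0 < ⟪gradient g' x, m' - m⟫ := by
    rw [hgc', inner_smul_left, inner_sub_right, inner_self_eq_one hm', real_inner_comm]
    have : 0 < 1 - ⟪m, m'⟫ := by linarith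
    simpa using mul_pos hc' this
  have hev := hasDerivAt_iff_tendsto_slope.1 d
  have hev' := hasDerivAt_iff_tendsto_slope.1 d'
  have hle : 𝓝[>] (0 : ℝ) ≤ 𝓝[≠] 0 := nhdsWithin_mono _ fun t ht => ne_of_gt ht
  have e1 := (hev.mono_left hle).eventually_lt_const hneg
  have e2 := (hev'.mono_left hle).eventually_const_lt hpos
  have hline : Tendsto (fun t : ℝ => x + t • (m' - m)) (𝓝[>] 0) (𝓝 x) := by
    have : Continuous fun t : ℝ => x + t • (m' - m) := by fun_prop
    have h3 := this.tendsto 0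
    simp only [zero_smul, add_zero] at h3
    exact h3.mono_left nhdsWithin_le_nhds
  obtain ⟨t, ht1, ht2, ht3, ht4, ht⟩ := (e1.and (e2.and ((hline.eventually hgT).and
    ((hline.eventually hgT').and self_mem_nhdsWithin)))).exists
  have ht0 : (0 : ℝ) < t := ht
  rw [slope_def_field] at ht1 ht2
  simp only [zero_smul, add_zero, sub_zero, z, z'] at ht1 ht2
  have h5 : g (x + t • (m' - m)) < 0 := by
    by_contra! h6; exact absurd (div_nonneg h6 ht0.le) (by linarith)
  have h6 := ht4.1 (ht3.2 h5)
  exact absurd (div_neg_of_neg_of_pos h6 ht0) (by linarith)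

/-- Near a boundary point, the domain is the subgraph of a `C¹` function. -/
lemma exists_subgraph {T : Set E2} (hT : IsOpen T) {x m : E2} (hx : x ∈ frontier T)
    (h : IsOutwardNormal T x m) :
    ∃ (f : ℝ → ℝ) (a b : ℝ), ContDiff ℝ 1 f ∧ f 0 = 0 ∧ 0 < a ∧ 0 < b ∧
      (∀ s, |s| ≤ a → |f s| < b) ∧
      ∀ s t, |s| ≤ a → |t| ≤ b → (frame x m s t ∈ T ↔ t < f s) := by
  obtain ⟨hm, g, hg, ⟨c, hc, hgc⟩, hgT⟩ := h
  have z := eq_zero_of_mem_frontier hT hx hg.continuousAt hgT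
  let G : ℝ × ℝ → ℝ := fun p => g (frame x m p.1 p.2)
  have hx0 : frame x m 0 0 = x := by simp [frame]
  have hG : ContDiffAt ℝ 1 G (0, 0) := by
    refine ContDiffAt.comp (g := g) (0, 0) ?_ (contDiff_frame x m).contDiffAt
    simpa [hx0] using hg
  have hdt : ∀ p : ℝ × ℝ, DifferentiableAt ℝ G p →
      HasDerivAt (fun t => G (p.1, t)) (fderiv ℝ G p (0, 1)) p.2 := by
    intro p hp
    have h1 : HasDerivAt (fun t : ℝ => (p.1, t)) ((0 : ℝ), (1 : ℝ)) p.2 :=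
      (hasDerivAt_const _ _).prodMk (hasDerivAt_id _)
    exact hp.hasFDerivAt.comp_hasDerivAt p.2 h1
  have hGc : fderiv ℝ G (0, 0) (0, 1) = c := by
    have h1 := hdt (0, 0) (hG.differentiableAt (by norm_num))
    have h2 := hasDerivAt_comp_line (hg.differentiableAt (by norm_num)) m
    have h3 : (fun t : ℝ => g (x + t • m)) = fun t => G ((0 : ℝ), t) := by
      ext t; simp [G, frame]
    rw [h3] at h2
    rw [h1.unique h2, hgc, inner_smul_left, inner_self_eq_one hm]
    simp
  -- The derivative of `G` in the direction of the normal is `c > 0`, so `G = 0` can be solved for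
  -- the height.
  have hinv : (fderiv ℝ G (0, 0) ∘L .inr ℝ ℝ ℝ).IsInvertible := by
    refine ⟨ContinuousLinearEquiv.smulLeft (Units.mk0 c hc.ne'), ?_⟩
    ext
    simp [hGc, Units.smul_def]
  let f₀ : ℝ → ℝ := hG.implicitFunction (by norm_num) hinv
  have hf₀ : ContDiffAt ℝ 1 f₀ 0 := hG.contDiffAt_implicitFunction (by norm_num) hinv
  have hf₀0 : f₀ 0 = 0 := hG.implicitFunction_apply_self (by norm_num) hinv
  have hG0 : G (0, 0) = 0 := by simp [G, hx0, z]
  have hfG : ∀ᶠ s in 𝓝 (0 : ℝ), G (s, f₀ s) = 0 := by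
    have := hG.eventually_apply_implicitFunction (by norm_num) hinv
    rwa [hG0] at this
  have e1 : ∀ᶠ p in 𝓝 ((0 : ℝ), (0 : ℝ)), DifferentiableAt ℝ G p := by
    filter_upwards [hG.eventually (by simp)] with p hp using hp.differentiableAt (by norm_num)
  have e2 : ∀ᶠ p in 𝓝 ((0 : ℝ), (0 : ℝ)), 0 < fderiv ℝ G p (0, 1) := by
    have hc1 : ContinuousAt (fun p => fderiv ℝ G p (0, 1)) (0, 0) :=
      (hG.continuousAt_fderiv (by norm_num)).clm_apply continuousAt_const
    exact hc1.eventually_const_lt (by simpa only [hGc] using hc)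
  have e3 : ∀ᶠ p in 𝓝 ((0 : ℝ), (0 : ℝ)), (frame x m p.1 p.2 ∈ T ↔ G p < 0) := by
    have h1 : Tendsto (fun p : ℝ × ℝ => frame x m p.1 p.2) (𝓝 (0, 0)) (𝓝 x) := by
      have := (contDiff_frame x m (n := 0)).continuous.tendsto ((0 : ℝ), (0 : ℝ))
      rwa [hx0] at this
    exact h1.eventually hgT
  obtain ⟨r, hr, hball⟩ := Metric.eventually_nhds_iff_ball.1 (e1.and (e2.and e3))
  have e4 : ∀ᶠ s in 𝓝 (0 : ℝ), |f₀ s| < r / 2 := by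
    have h1 : ContinuousAt (fun s => |f₀ s|) 0 := hf₀.continuousAt.abs
    refine h1.eventually_lt_const ?_
    simp only [hf₀0, abs_zero]; positivity
  obtain ⟨r', hr', hball'⟩ := Metric.eventually_nhds_iff_ball.1
    (hfG.and (e4.and (hf₀.eventually (by simp))))
  let a : ℝ := min (r / 2) (r' / 4)
  have ha : 0 < a := by positivity
  -- The implicit function is known to be `C¹` only near zero. Multiplying by a bump equal to one on
  -- `|s| ≤ a` makes the graph function `C¹` on the whole line.
  let χ : ContDiffBump (0 : ℝ) := ⟨r' / 4, r' / 2, by positivity, by linarith⟩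
  refine ⟨fun s => χ s * f₀ s, a, r / 2, ?_, by simp [hf₀0], ha, by positivity, ?_⟩
  · rw [contDiff_iff_contDiffAt]
    intro s
    by_cases hs : s ∈ Metric.ball (0 : ℝ) r'
    · exact χ.contDiffAt.mul (hball' s hs).2.2
    · have hs2 : s ∈ (Metric.closedBall (0 : ℝ) (r' / 2))ᶜ := fun h' =>
        hs (Metric.closedBall_subset_ball (by linarith) h')
      have : (fun s => χ s * f₀ s) =ᶠ[𝓝 s] fun _ => 0 := by
        filter_upwards [Metric.isClosed_closedBall.isOpen_compl.mem_nhds hs2] with y hy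
        have : χ y = 0 := χ.zero_of_le_dist (by
          simp only [mem_compl_iff, Metric.mem_closedBall, not_le] at hy; exact hy.le)
        simp [this]
      exact contDiffAt_const.congr_of_eventuallyEq this
  have hχ : ∀ s, |s| ≤ a → χ s * f₀ s = f₀ s := by
    intro s hs
    rw [χ.one_of_mem_closedBall (by simpa using hs.trans (min_le_right _ _)), one_mul]
  have hsr' : ∀ s, |s| ≤ a → s ∈ Metric.ball (0 : ℝ) r' := by
    intro s hs
    have := hs.trans (min_le_right (r / 2) (r' / 4))
    simp only [Metric.mem_ball, Real.dist_eq, sub_zero]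
    linarith
  refine ⟨fun s hs => ?_, fun s t hs ht => ?_⟩
  · simp only [hχ s hs]
    exact (hball' s (hsr' s hs)).2.1
  · simp only [hχ s hs]
    have hmem : ∀ t' ∈ Icc (-(r / 2)) (r / 2), (s, t') ∈ Metric.ball ((0 : ℝ), (0 : ℝ)) r := by
      intro t' ht'
      have := hs.trans (min_le_left (r / 2) (r' / 4))
      have h2 : |t'| ≤ r / 2 := abs_le.2 ht'
      simp only [Metric.mem_ball, Prod.dist_eq, Real.dist_eq, sub_zero]
      exact max_lt (by linarith) (by linarith)
    -- Along a vertical segment `G` increases strictly and vanishes at the graph, so its sign tells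
    -- the side of the graph.
    have hmono : StrictMonoOn (fun t' => G (s, t')) (Icc (-(r / 2)) (r / 2)) := by
      refine strictMonoOn_of_deriv_pos (convex_Icc _ _) (fun t' ht' => ?_) (fun t' ht' => ?_)
      · exact (hdt (s, t') (hball _ (hmem t' ht')).1).continuousAt.continuousWithinAt
      · have h1 := hball _ (hmem t' (interior_subset ht'))
        rw [(hdt (s, t') h1.1).deriv]
        exact h1.2.1
    have hf := hball' s (hsr' s hs)
    rw [(hball (s, t) (hmem t (abs_le.1 ht))).2.2, ← hf.1]
    exact hmono.lt_iff_lt (abs_le.1 ht) (abs_le.1 hf.2.1.le)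

/-! ### The divergence theorem on a subgraph -/

lemma measurePreserving_frame {m : E2} (hm : ‖m‖ = 1) (x : E2) :
    MeasurePreserving (fun p : ℝ × ℝ => frame x m p.1 p.2) := by
  let L : E2 →ₗᵢ[ℝ] E2 :=
    { toFun := fun v => v 0 • rot m + v 1 • m
      map_add' := fun v w => by simp only [PiLp.add_apply, add_smul]; abel
      map_smul' := fun c v => by simp [smul_smul]
      norm_map' := fun v => by
        change ‖v 0 • rot m + v 1 • m‖ = ‖v‖
        have h1 : ‖v 0 • rot m + v 1 • m‖ ^ 2 = ‖v‖ ^ 2 := by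
          rw [norm_add_sq_real, norm_smul, norm_smul, hm, norm_rot hm, inner_smul_left,
            inner_smul_right, real_inner_comm, inner_rot_self, EuclideanSpace.norm_sq_eq]
          simp
        exact (pow_left_inj₀ (norm_nonneg _) (norm_nonneg _) two_ne_zero).1 h1 }
  have h1 := (L.toLinearIsometryEquiv rfl).measurePreserving
  have h2 := (PiLp.volume_preserving_toLp (Fin 2)).comp (volume_preserving_finTwoArrow ℝ).symm
  have h3 := (measurePreserving_add_left (volume : Measure E2) x).comp (h1.comp h2)
  convert! h3 using 1
  ext p : 1
  change frame x m p.1 p.2 = x + (p.1 • rot m + p.2 • m)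
  rw [frame, add_assoc]

lemma injective_frame {m : E2} (hm : ‖m‖ = 1) (x : E2) :
    Function.Injective fun p : ℝ × ℝ => frame x m p.1 p.2 := by
  intro p q h
  have h' : frame x m p.1 p.2 = frame x m q.1 q.2 := h
  ext
  · rw [← inner_rot_frame_sub hm x p.1 p.2, h', inner_rot_frame_sub hm]
  · rw [← inner_frame_sub hm x p.1 p.2, h', inner_frame_sub hm]

lemma integral_frame {m : E2} (hm : ‖m‖ = 1) (x : E2) (g : E2 → ℝ) :
    ∫ p : ℝ × ℝ, g (frame x m p.1 p.2) = ∫ y, g y :=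
  (measurePreserving_frame hm x).integral_comp
    (Continuous.measurableEmbedding (contDiff_frame x m (n := 0)).continuous (injective_frame hm x)) g

/-- The shear `(s, u) ↦ (s, f s + u)`. -/
def shear (f : ℝ → ℝ) (hf : Continuous f) : ℝ × ℝ ≃ₜ ℝ × ℝ where
  toFun p := (p.1, f p.1 + p.2)
  invFun p := (p.1, p.2 - f p.1)
  left_inv p := by simp
  right_inv p := by simp
  continuous_toFun := by fun_prop
  continuous_invFun := by fun_prop

lemma measurePreserving_shear {f : ℝ → ℝ} (hf : Continuous f) :
    MeasurePreserving (shear f hf) := by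
  refine MeasurePreserving.skew_product (g := fun s u => f s + u) (MeasurePreserving.id volume)
    (by fun_prop) (Eventually.of_forall fun s => ?_)
  exact (measurePreserving_add_left volume (f s)).map_eq

lemma HasCompactSupport.comp_mk_left {g : ℝ × ℝ → ℝ} (hg : HasCompactSupport g) (s : ℝ) :
    HasCompactSupport fun u => g (s, u) :=
  HasCompactSupport.intro (hg.isCompact.image continuous_snd) fun u hu =>
    image_eq_zero_of_notMem_tsupport fun h => hu ⟨(s, u), h, rfl⟩

lemma HasCompactSupport.comp_mk_right {g : ℝ × ℝ → ℝ} (hg : HasCompactSupport g) (u : ℝ) :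
    HasCompactSupport fun s => g (s, u) :=
  HasCompactSupport.intro (hg.isCompact.image continuous_fst) fun s hs =>
    image_eq_zero_of_notMem_tsupport fun h => hs ⟨(s, u), h, rfl⟩

lemma integral_Iio_of_hasDerivAt_of_hasCompactSupport {g g' : ℝ → ℝ} (hg : ∀ u, HasDerivAt g (g' u) u)
    (hc : HasCompactSupport g) (hg' : Integrable g') (a : ℝ) : ∫ u in Iio a, g' u = g a := by
  have ht : Tendsto g atBot (𝓝 0) := by
    have h1 : g =ᶠ[atBot] 0 :=
      (hasCompactSupport_iff_eventuallyEq.1 hc).filter_mono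
        (by rw [coclosedCompact_eq_cocompact]; exact atBot_le_cocompact)
    exact tendsto_const_nhds.congr' h1.symm
  rw [← integral_Iic_eq_integral_Iio,
    integral_Iic_of_hasDerivAt_of_tendsto (hg a).continuousAt.continuousWithinAt
      (fun x _ => hg x) hg'.integrableOn ht, sub_zero]

/-- After flattening the graph by the shear, the divergence splits into `A + B`. Here `A` is the
`s`-derivative of `F₁ ∘ Z` and integrates to zero on horizontal lines; `B` is the `u`-derivative of
`F₂ ∘ Z - f' (F₁ ∘ Z)` and leaves the boundary value at `u = 0`. No second derivative of `f`
appears, because `f'` does not depend on `u`. -/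
lemma integral_subgraph_div {F₁ F₂ : ℝ × ℝ → ℝ} (h₁ : ContDiff ℝ 1 F₁) (h₂ : ContDiff ℝ 1 F₂)
    (c₁ : HasCompactSupport F₁) (c₂ : HasCompactSupport F₂) {f : ℝ → ℝ} (hf : ContDiff ℝ 1 f) :
    ∫ p in {p : ℝ × ℝ | p.2 < f p.1}, (fderiv ℝ F₁ p (1, 0) + fderiv ℝ F₂ p (0, 1)) =
      ∫ s, (F₂ (s, f s) - deriv f s * F₁ (s, f s)) := by
  have hfc := hf.continuous
  have hf'c : Continuous (deriv f) := hf.continuous_deriv (by norm_num)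
  let Z := shear f hfc
  have hZ : ∀ p, Z p = (p.1, f p.1 + p.2) := fun p => rfl
  have hd₁ : ∀ v, Continuous fun p => fderiv ℝ F₁ (Z p) v := fun v =>
    ((h₁.continuous_fderiv (by norm_num)).comp Z.continuous).clm_apply continuous_const
  have hd₂ : ∀ v, Continuous fun p => fderiv ℝ F₂ (Z p) v := fun v =>
    ((h₂.continuous_fderiv (by norm_num)).comp Z.continuous).clm_apply continuous_const
  have hk₁ : ∀ v, HasCompactSupport fun p => fderiv ℝ F₁ (Z p) v := fun v =>
    (c₁.fderiv_apply ℝ v).comp_homeomorph Z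
  have hk₂ : ∀ v, HasCompactSupport fun p => fderiv ℝ F₂ (Z p) v := fun v =>
    (c₂.fderiv_apply ℝ v).comp_homeomorph Z
  let A : ℝ × ℝ → ℝ := fun p => fderiv ℝ F₁ (Z p) (1, 0) + deriv f p.1 * fderiv ℝ F₁ (Z p) (0, 1)
  let B : ℝ × ℝ → ℝ := fun p => fderiv ℝ F₂ (Z p) (0, 1) - deriv f p.1 * fderiv ℝ F₁ (Z p) (0, 1)
  have hAc : Continuous A := (hd₁ _).add ((hf'c.comp continuous_fst).mul (hd₁ _))
  have hBc : Continuous B := (hd₂ _).sub ((hf'c.comp continuous_fst).mul (hd₁ _))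
  have hAk : HasCompactSupport A := (hk₁ _).add (hk₁ _).mul_left
  have hBk : HasCompactSupport B := (hk₂ _).sub (hk₁ _).mul_left
  have hAi : Integrable A (volume.prod volume) := hAc.integrable_of_hasCompactSupport hAk
  have hBi : Integrable B (volume.prod volume) := hBc.integrable_of_hasCompactSupport hBk
  have hset : {p : ℝ × ℝ | p.2 < f p.1} = Z '' (univ ×ˢ Iio 0) := by
    rw [Z.image_eq_preimage_symm]
    ext p
    change p.2 < f p.1 ↔ (p.1, p.2 - f p.1) ∈ univ ×ˢ Iio (0 : ℝ)
    simp
  have hsA : ∀ u, ∫ s, A (s, u) = 0 := by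
    intro u
    refine integral_eq_zero_of_hasDerivAt_of_integrable (f := fun s => F₁ (Z (s, u))) (fun s => ?_) ?_ ?_
    · have h3 : HasDerivAt (fun s : ℝ => (s, f s + u)) ((1 : ℝ), deriv f s) s :=
        (hasDerivAt_id s).prodMk ((hf.differentiable (by norm_num) s).hasDerivAt.add_const u)
      have h4 := ((h₁.differentiable (by norm_num)) (Z (s, u))).hasFDerivAt.comp_hasDerivAt s h3
      refine h4.congr_deriv ?_
      have : ((1 : ℝ), deriv f s) = (1, 0) + deriv f s • ((0 : ℝ), (1 : ℝ)) := by ext <;> simp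
      rw [this, map_add, map_smul, smul_eq_mul]
    · exact (hAc.comp (by fun_prop : Continuous fun s : ℝ => (s, u))).integrable_of_hasCompactSupport
        (HasCompactSupport.comp_mk_right hAk u)
    · exact ((h₁.continuous.comp Z.continuous).comp
        (by fun_prop : Continuous fun s : ℝ => (s, u))).integrable_of_hasCompactSupport
        (HasCompactSupport.comp_mk_right (c₁.comp_homeomorph Z) u)
  have hsB : ∀ s, ∫ u in Iio 0, B (s, u) = F₂ (s, f s) - deriv f s * F₁ (s, f s) := by
    intro s
    have h3 : ∀ u : ℝ, HasDerivAt (fun u : ℝ => (s, f s + u)) ((0 : ℝ), (1 : ℝ)) u := fun u =>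
      (hasDerivAt_const _ _).prodMk ((hasDerivAt_id u).const_add (f s))
    have h4 : ∀ u, HasDerivAt (fun u => F₂ (Z (s, u)) - deriv f s * F₁ (Z (s, u))) (B (s, u)) u :=
      fun u =>
        (((h₂.differentiable (by norm_num)) (Z (s, u))).hasFDerivAt.comp_hasDerivAt u (h3 u)).sub
        ((((h₁.differentiable (by norm_num)) (Z (s, u))).hasFDerivAt.comp_hasDerivAt u
          (h3 u)).const_mul (deriv f s))
    have h5 : HasCompactSupport fun u => F₂ (Z (s, u)) - deriv f s * F₁ (Z (s, u)) :=
      (HasCompactSupport.comp_mk_left (c₂.comp_homeomorph Z) s).sub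
        (HasCompactSupport.comp_mk_left (c₁.comp_homeomorph Z) s).mul_left
    have h6 : Integrable fun u => B (s, u) :=
      (hBc.comp (by fun_prop : Continuous fun u : ℝ => (s, u))).integrable_of_hasCompactSupport
        (HasCompactSupport.comp_mk_left hBk s)
    rw [integral_Iio_of_hasDerivAt_of_hasCompactSupport h4 h5 h6]
    simp [hZ]
  have hAB : ∀ p, fderiv ℝ F₁ (Z p) (1, 0) + fderiv ℝ F₂ (Z p) (0, 1) = A p + B p := by
    intro p; simp only [A, B]; ring
  rw [hset, (measurePreserving_shear hfc).setIntegral_image_emb Z.measurableEmbedding]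
  rw [funext hAB]
  change ∫ p in univ ×ˢ Iio (0 : ℝ), (A p + B p) ∂(volume.prod volume) = _
  have hA0 : ∫ p in univ ×ˢ Iio (0 : ℝ), A p ∂(volume.prod volume) = 0 := by
    have hi := hAi.integrableOn (s := univ ×ˢ Iio (0 : ℝ))
    rw [IntegrableOn, ← Measure.prod_restrict] at hi
    rw [← Measure.prod_restrict, integral_prod_symm _ hi, Measure.restrict_univ]
    simp [hsA]
  have hB0 : ∫ p in univ ×ˢ Iio (0 : ℝ), B p ∂(volume.prod volume) =
      ∫ s, (F₂ (s, f s) - deriv f s * F₁ (s, f s)) := by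
    rw [setIntegral_prod _ hBi.integrableOn, Measure.restrict_univ]
    simp_rw [hsB]
  rw [integral_add hAi.integrableOn hBi.integrableOn, hA0, hB0, zero_add]

/-- The divergence is a trace and can be computed in the orthonormal basis `rot m`, `m`. -/
lemma planarDiv_eq {F : E2 → E2} {y m : E2} (hm : ‖m‖ = 1) :
    planarDiv F y = ⟪fderiv ℝ F y (rot m), rot m⟫ + ⟪fderiv ℝ F y m, m⟫ := by
  have h := inner_self_eq_one hm
  rw [inner_E2] at h
  have e0 : m = m 0 • EuclideanSpace.single 0 (1 : ℝ) + m 1 • EuclideanSpace.single 1 (1 : ℝ) := by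
    ext i; fin_cases i <;> simp
  have e1 : rot m = -m 1 • EuclideanSpace.single 0 (1 : ℝ) + m 0 • EuclideanSpace.single 1 (1 : ℝ) := by
    ext i; fin_cases i <;> simp [rot]
  have d0 : fderiv ℝ F y m = m 0 • fderiv ℝ F y (EuclideanSpace.single 0 (1 : ℝ))
      + m 1 • fderiv ℝ F y (EuclideanSpace.single 1 (1 : ℝ)) := by
    conv_lhs => rw [e0]
    simp
  have d1 : fderiv ℝ F y (rot m) = -m 1 • fderiv ℝ F y (EuclideanSpace.single 0 (1 : ℝ))
      + m 0 • fderiv ℝ F y (EuclideanSpace.single 1 (1 : ℝ)) := by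
    rw [e1]; simp
  rw [d0, d1, inner_E2, inner_E2, planarDiv, Fin.sum_univ_two]
  simp [rot]
  generalize (fderiv ℝ F y (EuclideanSpace.single 0 1)).ofLp 0 = p
  generalize (fderiv ℝ F y (EuclideanSpace.single 1 1)).ofLp 1 = q
  linear_combination -(p + q) * h

lemma planarDiv_eq_zero_of_notMem_tsupport {F : E2 → E2} {y : E2} (hy : y ∉ tsupport F) :
    planarDiv F y = 0 := by
  have : fderiv ℝ F y = 0 :=
    image_eq_zero_of_notMem_tsupport fun h => hy (tsupport_fderiv_subset ℝ h)
  simp [planarDiv, this]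

/-- The divergence theorem for fields supported where the domain is a subgraph. -/
lemma integral_planarDiv_of_subgraph {T : Set E2} (hT : IsOpen T) {x m : E2} (hm : ‖m‖ = 1)
    {f : ℝ → ℝ} (hf : ContDiff ℝ 1 f) {a b : ℝ}
    (hsub : ∀ s t, |s| ≤ a → |t| ≤ b → (frame x m s t ∈ T ↔ t < f s)) {F : E2 → E2}
    (hF : ContDiff ℝ 1 F) (hc : HasCompactSupport F)
    (hsupp : ∀ y ∈ tsupport F, |⟪rot m, y - x⟫| ≤ a ∧ |⟪m, y - x⟫| ≤ b) :
    ∫ y in T, planarDiv F y = ∫ s, ⟪F (frame x m s (f s)), m - deriv f s • rot m⟫ := by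
  have hFr := hF.comp (contDiff_frame x m)
  have hcF : HasCompactSupport fun p : ℝ × ℝ => F (frame x m p.1 p.2) := by
    let g : E2 → ℝ × ℝ := fun y => (⟪rot m, y - x⟫, ⟪m, y - x⟫)
    have hg : Continuous g := by fun_prop
    refine HasCompactSupport.intro (hc.isCompact.image hg) fun p hp => ?_
    refine image_eq_zero_of_notMem_tsupport fun h => hp ⟨_, h, ?_⟩
    simp only [g]
    rw [inner_rot_frame_sub hm, inner_frame_sub hm]
  have h₁ : ContDiff ℝ 1 fun p : ℝ × ℝ => ⟪F (frame x m p.1 p.2), rot m⟫ :=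
    hFr.inner ℝ contDiff_const
  have h₂ : ContDiff ℝ 1 fun p : ℝ × ℝ => ⟪F (frame x m p.1 p.2), m⟫ :=
    hFr.inner ℝ contDiff_const
  have c₁ : HasCompactSupport fun p : ℝ × ℝ => ⟪F (frame x m p.1 p.2), rot m⟫ :=
    hcF.comp_left (g := fun v => ⟪v, rot m⟫) (inner_zero_left _)
  have c₂ : HasCompactSupport fun p : ℝ × ℝ => ⟪F (frame x m p.1 p.2), m⟫ :=
    hcF.comp_left (g := fun v => ⟪v, m⟫) (inner_zero_left _)
  have key := integral_subgraph_div h₁ h₂ c₁ c₂ hf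
  have hfr : ∀ p : ℝ × ℝ, ∀ v : ℝ × ℝ, ∀ w : E2,
      fderiv ℝ (fun p : ℝ × ℝ => ⟪F (frame x m p.1 p.2), w⟫) p v =
        ⟪fderiv ℝ F (frame x m p.1 p.2) (v.1 • rot m + v.2 • m), w⟫ := by
    intro p v w
    have d1 : HasFDerivAt (fun p : ℝ × ℝ => frame x m p.1 p.2)
        ((ContinuousLinearMap.fst ℝ ℝ ℝ).smulRight (rot m) +
          (ContinuousLinearMap.snd ℝ ℝ ℝ).smulRight m) p := by
      unfold frame
      exact ((hasFDerivAt_fst.smul_const (rot m)).const_add x).add (hasFDerivAt_snd.smul_const m)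
    have d2 := (((hF.differentiable (by norm_num)) (frame x m p.1 p.2)).hasFDerivAt.comp p d1)
    have d3 : HasFDerivAt (fun p : ℝ × ℝ => ⟪F (frame x m p.1 p.2), w⟫) _ p :=
      ((innerSL ℝ w).hasFDerivAt.comp p d2).congr_of_eventuallyEq
        (Eventually.of_forall fun q => (real_inner_comm _ _))
    rw [d3.fderiv]
    simp [real_inner_comm, inner_add_right, inner_smul_right]
  -- On the support of `F` the box description identifies `T` with the subgraph; off the support
  -- both sides vanish, so nothing need be known about `T` there.
  have e1 : ∀ p : ℝ × ℝ, T.indicator (planarDiv F) (frame x m p.1 p.2) =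
      {p : ℝ × ℝ | p.2 < f p.1}.indicator (fun p =>
        fderiv ℝ (fun p : ℝ × ℝ => ⟪F (frame x m p.1 p.2), rot m⟫) p (1, 0) +
        fderiv ℝ (fun p : ℝ × ℝ => ⟪F (frame x m p.1 p.2), m⟫) p (0, 1)) p := by
    intro p
    have e2 : fderiv ℝ (fun p : ℝ × ℝ => ⟪F (frame x m p.1 p.2), rot m⟫) p (1, 0) +
        fderiv ℝ (fun p : ℝ × ℝ => ⟪F (frame x m p.1 p.2), m⟫) p (0, 1) =
        planarDiv F (frame x m p.1 p.2) := by
      rw [hfr, hfr, planarDiv_eq hm]; simp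
    by_cases hp : frame x m p.1 p.2 ∈ tsupport F
    · have h3 := hsupp _ hp
      rw [inner_rot_frame_sub hm, inner_frame_sub hm] at h3
      have h4 := hsub _ _ h3.1 h3.2
      by_cases h5 : p.2 < f p.1
      · rw [indicator_of_mem (h4.2 h5), indicator_of_mem (by exact h5), e2]
      · rw [indicator_of_notMem fun h => h5 (h4.1 h), indicator_of_notMem (by exact h5)]
    · have h3 := planarDiv_eq_zero_of_notMem_tsupport hp
      have h4 : ∀ (S : Set (ℝ × ℝ)) (g : ℝ × ℝ → ℝ), g p = 0 → S.indicator g p = 0 := fun S g hg =>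
        indicator_apply_eq_zero.2 fun _ => hg
      rw [h4 _ _ (e2.trans h3)]
      exact indicator_apply_eq_zero.2 fun _ => h3
  rw [← integral_indicator hT.measurableSet, ← integral_frame hm x]
  simp_rw [e1]
  have hms : MeasurableSet {p : ℝ × ℝ | p.2 < f p.1} :=
    measurableSet_lt measurable_snd (hf.continuous.measurable.comp measurable_fst)
  rw [integral_indicator hms, key]
  refine integral_congr_ae (Eventually.of_forall fun s => ?_)
  simp only
  rw [inner_sub_right, inner_smul_right]

/-! ### Gram determinants and the conormal -/

/-- The planar cross product. -/
def cross (v w : E2) : ℝ := v 0 * w 1 - v 1 * w 0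

lemma det_adjoint_comp_self (A : E2 →L[ℝ] E3) :
    ((ContinuousLinearMap.adjoint A) ∘L A).det =
      ‖A (EuclideanSpace.single 0 1)‖ ^ 2 * ‖A (EuclideanSpace.single 1 1)‖ ^ 2 -
        ⟪A (EuclideanSpace.single 0 1), A (EuclideanSpace.single 1 1)⟫ ^ 2 := by
  let b := (EuclideanSpace.basisFun (Fin 2) ℝ).toBasis
  rw [ContinuousLinearMap.det, ← LinearMap.det_toMatrix b, Matrix.det_fin_two]
  have h : ∀ i j : Fin 2, LinearMap.toMatrix b b ((ContinuousLinearMap.adjoint A) ∘L A).toLinearMap i j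
      = ⟪A (EuclideanSpace.single i 1), A (EuclideanSpace.single j 1)⟫ := by
    intro i j
    rw [← ContinuousLinearMap.adjoint_inner_right, LinearMap.toMatrix_apply]
    simp [b, EuclideanSpace.inner_single_left]
  rw [h, h, h, h, real_inner_self_eq_norm_sq, real_inner_self_eq_norm_sq,
    real_inner_comm (A (EuclideanSpace.single 0 1)) (A (EuclideanSpace.single 1 1))]
  ring

lemma eq_single_add_single (v : E2) :
    v = v 0 • EuclideanSpace.single 0 (1 : ℝ) + v 1 • EuclideanSpace.single 1 (1 : ℝ) := by
  ext i; fin_cases i <;> simp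

/-- The Gram determinant of `A v`, `A w` scales by the square of the determinant of `v`, `w`. -/
lemma gram_eq (A : E2 →L[ℝ] E3) (v w : E2) :
    ‖A v‖ ^ 2 * ‖A w‖ ^ 2 - ⟪A v, A w⟫ ^ 2 =
      ((ContinuousLinearMap.adjoint A) ∘L A).det * cross v w ^ 2 := by
  rw [det_adjoint_comp_self]
  have hv : A v = v 0 • A (EuclideanSpace.single 0 (1 : ℝ)) + v 1 • A (EuclideanSpace.single 1 (1 : ℝ)) := by
    conv_lhs => rw [eq_single_add_single v]
    simp
  have hw : A w = w 0 • A (EuclideanSpace.single 0 (1 : ℝ)) + w 1 • A (EuclideanSpace.single 1 (1 : ℝ)) := by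
    conv_lhs => rw [eq_single_add_single w]
    simp
  rw [hv, hw]
  generalize A (EuclideanSpace.single 0 (1 : ℝ)) = p
  generalize A (EuclideanSpace.single 1 (1 : ℝ)) = q
  simp only [← real_inner_self_eq_norm_sq, inner_add_left, inner_add_right, inner_smul_left,
    inner_smul_right, real_inner_comm p q, cross]
  simp
  ring

/-- With `p`, `q` the images of the basis vectors, `‖q‖² p - ⟪p, q⟫ q` is nonzero by injectivity,
and its squared length is `‖q‖²` times the Gram determinant. -/
lemma det_adjoint_comp_self_pos {A : E2 →L[ℝ] E3} (hA : Function.Injective A) :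
    0 < ((ContinuousLinearMap.adjoint A) ∘L A).det := by
  rw [det_adjoint_comp_self]
  have hne : ∀ v : E2, v ≠ 0 → A v ≠ 0 := fun v hv h => hv (hA (by rw [h, map_zero]))
  have hq := hne (EuclideanSpace.single 1 (1 : ℝ)) (by simp)
  have hw : ‖A (EuclideanSpace.single 1 1)‖ ^ 2 • A (EuclideanSpace.single 0 1) -
      ⟪A (EuclideanSpace.single 0 1), A (EuclideanSpace.single 1 1)⟫ • A (EuclideanSpace.single 1 1)
      ≠ 0 := by
    rw [← map_smul, ← map_smul, ← map_sub]
    refine hne _ fun h => ?_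
    have := congrArg (fun v : E2 => v 0) h
    simp at this
    exact hq this
  generalize A (EuclideanSpace.single 0 (1 : ℝ)) = p at *
  generalize A (EuclideanSpace.single 1 (1 : ℝ)) = q at *
  have h1 : 0 < ‖‖q‖ ^ 2 • p - ⟪p, q⟫ • q‖ ^ 2 := by positivity
  have h2 : ‖‖q‖ ^ 2 • p - ⟪p, q⟫ • q‖ ^ 2 = ‖q‖ ^ 2 * (‖p‖ ^ 2 * ‖q‖ ^ 2 - ⟪p, q⟫ ^ 2) := by
    rw [norm_sub_sq_real, norm_smul, norm_smul, inner_smul_left, inner_smul_right, mul_pow, mul_pow,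
      Real.norm_eq_abs, Real.norm_eq_abs, sq_abs, sq_abs]
    simp
    ring
  rw [h2] at h1
  exact pos_of_mul_pos_right h1 (by positivity)

lemma J0_pos {ψ : E3 → E3} {x : E2} (h : Function.Injective (D0 ψ x)) : 0 < J0 ψ x :=
  Real.sqrt_pos.2 (det_adjoint_comp_self_pos h)

/-- The length of the conormal component of the image of a transversal vector. -/
lemma inner_conormal_mul_norm {A : E2 →L[ℝ] E3} {n : E3} (hn : ‖n‖ = 1) (hr : n ∈ range A) {v w : E2}
    (hvw : cross v w ≠ 0) (hv : ⟪n, A v⟫ = 0) (hw : 0 < ⟪n, A w⟫) :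
    ‖A v‖ * ⟪n, A w⟫ = Real.sqrt ((ContinuousLinearMap.adjoint A) ∘L A).det * |cross v w| := by
  obtain ⟨u, hu⟩ := hr
  -- Cramer's rule expresses the preimage `u` of `n` through `v` and `w`. Pairing the image of this
  -- identity with `n`, `A v` and `A w` gives three scalar equations, from which the coefficients of
  -- `u` are eliminated.
  have h1 : cross v w • u = cross u w • v - cross u v • w := by
    ext i; fin_cases i <;> simp [cross] <;> ring
  have h2 : cross v w • n = cross u w • A v - cross u v • A w := by
    rw [← hu, ← map_smul, h1, map_sub, map_smul, map_smul]
  have e1 : cross v w = -cross u v * ⟪n, A w⟫ := by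
    have := congrArg (fun z => ⟪n, z⟫) h2
    simp only [inner_smul_right, inner_sub_right, hv, real_inner_self_eq_norm_sq, hn] at this
    linarith
  have e2 : 0 = cross u w * ‖A v‖ ^ 2 - cross u v * ⟪A v, A w⟫ := by
    have := congrArg (fun z => ⟪A v, z⟫) h2
    simp only [inner_smul_right, inner_sub_right, real_inner_self_eq_norm_sq,
      real_inner_comm n (A v), hv] at this
    linarith
  have e3 : cross v w * ⟪n, A w⟫ = cross u w * ⟪A v, A w⟫ - cross u v * ‖A w‖ ^ 2 := by
    have := congrArg (fun z => ⟪A w, z⟫) h2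
    simp only [inner_smul_right, inner_sub_right, real_inner_self_eq_norm_sq,
      real_inner_comm n (A w), real_inner_comm (A v) (A w)] at this
    linarith
  have hg := gram_eq A v w
  have h4 : cross v w * (‖A v‖ * ⟪n, A w⟫) ^ 2 =
      cross v w * (((ContinuousLinearMap.adjoint A) ∘L A).det * cross v w ^ 2) := by
    rw [← hg]
    linear_combination ‖A v‖ ^ 2 * ⟪n, A w⟫ * e3 - ⟪n, A w⟫ * ⟪A v, A w⟫ * e2 -
      (‖A v‖ ^ 2 * ‖A w‖ ^ 2 - ⟪A v, A w⟫ ^ 2) * e1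
  have h5 := mul_left_cancel₀ hvw h4
  rw [← sq_abs (cross v w)] at h5
  rw [← Real.sqrt_sq (show 0 ≤ ‖A v‖ * ⟪n, A w⟫ by positivity), h5,
    Real.sqrt_mul' _ (by positivity), Real.sqrt_sq (abs_nonneg _)]

/-! ### Boundary patches -/

/-- A coordinate box in which the domain is the subgraph of a `C¹` function. -/
structure BoundaryPatch (T : Set E2) where
  /-- The origin of the box. -/
  x : E2
  /-- The direction in which the boundary is a graph. -/
  m : E2
  /-- The function whose graph is the boundary. -/
  f : ℝ → ℝ
  /-- The half width of the box. -/
  a : ℝ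
  /-- The half height of the box. -/
  b : ℝ
  norm_m : ‖m‖ = 1
  contDiff : ContDiff ℝ 1 f
  a_pos : 0 < a
  abs_lt : ∀ s, |s| ≤ a → |f s| < b
  mem_iff : ∀ s t, |s| ≤ a → |t| ≤ b → (frame x m s t ∈ T ↔ t < f s)

namespace BoundaryPatch

variable {T : Set E2} (P : BoundaryPatch T)

/-- The open coordinate box. -/
def box : Set E2 := {y | |⟪rot P.m, y - P.x⟫| < P.a ∧ |⟪P.m, y - P.x⟫| < P.b}

/-- The boundary curve. -/
def curve (s : ℝ) : E2 := frame P.x P.m s (P.f s)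

/-- The tangent vector of the boundary curve. -/
def tangent (s : ℝ) : E2 := rot P.m + deriv P.f s • P.m

/-- The (not normalized) outward normal of the boundary curve. -/
def normal (s : ℝ) : E2 := P.m - deriv P.f s • rot P.m

lemma isOpen_box : IsOpen P.box := by
  have h1 : Continuous fun y : E2 => |⟪rot P.m, y - P.x⟫| := by fun_prop
  have h2 : Continuous fun y : E2 => |⟪P.m, y - P.x⟫| := by fun_prop
  exact (isOpen_lt h1 continuous_const).inter (isOpen_lt h2 continuous_const)

lemma contDiff_curve : ContDiff ℝ 1 P.curve := by
  have := P.contDiff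
  unfold curve frame; fun_prop

lemma hasDerivAt_curve (s : ℝ) : HasDerivAt P.curve (P.tangent s) s := by
  have h1 := (P.contDiff.differentiable (by norm_num) s).hasDerivAt
  have h2 := (((hasDerivAt_id s).smul_const (rot P.m)).const_add P.x).add (h1.smul_const P.m)
  simpa [tangent] using! h2

lemma inner_rot_curve (s : ℝ) : ⟪rot P.m, P.curve s - P.x⟫ = s := inner_rot_frame_sub P.norm_m _ _ _

lemma inner_curve (s : ℝ) : ⟪P.m, P.curve s - P.x⟫ = P.f s := inner_frame_sub P.norm_m _ _ _

lemma injective_curve : Function.Injective P.curve := fun s t h => by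
  rw [← P.inner_rot_curve s, h, P.inner_rot_curve]

lemma curve_notMem {s : ℝ} (hs : |s| ≤ P.a) : P.curve s ∉ T := fun h =>
  lt_irrefl _ ((P.mem_iff s (P.f s) hs (P.abs_lt s hs).le).1 h)

lemma curve_mem_closure {s : ℝ} (hs : |s| ≤ P.a) : P.curve s ∈ closure T := by
  have h1 : Continuous fun t : ℝ => frame P.x P.m s (P.f s - t) := by unfold frame; fun_prop
  have h2 : Tendsto (fun t : ℝ => frame P.x P.m s (P.f s - t)) (𝓝[>] 0) (𝓝 (P.curve s)) := by
    have := h1.tendsto 0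
    simp only [sub_zero] at this
    exact this.mono_left nhdsWithin_le_nhds
  refine mem_closure_of_tendsto h2 ?_
  have h3 := _root_.abs_lt.1 (P.abs_lt s hs)
  have h4 : ∀ᶠ t : ℝ in 𝓝[>] 0, t < P.f s + P.b :=
    nhdsWithin_le_nhds (Iio_mem_nhds (by linarith))
  filter_upwards [h4, self_mem_nhdsWithin] with t ht ht0
  have ht0' : (0 : ℝ) < t := ht0
  exact (P.mem_iff s _ hs (abs_le.2 ⟨by linarith, by linarith⟩)).2 (by linarith)

lemma curve_mem_frontier (hT : IsOpen T) {s : ℝ} (hs : |s| ≤ P.a) : P.curve s ∈ frontier T := by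
  rw [hT.frontier_eq]
  exact ⟨P.curve_mem_closure hs, P.curve_notMem hs⟩

lemma mem_iff_of_mem_box {y : E2} (hy : y ∈ P.box) :
    y ∈ T ↔ ⟪P.m, y - P.x⟫ < P.f ⟪rot P.m, y - P.x⟫ := by
  have := P.mem_iff _ _ hy.1.le hy.2.le
  rwa [frame_inner_inner P.norm_m] at this

/-- Inside the box, height minus `f` is a defining function of `T`, and defining functions vanish on
the frontier. -/
lemma eq_curve_of_mem_frontier (hT : IsOpen T) {y : E2} (hy : y ∈ frontier T) (hyb : y ∈ P.box) :
    P.curve ⟪rot P.m, y - P.x⟫ = y := by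
  let g : E2 → ℝ := fun y => ⟪P.m, y - P.x⟫ - P.f ⟪rot P.m, y - P.x⟫
  have hf := P.contDiff.continuous
  have hg : Continuous g := by fun_prop
  have h0 := eq_zero_of_mem_frontier hT hy hg.continuousAt (by
    filter_upwards [P.isOpen_box.mem_nhds hyb] with z hz
    rw [P.mem_iff_of_mem_box hz]
    simp [g])
  have h1 : P.f ⟪rot P.m, y - P.x⟫ = ⟪P.m, y - P.x⟫ := by simp only [g] at h0; linarith
  rw [curve, h1, frame_inner_inner P.norm_m]

lemma curve_mem_box {s : ℝ} (hs : |s| < P.a) : P.curve s ∈ P.box := by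
  refine ⟨?_, ?_⟩
  · rwa [P.inner_rot_curve]
  · rw [P.inner_curve]; exact P.abs_lt s hs.le

lemma inner_tangent_normal (s : ℝ) : ⟪P.normal s, P.tangent s⟫ = 0 := by
  simp only [tangent, normal, inner_add_right, inner_sub_left, inner_smul_left, inner_smul_right,
    inner_rot_self, inner_self_eq_one P.norm_m, inner_rot_rot P.norm_m,
    real_inner_comm P.m (rot P.m)]
  simp

lemma norm_sq_normal (s : ℝ) : ‖P.normal s‖ ^ 2 = 1 + deriv P.f s ^ 2 := by
  rw [normal, norm_sub_sq_real, norm_smul, P.norm_m, norm_rot P.norm_m, inner_smul_right,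
    inner_rot_self]
  simp

lemma norm_normal_pos (s : ℝ) : 0 < ‖P.normal s‖ := by
  have := P.norm_sq_normal s
  have h : 0 < ‖P.normal s‖ ^ 2 := by rw [this]; positivity
  exact lt_of_le_of_ne (norm_nonneg _) fun h0 => by rw [← h0] at h; simp at h

lemma cross_tangent_normal (s : ℝ) : cross (P.tangent s) (P.normal s) = -(1 + deriv P.f s ^ 2) := by
  have h := inner_self_eq_one P.norm_m
  rw [inner_E2] at h
  simp [cross, tangent, normal, rot]
  linear_combination -(1 + deriv P.f s ^ 2) * h

lemma isOutwardNormal {s : ℝ} (hs : |s| < P.a) :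
    IsOutwardNormal T (P.curve s) (‖P.normal s‖⁻¹ • P.normal s) := by
  have h0 := P.norm_normal_pos s
  refine ⟨by rw [norm_smul, norm_inv, norm_norm, inv_mul_cancel₀ h0.ne'],
    fun y => ⟪P.m, y - P.x⟫ - P.f ⟪rot P.m, y - P.x⟫, ?_, ⟨‖P.normal s‖, h0, ?_⟩, ?_⟩
  · have := P.contDiff
    exact ((contDiff_const.inner ℝ (contDiff_id.sub contDiff_const)).sub
      (P.contDiff.comp (contDiff_const.inner ℝ (contDiff_id.sub contDiff_const)))).contDiffAt
  · rw [smul_smul, mul_inv_cancel₀ h0.ne', one_smul]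
    apply HasGradientAt.gradient
    rw [hasGradientAt_iff_hasFDerivAt]
    have h1 : ∀ w : E2, HasFDerivAt (fun y => ⟪w, y - P.x⟫) (innerSL ℝ w) (P.curve s) := fun w =>
      (innerSL ℝ w).hasFDerivAt.comp (P.curve s) ((hasFDerivAt_id (P.curve s)).sub_const P.x)
    have h2 : HasDerivAt P.f (deriv P.f s) ⟪rot P.m, P.curve s - P.x⟫ := by
      rw [P.inner_rot_curve]
      exact (P.contDiff.differentiable (by norm_num) s).hasDerivAt
    have h3 := (h1 P.m).sub (h2.comp_hasFDerivAt (P.curve s) (h1 (rot P.m)))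
    refine h3.congr_fderiv ?_
    ext v
    simp [normal]
  · filter_upwards [P.isOpen_box.mem_nhds (P.curve_mem_box hs)] with y hy
    rw [P.mem_iff_of_mem_box hy, sub_neg]

end BoundaryPatch

lemma exists_boundaryPatch {T : Set E2} (hT : IsC1Domain T) {x : E2} (hx : x ∈ frontier T) :
    ∃ P : BoundaryPatch T, x ∈ P.box := by
  obtain ⟨m, hm⟩ := hT.boundary x hx
  obtain ⟨f, a, b, hf, -, ha, hb, hab, hmem⟩ := exists_subgraph hT.isOpen hx hm
  refine ⟨⟨x, m, f, a, b, hm.1, hf, ha, hab, hmem⟩, ?_⟩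
  simp [BoundaryPatch.box, ha, hb]

lemma IsC1Domain.isCompact_closure {T : Set E2} (hT : IsC1Domain T) : IsCompact (closure T) :=
  hT.isBounded.isCompact_closure

lemma IsC1Domain.isCompact_frontier {T : Set E2} (hT : IsC1Domain T) : IsCompact (frontier T) :=
  hT.isCompact_closure.of_isClosed_subset isClosed_frontier frontier_subset_closure

/-- The boundary of a `C¹` domain is covered by finitely many patches. -/
lemma exists_finite_patches {T : Set E2} (hT : IsC1Domain T) :
    ∃ (N : ℕ) (P : Fin N → BoundaryPatch T), frontier T ⊆ ⋃ i, (P i).box := by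
  choose P hP using fun x : frontier T => exists_boundaryPatch hT x.2
  obtain ⟨t, ht⟩ := hT.isCompact_frontier.elim_finite_subcover (fun x => (P x).box)
    (fun x => (P x).isOpen_box) fun x hx => mem_iUnion.2 ⟨⟨x, hx⟩, hP ⟨x, hx⟩⟩
  refine ⟨t.card, fun i => P (t.equivFin.symm i), fun x hx => ?_⟩
  obtain ⟨y, hy, hxy⟩ := mem_iUnion₂.1 (ht hx)
  exact mem_iUnion.2 ⟨t.equivFin ⟨y, hy⟩, by simpa using hxy⟩

/-! ### Boundary patches of the surface -/

lemma contDiff_pt {n : WithTop ℕ∞} : ContDiff ℝ n fun z : E2 × ℝ => pt z.1 z.2 := by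
  rw [contDiff_euclidean]
  intro i
  fin_cases i
  · exact (contDiff_euclidean.1 contDiff_fst 0)
  · exact (contDiff_euclidean.1 contDiff_fst 1)
  · exact contDiff_snd

lemma IsFilmChart.contDiff_slab {ψ ν : E3 → E3} {T : Set E2} (hψ : IsFilmChart ψ T ν) :
    ContDiff ℝ 1 fun z : E2 × ℝ => ψ (pt z.1 z.2) :=
  hψ.contDiff.comp contDiff_pt

lemma IsFilmChart.contDiff_mid {ψ ν : E3 → E3} {T : Set E2} (hψ : IsFilmChart ψ T ν) :
    ContDiff ℝ 1 (mid ψ) :=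
  hψ.contDiff_slab.comp (contDiff_id.prodMk contDiff_const)

lemma IsFilmChart.injOn_mid {ψ ν : E3 → E3} {T : Set E2} (hψ : IsFilmChart ψ T ν) :
    InjOn (mid ψ) (closure T) := by
  obtain ⟨h, h0, hi⟩ := hψ.injOn
  intro x hx y hy hxy
  have := @hi (x, 0) ⟨hx, by simp [h0.le]⟩ (y, 0) ⟨hy, by simp [h0.le]⟩ hxy
  exact congrArg Prod.fst this

/-- The parameter of a point of the closed surface. -/
def param (ψ : E3 → E3) (T : Set E2) : E3 → E2 := Function.invFunOn (mid ψ) (closure T)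

lemma IsFilmChart.param_mid {ψ ν : E3 → E3} {T : Set E2} (hψ : IsFilmChart ψ T ν) {x : E2}
    (hx : x ∈ closure T) : param ψ T (mid ψ x) = x :=
  hψ.injOn_mid.leftInvOn_invFunOn hx

/-- The normal component, at the boundary of the surface, of the tangent field whose components
multiplied by the surface Jacobian are `F`. -/
def fluxDensity (ψ : E3 → E3) (T : Set E2) (n : E3 → E3) (F : E2 → E2) (r : E3) : ℝ :=
  ⟪D0 ψ (param ψ T r) (F (param ψ T r)), n r⟫ / J0 ψ (param ψ T r)

lemma IsC1Domain.isCompact_surfaceBoundary {ψ ν : E3 → E3} {T : Set E2} (hT : IsC1Domain T)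
    (hψ : IsFilmChart ψ T ν) : IsCompact (surfaceBoundary ψ T) :=
  hT.isCompact_frontier.image hψ.contDiff_mid.continuous

namespace BoundaryPatch

variable {T : Set E2} (P : BoundaryPatch T) {ψ ν n : E3 → E3}

lemma contDiff_mid_curve (hψ : IsFilmChart ψ T ν) : ContDiff ℝ 1 fun s => mid ψ (P.curve s) :=
  hψ.contDiff_mid.comp P.contDiff_curve

lemma deriv_mid_curve (hψ : IsFilmChart ψ T ν) (s : ℝ) :
    deriv (fun s => mid ψ (P.curve s)) s = D0 ψ (P.curve s) (P.tangent s) :=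
  ((hψ.contDiff_mid.differentiable (by norm_num) _).hasFDerivAt.comp_hasDerivAt s
    (P.hasDerivAt_curve s)).deriv

lemma injOn_mid_curve (hψ : IsFilmChart ψ T ν) :
    InjOn (fun s => mid ψ (P.curve s)) (Icc (-P.a) P.a) := fun _ hs _ ht h =>
  P.injective_curve (hψ.injOn_mid (P.curve_mem_closure (abs_le.2 hs))
    (P.curve_mem_closure (abs_le.2 ht)) h)

/-- The conormal kills the image of the tangent, so only the component of `F` along the planar
normal `N` contributes. For it, `‖D0 τ‖ ⟪n, D0 N⟫ = J0 |τ × N|` with `|τ × N| = 1 + f'² = ‖N‖²`, and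
the factor `J0` cancels the denominator of the flux density. -/
lemma norm_deriv_mul_fluxDensity (hT : IsC1Domain T) (hψ : IsFilmChart ψ T ν)
    (hn : ∀ x ∈ frontier T, IsOutwardConormal ψ T x (n (mid ψ x))) (F : E2 → E2) {s : ℝ}
    (hs : |s| < P.a) :
    ‖deriv (fun s => mid ψ (P.curve s)) s‖ * fluxDensity ψ T n F (mid ψ (P.curve s)) =
      ⟪F (P.curve s), P.normal s⟫ := by
  have hx := P.curve_mem_frontier hT.isOpen hs.le
  have hxc := P.curve_mem_closure hs.le
  obtain ⟨h1, hr, m, hm, hort, hpos⟩ := hn _ hx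
  have hN := P.norm_normal_pos s
  have hmN := hm.unique hT.isOpen hx (P.isOutwardNormal hs)
  have hV : ⟪n (mid ψ (P.curve s)), D0 ψ (P.curve s) (P.tangent s)⟫ = 0 := by
    apply hort
    rw [hmN, inner_smul_left, P.inner_tangent_normal, mul_zero]
  have hM : 0 < ⟪n (mid ψ (P.curve s)), D0 ψ (P.curve s) (P.normal s)⟫ := by
    rw [hmN, map_smul, inner_smul_right] at hpos
    exact pos_of_mul_pos_right hpos (by positivity)
  have hc := P.cross_tangent_normal s
  have hc0 : 0 < 1 + deriv P.f s ^ 2 := by positivity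
  have key := inner_conormal_mul_norm h1 hr (v := P.tangent s) (w := P.normal s)
    (by rw [hc]; exact neg_ne_zero.2 hc0.ne') hV hM
  rw [hc, abs_neg, abs_of_pos hc0] at key
  have hJ : 0 < J0 ψ (P.curve s) := J0_pos (hψ.immersion _ hxc)
  change _ = J0 ψ (P.curve s) * _ at key
  -- Expansion of `F` in the orthogonal frame of tangent and normal, both of squared length `1 +
  -- f'²`.
  have hF : (1 + deriv P.f s ^ 2) • F (P.curve s) =
      -cross (F (P.curve s)) (P.normal s) • P.tangent s +
        ⟪F (P.curve s), P.normal s⟫ • P.normal s := by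
    have h := inner_self_eq_one P.norm_m
    rw [inner_E2] at h
    rw [inner_E2]
    generalize F (P.curve s) = w
    ext i
    fin_cases i
    · simp [cross, tangent, normal, rot]
      linear_combination (-(1 + deriv P.f s ^ 2) * w 0) * h
    · simp [cross, tangent, normal, rot]
      linear_combination (-(1 + deriv P.f s ^ 2) * w 1) * h
  have hF2 : (1 + deriv P.f s ^ 2) * ⟪D0 ψ (P.curve s) (F (P.curve s)), n (mid ψ (P.curve s))⟫ =
      ⟪F (P.curve s), P.normal s⟫ * ⟪n (mid ψ (P.curve s)), D0 ψ (P.curve s) (P.normal s)⟫ := by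
    have := congrArg (fun z => ⟪n (mid ψ (P.curve s)), D0 ψ (P.curve s) z⟫) hF
    simp only [map_smul, map_add, inner_add_right, inner_smul_right, hV, mul_zero, zero_add] at this
    rwa [real_inner_comm]
  rw [fluxDensity, hψ.param_mid hxc, P.deriv_mid_curve hψ, mul_div_assoc', div_eq_iff hJ.ne']
  apply mul_left_cancel₀ hc0.ne'
  linear_combination ‖D0 ψ (P.curve s) (P.tangent s)‖ * hF2 + ⟪F (P.curve s), P.normal s⟫ * key

lemma continuous_normal : Continuous P.normal := by
  have := P.contDiff.continuous_deriv (by norm_num)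
  unfold normal; fun_prop

lemma isBounded_box : Bornology.IsBounded P.box := by
  refine (Metric.isBounded_closedBall (x := P.x) (r := P.a + P.b)).subset fun y hy => ?_
  rw [mem_closedBall_iff_norm]
  have h : y - P.x = ⟪rot P.m, y - P.x⟫ • rot P.m + ⟪P.m, y - P.x⟫ • P.m := by
    conv_lhs => rw [← frame_inner_inner P.norm_m P.x y]
    simp only [frame]; abel
  rw [h]
  refine (norm_add_le _ _).trans ?_
  rw [norm_smul, norm_smul, P.norm_m, norm_rot P.norm_m, mul_one, mul_one]
  exact add_le_add hy.1.le hy.2.le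

/-- The divergence theorem for fields supported in a boundary patch. -/
lemma integral_planarDiv (hT : IsC1Domain T) (hψ : IsFilmChart ψ T ν)
    (hn : ∀ x ∈ frontier T, IsOutwardConormal ψ T x (n (mid ψ x))) {F : E2 → E2}
    (hF : ContDiff ℝ 1 F) (hsupp : tsupport F ⊆ P.box) :
    IntegrableOn (fluxDensity ψ T n F) (surfaceBoundary ψ T) μH[1] ∧
      ∫ y in T, planarDiv F y = ∫ r in surfaceBoundary ψ T, fluxDensity ψ T n F r ∂μH[1] := by
  have hc : HasCompactSupport F :=
    Metric.isCompact_of_isClosed_isBounded (isClosed_tsupport F) (P.isBounded_box.subset hsupp)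
  have hI : Ioo (-P.a) P.a ⊆ Icc (-P.a) P.a := Ioo_subset_Icc_self
  have hsub : (fun s => mid ψ (P.curve s)) '' Ioo (-P.a) P.a ⊆ surfaceBoundary ψ T := by
    rintro _ ⟨s, hs, rfl⟩
    exact ⟨_, P.curve_mem_frontier hT.isOpen (_root_.abs_lt.2 hs).le, rfl⟩
  -- Boundary points outside the box carry no flux, so the integral over the whole boundary curve
  -- reduces to the single arc of this patch.
  have hz : ∀ r ∈ surfaceBoundary ψ T \ (fun s => mid ψ (P.curve s)) '' Ioo (-P.a) P.a,
      fluxDensity ψ T n F r = 0 := by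
    rintro _ ⟨⟨x, hx, rfl⟩, hx'⟩
    have hxb : x ∉ P.box := fun hxb =>
      hx' ⟨_, _root_.abs_lt.1 hxb.1, by simp only [P.eq_curve_of_mem_frontier hT.isOpen hx hxb]⟩
    have : F x = 0 := image_eq_zero_of_notMem_tsupport fun h => hxb (hsupp h)
    rw [fluxDensity, hψ.param_mid (frontier_subset_closure hx), this]
    simp
  have hmeas := (hT.isCompact_surfaceBoundary hψ).measurableSet
  have hmeas' := measurableSet_image_curve (P.contDiff_mid_curve hψ) (P.injOn_mid_curve hψ)
    measurableSet_Ioo hI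
  have hcongr : ∀ s ∈ Ioo (-P.a) P.a, ⟪F (P.curve s), P.normal s⟫ =
      ‖deriv (fun s => mid ψ (P.curve s)) s‖ * fluxDensity ψ T n F (mid ψ (P.curve s)) :=
    fun s hs => (P.norm_deriv_mul_fluxDensity hT hψ hn F (_root_.abs_lt.2 hs)).symm
  constructor
  · have h1 : IntegrableOn (fluxDensity ψ T n F)
        ((fun s => mid ψ (P.curve s)) '' Ioo (-P.a) P.a) μH[1] := by
      rw [integrableOn_image_curve_iff (P.contDiff_mid_curve hψ) (P.injOn_mid_curve hψ)
        measurableSet_Ioo hI, ← integrableOn_congr_fun hcongr measurableSet_Ioo]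
      refine IntegrableOn.mono_set (Continuous.integrableOn_Icc ?_) hI
      have := P.continuous_normal
      have := hF.continuous
      have := P.contDiff_curve.continuous
      fun_prop
    rw [← union_sdiff_cancel hsub]
    refine h1.union ?_
    rw [integrableOn_congr_fun (g := fun _ => (0 : ℝ)) hz (hmeas.diff hmeas')]
    exact integrableOn_zero
  · rw [setIntegral_eq_of_subset_of_forall_sdiff_eq_zero hmeas hsub hz,
      setIntegral_image_curve (P.contDiff_mid_curve hψ) (P.injOn_mid_curve hψ) measurableSet_Ioo hI,
      ← setIntegral_congr_fun measurableSet_Ioo hcongr,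
      integral_planarDiv_of_subgraph hT.isOpen P.norm_m P.contDiff P.mem_iff hF hc
        fun y hy => ⟨(hsupp hy).1.le, (hsupp hy).2.le⟩]
    symm
    apply setIntegral_eq_integral_of_forall_compl_eq_zero
    intro s hs
    have : P.curve s ∉ tsupport F := fun h => by
      have := (hsupp h).1
      rw [P.inner_rot_curve] at this
      exact hs (_root_.abs_lt.1 this)
    rw [image_eq_zero_of_notMem_tsupport this, inner_zero_left]

end BoundaryPatch

/-! ### The divergence theorem on the surface -/

lemma continuous_planarDiv {F : E2 → E2} (hF : ContDiff ℝ 1 F) : Continuous (planarDiv F) := by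
  unfold planarDiv
  have := hF.continuous_fderiv (by norm_num)
  fun_prop

lemma integrable_planarDiv {F : E2 → E2} (hF : ContDiff ℝ 1 F) (hc : HasCompactSupport F) :
    Integrable (planarDiv F) :=
  (continuous_planarDiv hF).integrable_of_hasCompactSupport
    (hc.mono' fun _ hx => by_contra fun h => hx (planarDiv_eq_zero_of_notMem_tsupport h))

/-- The whole plane is treated as a subgraph: a horizontal line at height `R + 1` passes above the
support of `F`, so the boundary term is zero. -/
lemma integral_planarDiv_eq_zero {F : E2 → E2} (hF : ContDiff ℝ 1 F) (hc : HasCompactSupport F) :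
    ∫ y, planarDiv F y = 0 := by
  obtain ⟨R, hR0, hR⟩ := hc.isCompact.isBounded.exists_pos_norm_le
  let m : E2 := EuclideanSpace.single 0 1
  have hm : ‖m‖ = 1 := by simp [m]
  have h := integral_planarDiv_of_subgraph (T := univ) (x := 0) (f := fun _ => R + 1) (a := R) (b := R)
    isOpen_univ hm contDiff_const (fun s t _ ht => by
      simp only [mem_univ, true_iff]; linarith [(abs_le.1 ht).2]) hF hc fun y hy => by
        have h1 := abs_real_inner_le_norm (rot m) (y - 0)
        have h2 := abs_real_inner_le_norm m (y - 0)
        rw [norm_rot hm, one_mul] at h1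
        rw [hm, one_mul] at h2
        rw [sub_zero] at *
        exact ⟨h1.trans (hR y hy), h2.trans (hR y hy)⟩
  rw [setIntegral_univ] at h
  rw [h]
  apply integral_eq_zero_of_ae
  refine Eventually.of_forall fun s => ?_
  have : frame 0 m s (R + 1) ∉ tsupport F := fun hs => by
    have h2 := abs_real_inner_le_norm m (frame 0 m s (R + 1) - 0)
    rw [inner_frame_sub hm, hm, one_mul, sub_zero] at h2
    linarith [hR _ hs, le_abs_self (R + 1)]
  simp [image_eq_zero_of_notMem_tsupport this]

lemma setIntegral_planarDiv_eq_zero {T : Set E2} {F : E2 → E2} (hF : ContDiff ℝ 1 F)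
    (hc : HasCompactSupport F) (hs : tsupport F ⊆ T) : ∫ y in T, planarDiv F y = 0 := by
  rw [setIntegral_eq_integral_of_forall_compl_eq_zero, integral_planarDiv_eq_zero hF hc]
  exact fun y hy => planarDiv_eq_zero_of_notMem_tsupport fun h => hy (hs h)

/-- A field that is `C¹` near the closure of `T` is, there, a finite sum of `C¹` fields supported in
`T` or in a boundary patch. -/
lemma exists_decomposition {T U : Set E2} (hT : IsC1Domain T) (hU : IsOpen U) (hTU : closure T ⊆ U)
    {F : E2 → E2} (hF : ContDiffOn ℝ 1 F U) :
    ∃ (N : ℕ) (P : Fin N → BoundaryPatch T) (G : Option (Fin N) → E2 → E2),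
      (∀ i, ContDiff ℝ 1 (G i)) ∧ tsupport (G none) ⊆ T ∧ (∀ i, tsupport (G (some i)) ⊆ (P i).box) ∧
        ∀ x ∈ closure T, F x = ∑ i, G i x := by
  obtain ⟨N, P, hP⟩ := exists_finite_patches hT
  -- The index `none` stands for the interior piece. The boundary pieces are cut down to `U`, where
  -- `F` is `C¹`, so that every product `χ i • F` is `C¹` on the whole plane.
  let W : Option (Fin N) → Set E2 := fun i => i.elim T fun i => (P i).box ∩ U
  have hW : ∀ i, IsOpen (W i) := by
    rintro (_ | i)
    · exact hT.isOpen
    · exact (P i).isOpen_box.inter hU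
  have hcov : closure T ⊆ ⋃ i, W i := by
    intro x hx
    by_cases hxT : x ∈ T
    · exact mem_iUnion.2 ⟨none, hxT⟩
    · have : x ∈ frontier T := by rw [hT.isOpen.frontier_eq]; exact ⟨hx, hxT⟩
      obtain ⟨i, hi⟩ := mem_iUnion.1 (hP this)
      exact mem_iUnion.2 ⟨some i, hi, hTU hx⟩
  have hWU : ∀ i, W i ⊆ U := by
    rintro (_ | i)
    · exact subset_closure.trans hTU
    · exact inter_subset_right
  obtain ⟨χ, hχ⟩ := SmoothPartitionOfUnity.exists_isSubordinate (modelWithCornersSelf ℝ E2)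
    (isClosed_closure (s := T)) W hW hcov
  have hsupp : ∀ i, tsupport (fun x => χ i x • F x) ⊆ W i := fun i =>
    (tsupport_smul_subset_left (χ i) F).trans (hχ i)
  refine ⟨N, P, fun i x => χ i x • F x, fun i => contDiff_iff_contDiffAt.2 fun x => ?_, hsupp none,
    fun i => (hsupp (some i)).trans inter_subset_left, fun x hx => ?_⟩
  · by_cases hx : x ∈ tsupport fun x => χ i x • F x
    · exact ((χ i).contMDiff.contDiff.of_le (by norm_cast)).contDiffAt.smul
        (hF.contDiffAt (hU.mem_nhds (hWU i (hsupp i hx))))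
    · exact contDiffAt_const.congr_of_eventuallyEq (notMem_tsupport_iff_eventuallyEq.1 hx)
  · have := χ.sum_eq_one hx
    rw [finsum_eq_sum_of_fintype] at this
    rw [← Finset.sum_smul, this, one_smul]

/-- The divergence theorem on the surface. -/
theorem setIntegral_planarDiv {T U : Set E2} (hT : IsC1Domain T) {ψ ν n : E3 → E3}
    (hψ : IsFilmChart ψ T ν) (hn : ∀ x ∈ frontier T, IsOutwardConormal ψ T x (n (mid ψ x)))
    (hU : IsOpen U) (hTU : closure T ⊆ U) {F : E2 → E2} (hF : ContDiffOn ℝ 1 F U) :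
    IntegrableOn (fluxDensity ψ T n F) (surfaceBoundary ψ T) μH[1] ∧
      ∫ y in T, planarDiv F y = ∫ r in surfaceBoundary ψ T, fluxDensity ψ T n F r ∂μH[1] := by
  obtain ⟨N, P, G, hG, hG0, hG1, hsum⟩ := exists_decomposition hT hU hTU hF
  have hc : ∀ i, HasCompactSupport (G i) := by
    rintro (_ | i)
    · exact Metric.isCompact_of_isClosed_isBounded (isClosed_tsupport _) (hT.isBounded.subset hG0)
    · exact Metric.isCompact_of_isClosed_isBounded (isClosed_tsupport _)
        ((P i).isBounded_box.subset (hG1 i))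
  have hmeas := (hT.isCompact_surfaceBoundary hψ).measurableSet
  have hzero : ∀ r ∈ surfaceBoundary ψ T, fluxDensity ψ T n (G none) r = 0 := by
    rintro _ ⟨x, hx, rfl⟩
    have : G none x = 0 := image_eq_zero_of_notMem_tsupport fun h => by
      rw [hT.isOpen.frontier_eq] at hx; exact hx.2 (hG0 h)
    rw [fluxDensity, hψ.param_mid (frontier_subset_closure hx), this]
    simp
  have key : ∀ i, IntegrableOn (fluxDensity ψ T n (G i)) (surfaceBoundary ψ T) μH[1] ∧
      ∫ y in T, planarDiv (G i) y =
        ∫ r in surfaceBoundary ψ T, fluxDensity ψ T n (G i) r ∂μH[1] := by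
    rintro (_ | i)
    · refine ⟨(integrableOn_congr_fun hzero hmeas).2 integrableOn_zero, ?_⟩
      rw [setIntegral_planarDiv_eq_zero (hG none) (hc none) hG0, setIntegral_congr_fun hmeas hzero]
      simp
    · exact (P i).integral_planarDiv hT hψ hn (hG _) (hG1 i)
  have hflux : ∀ r ∈ surfaceBoundary ψ T,
      fluxDensity ψ T n F r = ∑ i, fluxDensity ψ T n (G i) r := by
    rintro _ ⟨x, hx, rfl⟩
    simp only [fluxDensity, hψ.param_mid (frontier_subset_closure hx),
      hsum x (frontier_subset_closure hx), map_sum, sum_inner, Finset.sum_div]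
  have hdiv : ∀ x ∈ T, planarDiv F x = ∑ i, planarDiv (G i) x := by
    intro x hx
    -- The decomposition holds only on `closure T`; openness of `T` turns it into an equality of
    -- germs, which is what derivatives need.
    have h1 : F =ᶠ[𝓝 x] fun y => ∑ i, G i y := by
      filter_upwards [hT.isOpen.mem_nhds hx] with y hy using hsum y (subset_closure hy)
    have h2 : fderiv ℝ F x = ∑ i, fderiv ℝ (G i) x := by
      rw [h1.fderiv_eq]
      exact fderiv_fun_sum fun i _ => (hG i).differentiable (by norm_num) x
    simp only [planarDiv, h2]
    rw [Finset.sum_comm]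
    simp
  refine ⟨(integrableOn_congr_fun hflux hmeas).2
    (integrable_finsetSum _ fun i _ => (key i).1), ?_⟩
  rw [setIntegral_congr_fun hT.isOpen.measurableSet hdiv, setIntegral_congr_fun hmeas hflux,
    integral_finsetSum _ fun i _ => (integrable_planarDiv (hG i) (hc i)).integrableOn,
    integral_finsetSum _ fun i _ => (key i).1]
  exact Finset.sum_congr rfl fun i _ => (key i).2

/-! ### Length of the boundary and area of its neighbourhoods -/

/-- The boundary is covered by finitely many `C¹` arcs, each of finite length by the area formula.
Finiteness is needed because Hausdorff measure on space is not a σ-finite measure to which Fubini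
would apply. -/
lemma IsC1Domain.hausdorffMeasure_surfaceBoundary_lt_top {T : Set E2} (hT : IsC1Domain T)
    {ψ ν : E3 → E3} (hψ : IsFilmChart ψ T ν) : μH[1] (surfaceBoundary ψ T) < ⊤ := by
  obtain ⟨N, P, hP⟩ := exists_finite_patches hT
  have hsub : surfaceBoundary ψ T ⊆
      ⋃ i, (fun s => mid ψ ((P i).curve s)) '' Icc (-(P i).a) (P i).a := by
    rintro _ ⟨x, hx, rfl⟩
    obtain ⟨i, hi⟩ := mem_iUnion.1 (hP hx)
    exact mem_iUnion.2 ⟨i, _, abs_le.1 hi.1.le,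
      by simp only [(P i).eq_curve_of_mem_frontier hT.isOpen hx hi]⟩
  refine (measure_mono hsub).trans_lt ((measure_iUnion_fintype_le _ _).trans_lt
    (ENNReal.sum_lt_top.2 fun i _ => ?_))
  have hγ := (P i).contDiff_mid_curve hψ
  rw [hausdorffMeasure_image_curve hγ ((P i).injOn_mid_curve hψ) measurableSet_Icc subset_rfl]
  have hcont := (hγ.continuous_deriv (by norm_num)).norm
  exact (hcont.integrableOn_Icc (a := -(P i).a) (b := (P i).a)).lintegral_lt_top

/-- The neighbourhood of width `r` of a curve has area `O(r)`. -/
lemma exists_volume_neighbourhood_curve_le {γ : ℝ → E2} (hγ : ContDiff ℝ 1 γ) {a : ℝ} (ha : 0 < a) :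
    ∃ C : ℝ, 0 ≤ C ∧ ∀ r : ℝ, 0 < r → r ≤ 1 →
      volume {y | ∃ s ∈ Icc (-a) a, dist y (γ s) ≤ r} ≤ ENNReal.ofReal (C * r) := by
  obtain ⟨K, hK⟩ := isCompact_Icc.exists_bound_of_continuousOn (s := Icc (-a) a)
    (hγ.continuous_deriv (by norm_num)).continuousOn
  have hK0 : 0 ≤ K := (norm_nonneg _).trans (hK 0 (by constructor <;> linarith))
  have hlip : ∀ s ∈ Icc (-a) a, ∀ t ∈ Icc (-a) a, dist (γ s) (γ t) ≤ K * |s - t| := by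
    intro s hs t ht
    rw [dist_eq_norm]
    exact (convex_Icc (-a) a).norm_image_sub_le_of_norm_deriv_le
      (fun x _ => hγ.differentiable (by norm_num) x) hK ht hs
  -- Nodes at parameter distance `r` give `m` discs of radius `(K + 1) r`: the curve moves by at
  -- most `K r` from a node, and `y` is another `r` away. The total area is at most `m r · (K + 1)²
  -- π · r`, and `m r ≤ 2 a + 1`.
  refine ⟨(2 * a + 1) * ((K + 1) ^ 2 * Real.pi), by positivity, fun r hr hr1 => ?_⟩
  let m : ℕ := ⌊2 * a / r⌋₊ + 1
  have hm : (m : ℝ) ≤ 2 * a / r + 1 := by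
    have := Nat.floor_le (show 0 ≤ 2 * a / r by positivity)
    simpa [m] using this
  let c : Fin m → E2 := fun i => γ (-a + (i : ℕ) * r)
  have hsub : {y | ∃ s ∈ Icc (-a) a, dist y (γ s) ≤ r} ⊆ ⋃ i, Metric.closedBall (c i) ((K + 1) * r) := by
    rintro y ⟨s, hs, hy⟩
    have h0 : 0 ≤ (s + a) / r := div_nonneg (by linarith [hs.1]) hr.le
    have h1 := Nat.floor_le h0
    have h2 := Nat.lt_floor_add_one ((s + a) / r)
    rw [le_div_iff₀ hr] at h1
    rw [div_lt_iff₀ hr] at h2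
    have hi : ⌊(s + a) / r⌋₊ < m :=
      Nat.lt_succ_of_le (Nat.floor_le_floor (by gcongr; linarith [hs.2]))
    refine mem_iUnion.2 ⟨⟨_, hi⟩, ?_⟩
    have h3 := hlip s hs (-a + (⌊(s + a) / r⌋₊ : ℝ) * r)
      ⟨by nlinarith [Nat.cast_nonneg (α := ℝ) ⌊(s + a) / r⌋₊], by linarith [hs.2]⟩
    have h4 : |s - (-a + (⌊(s + a) / r⌋₊ : ℝ) * r)| ≤ r := abs_le.2 ⟨by linarith, by linarith⟩
    have h5 := mul_le_mul_of_nonneg_left h4 hK0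
    have h6 := dist_triangle y (γ s) (γ (-a + (⌊(s + a) / r⌋₊ : ℝ) * r))
    rw [Metric.mem_closedBall]
    simp only [c]
    linarith
  refine (measure_mono hsub).trans ((measure_iUnion_fintype_le _ _).trans ?_)
  simp only [EuclideanSpace.volume_closedBall_fin_two, Finset.sum_const, Finset.card_univ,
    Fintype.card_fin, nsmul_eq_mul]
  rw [← ENNReal.ofReal_pow (by positivity), ← ENNReal.ofReal_mul (by positivity),
    ← ENNReal.ofReal_natCast, ← ENNReal.ofReal_mul (by positivity)]
  apply ENNReal.ofReal_le_ofReal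
  have h1 : (m : ℝ) * r ≤ 2 * a + 1 := by
    calc (m : ℝ) * r ≤ (2 * a / r + 1) * r := by gcongr
      _ = 2 * a + r := by field_simp
      _ ≤ 2 * a + 1 := by linarith
  calc (m : ℝ) * (((K + 1) * r) ^ 2 * Real.pi) = (m * r) * ((K + 1) ^ 2 * Real.pi) * r := by ring
    _ ≤ (2 * a + 1) * ((K + 1) ^ 2 * Real.pi) * r := by gcongr

/-- The neighbourhood of width `r` of the boundary of a `C¹` domain has area `O(r)`. -/
lemma IsC1Domain.exists_volume_neighbourhood_le {T : Set E2} (hT : IsC1Domain T) :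
    ∃ C : ℝ, 0 ≤ C ∧ ∀ r : ℝ, 0 < r → r ≤ 1 →
      volume {y | ∃ x ∈ frontier T, dist y x ≤ r} ≤ ENNReal.ofReal (C * r) := by
  obtain ⟨N, P, hP⟩ := exists_finite_patches hT
  choose C hC0 hC using fun i => exists_volume_neighbourhood_curve_le (P i).contDiff_curve (P i).a_pos
  refine ⟨∑ i, C i, Finset.sum_nonneg fun i _ => hC0 i, fun r hr hr1 => ?_⟩
  have hsub : {y | ∃ x ∈ frontier T, dist y x ≤ r} ⊆
      ⋃ i, {y | ∃ s ∈ Icc (-(P i).a) (P i).a, dist y ((P i).curve s) ≤ r} := by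
    rintro y ⟨x, hx, hxy⟩
    obtain ⟨i, hi⟩ := mem_iUnion.1 (hP hx)
    exact mem_iUnion.2 ⟨i, _, abs_le.1 hi.1.le,
      by rwa [(P i).eq_curve_of_mem_frontier hT.isOpen hx hi]⟩
  refine (measure_mono hsub).trans ((measure_iUnion_fintype_le _ _).trans ?_)
  rw [Finset.sum_mul, ENNReal.ofReal_sum_of_nonneg fun i _ => mul_nonneg (hC0 i) hr.le]
  exact Finset.sum_le_sum fun i _ => hC i r hr hr1

/-! ### Lattice cells -/

/-- The cell with index `n`. -/
def cell (e : Module.Basis (Fin 2) ℝ E2) (B : Set E2) (l : ℝ) (n : Fin 2 → ℤ) : Set E2 :=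
  {x | l⁻¹ • (x - corner e l n) ∈ B}

section Cells

variable {e : Module.Basis (Fin 2) ℝ E2} {B T : Set E2} {l : ℝ}

lemma corner_add_mem_cell_iff (hl : 0 < l) (n : Fin 2 → ℤ) (y : E2) :
    corner e l n + l • y ∈ cell e B l n ↔ y ∈ B := by
  simp [cell, hl.ne']

lemma exists_of_mem_cell (hl : 0 < l) {n : Fin 2 → ℤ} {x : E2} (hx : x ∈ cell e B l n) :
    ∃ y ∈ B, corner e l n + l • y = x :=
  ⟨_, hx, by rw [smul_inv_smul₀ hl.ne']; abel⟩

lemma measurableSet_cell (hB : MeasurableSet B) (l : ℝ) (n : Fin 2 → ℤ) :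
    MeasurableSet (cell e B l n) := by
  have : Measurable fun x : E2 => l⁻¹ • (x - corner e l n) := by fun_prop
  exact this hB

lemma setIntegral_cell {V : Type*} [NormedAddCommGroup V] [NormedSpace ℝ V] (hB : MeasurableSet B)
    (hl : 0 < l) (n : Fin 2 → ℤ) (g : E2 → V) :
    ∫ x in cell e B l n, g x = l ^ 2 • ∫ y in B, g (corner e l n + l • y) := by
  have h2 : ∀ y, (cell e B l n).indicator g (corner e l n + l • y) =
      B.indicator (fun y => g (corner e l n + l • y)) y := by
    intro y
    by_cases hy : y ∈ B
    · rw [indicator_of_mem hy, indicator_of_mem ((corner_add_mem_cell_iff hl n y).2 hy)]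
    · rw [indicator_of_notMem hy,
        indicator_of_notMem fun h => hy ((corner_add_mem_cell_iff hl n y).1 h)]
  have h1 := Measure.integral_comp_smul volume
    (fun x => (cell e B l n).indicator g (corner e l n + x)) l
  rw [integral_add_left_eq_self (μ := (volume : Measure E2)) ((cell e B l n).indicator g)
    (corner e l n)] at h1
  simp only [h2] at h1
  rw [← integral_indicator (measurableSet_cell hB l n), ← integral_indicator hB, h1, smul_smul]
  have : Module.finrank ℝ E2 = 2 := by simp
  rw [this, abs_of_pos (by positivity), mul_inv_cancel₀ (by positivity), one_smul]

lemma volume_cell (hB : IsUnitCell e B) (hl : 0 < l) (n : Fin 2 → ℤ) :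
    volume (cell e B l n) = ENNReal.ofReal (l ^ 2) := by
  have h1 : cell e B l n = (fun x => x - corner e l n) ⁻¹' ((fun x => l⁻¹ • x) ⁻¹' B) := rfl
  have : Module.finrank ℝ E2 = 2 := by simp
  rw [h1, (measurePreserving_sub_right volume (corner e l n)).measure_preimage
    ((measurable_const_smul l⁻¹) hB.measurableSet).nullMeasurableSet,
    Measure.addHaar_preimage_smul _ (inv_ne_zero hl.ne'), this, hB.area, mul_one,
    abs_of_pos (by positivity), inv_pow, inv_inv]

lemma existsUnique_mem_cell (hB : IsUnitCell e B) (hl : 0 < l) (x : E2) :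
    ∃! n, x ∈ cell e B l n := by
  have h : ∀ n, x ∈ cell e B l n ↔ l⁻¹ • x - latticePt e n ∈ B := fun n => by
    simp [cell, corner, smul_sub, hl.ne']
  simpa only [h] using hB.tiling (l⁻¹ • x)

lemma pairwise_disjoint_cell (hB : IsUnitCell e B) (hl : 0 < l) :
    Pairwise (Function.onFun Disjoint (cell e B l)) := fun _ _ hnm =>
  Set.disjoint_left.2 fun _ hn hm => hnm ((existsUnique_mem_cell hB hl _).unique hn hm)

lemma mem_fullCells_iff (hl : 0 < l) {n : Fin 2 → ℤ} : n ∈ fullCells e B T l ↔ cell e B l n ⊆ T := by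
  constructor
  · intro h x hx
    obtain ⟨y, hy, rfl⟩ := exists_of_mem_cell hl hx
    exact h y hy
  · exact fun h y hy => h ((corner_add_mem_cell_iff hl n y).2 hy)

lemma disjoint_fullCells_partialCells : Disjoint (fullCells e B T l) (partialCells e B T l) :=
  Set.disjoint_left.2 fun _ hn ⟨_, y, hy, hyT⟩ => hyT (hn y hy)

lemma mem_fullCells_or_partialCells {n : Fin 2 → ℤ} {y : E2} (hy : y ∈ B)
    (hyT : corner e l n + l • y ∈ T) : n ∈ fullCells e B T l ∪ partialCells e B T l := by
  by_cases h : n ∈ fullCells e B T l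
  · exact Or.inl h
  · simp only [fullCells, mem_ofPred_eq, not_forall, exists_prop] at h
    exact Or.inr ⟨⟨y, hy, hyT⟩, h⟩

/-- A counting argument: disjoint cells contained in a set of finite area. -/
lemma finite_and_ncard_mul_le (hB : IsUnitCell e B) (hl : 0 < l) {A : Set E2} {c : ℝ} (hc : 0 ≤ c)
    (hA : volume A ≤ ENNReal.ofReal c) {S : Set (Fin 2 → ℤ)} (hS : ∀ n ∈ S, cell e B l n ⊆ A) :
    S.Finite ∧ S.ncard * l ^ 2 ≤ c := by
  have key : ∀ t : Finset (Fin 2 → ℤ), ↑t ⊆ S → t.card * l ^ 2 ≤ c := by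
    intro t ht
    have h1 : volume (⋃ n ∈ t, cell e B l n) ≤ ENNReal.ofReal c :=
      (measure_mono (iUnion₂_subset fun n hn => hS n (ht hn))).trans hA
    rw [measure_biUnion_finset (fun _ _ _ _ h => pairwise_disjoint_cell hB hl h)
      fun n _ => measurableSet_cell hB.measurableSet l n] at h1
    simp only [volume_cell hB hl, Finset.sum_const, nsmul_eq_mul] at h1
    rw [← ENNReal.ofReal_natCast, ← ENNReal.ofReal_mul (by positivity),
      ENNReal.ofReal_le_ofReal_iff hc] at h1
    exact h1
  have hfin : S.Finite := by
    by_contra h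
    obtain ⟨t, ht, htc⟩ := Set.Infinite.exists_subset_card_eq h (⌊c / l ^ 2⌋₊ + 1)
    have h1 := key t ht
    rw [htc, ← le_div_iff₀ (by positivity)] at h1
    have h2 := Nat.lt_floor_add_one (c / l ^ 2)
    push_cast at h1
    linarith
  refine ⟨hfin, ?_⟩
  rw [Set.ncard_eq_toFinset_card S hfin]
  exact key _ (by simp)

lemma finite_fullCells (hB : IsUnitCell e B) (hT : Bornology.IsBounded T) (hl : 0 < l) :
    (fullCells e B T l).Finite ∧ (fullCells e B T l).ncard * l ^ 2 ≤ volume.real T :=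
  finite_and_ncard_mul_le hB hl measureReal_nonneg (A := T)
    (by rw [Measure.real, ENNReal.ofReal_toReal hT.measure_lt_top.ne])
    fun _ hn => (mem_fullCells_iff hl).1 hn

/-- The cell need not be connected, so connectedness is applied to the disc of radius `b l` about
its corner: the disc contains the cell, hence meets `T` and its complement, hence meets the
frontier. Every point of the cell is within the diameter `2 b l` of the point found there. -/
lemma cell_subset_of_mem_partialCells {b : ℝ} (hb : ∀ y ∈ B, ‖y‖ ≤ b) (hl : 0 < l) {n : Fin 2 → ℤ}
    (hn : n ∈ partialCells e B T l) :
    cell e B l n ⊆ {y | ∃ x ∈ frontier T, dist y x ≤ 2 * b * l} := by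
  obtain ⟨⟨p, hp, hpT⟩, ⟨q, hq, hqT⟩⟩ := hn
  let s : Set E2 := (fun y => corner e l n + l • y) '' Metric.closedBall 0 b
  have hs : IsPreconnected s :=
    (convex_closedBall (0 : E2) b).isPreconnected.image _ (by fun_prop)
  have hmem : ∀ {y}, y ∈ B → corner e l n + l • y ∈ s := fun hy =>
    ⟨_, mem_closedBall_zero_iff.2 (hb _ hy), rfl⟩
  obtain ⟨_, ⟨z, hz, rfl⟩, hzf⟩ : (s ∩ frontier T).Nonempty := by
    by_contra hne
    have h1 : s ⊆ interior T ∪ (closure T)ᶜ := by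
      intro x hx
      by_contra h
      rw [mem_union, not_or, mem_compl_iff, not_not] at h
      exact hne ⟨x, hx, h.2, h.1⟩
    have h2 := hs (interior T) (closure T)ᶜ isOpen_interior isClosed_closure.isOpen_compl h1
      ⟨_, hmem hp, (h1 (hmem hp)).resolve_right fun h => h (subset_closure hpT)⟩
      ⟨_, hmem hq, (h1 (hmem hq)).resolve_left fun h => hqT (interior_subset h)⟩
    obtain ⟨x, -, hx1, hx2⟩ := h2
    exact hx2 (subset_closure (interior_subset hx1))
  intro x hx
  obtain ⟨y, hy, rfl⟩ := exists_of_mem_cell hl hx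
  refine ⟨_, hzf, ?_⟩
  rw [dist_add_left, dist_smul₀, Real.norm_of_nonneg hl.le, dist_eq_norm]
  have h1 := norm_sub_le y z
  have h2 := hb y hy
  have h3 := mem_closedBall_zero_iff.1 hz
  nlinarith

/-- Disjoint cells of area `l²` in a strip of area `O(l)` number at most `O(1 / l)`. The threshold
`l₀` keeps the width `2 b l` of the strip at most one. -/
lemma exists_ncard_partialCells_le (hB : IsUnitCell e B) (hT : IsC1Domain T) :
    ∃ C l₀ : ℝ, 0 ≤ C ∧ 0 < l₀ ∧ ∀ l, 0 < l → l ≤ l₀ →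
      (partialCells e B T l).Finite ∧ (partialCells e B T l).ncard * l ≤ C := by
  obtain ⟨b, hb0, hb⟩ := hB.isBounded.exists_pos_norm_le
  obtain ⟨C, hC0, hC⟩ := hT.exists_volume_neighbourhood_le
  refine ⟨C * (2 * b), (2 * b)⁻¹, by positivity, by positivity, fun l hl hl0 => ?_⟩
  have h1 := hC (2 * b * l) (by positivity) (by
    rwa [mul_comm, ← le_div_iff₀ (by positivity), one_div])
  obtain ⟨h2, h3⟩ := finite_and_ncard_mul_le hB hl (by positivity) h1
    fun n hn => cell_subset_of_mem_partialCells hb hl hn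
  refine ⟨h2, ?_⟩
  have h4 : (((partialCells e B T l).ncard : ℝ) * l) * l ≤ (C * (2 * b)) * l := by
    calc _ = ((partialCells e B T l).ncard : ℝ) * l ^ 2 := by ring
      _ ≤ _ := h3.trans (le_of_eq (by ring))
  exact le_of_mul_le_mul_right h4 hl

/-- Decomposition of an integral over `T` into the contributions of the cells. -/
lemma integral_eq_sum_cells (hB : IsUnitCell e B) (hl : 0 < l) (hF : (fullCells e B T l).Finite)
    (hP : (partialCells e B T l).Finite) {W : E2 → ℝ} (hW : Integrable W) (hWT : ∀ x ∉ T, W x = 0) :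
    ∫ x, W x = (∑ᶠ n ∈ fullCells e B T l, l ^ 2 * ∫ y in B, W (corner e l n + l • y)) +
      ∑ᶠ n ∈ partialCells e B T l, l ^ 2 * ∫ y in B, W (corner e l n + l • y) := by
  have hfin := hF.union hP
  rw [← finsum_mem_union disjoint_fullCells_partialCells hF hP,
    finsum_mem_eq_finite_toFinset_sum _ hfin]
  have h1 : ∀ n, l ^ 2 * ∫ y in B, W (corner e l n + l • y) = ∫ x in cell e B l n, W x :=
    fun n => (setIntegral_cell hB.measurableSet hl n W).symm
  simp only [h1]
  rw [← integral_biUnion_finset _ (fun n _ => measurableSet_cell hB.measurableSet l n)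
    (fun _ _ _ _ h => pairwise_disjoint_cell hB hl h) fun n _ => hW.integrableOn]
  symm
  apply setIntegral_eq_integral_of_forall_compl_eq_zero
  intro x hx
  apply hWT
  intro hxT
  obtain ⟨n, hn, -⟩ := existsUnique_mem_cell hB hl x
  obtain ⟨y, hy, rfl⟩ := exists_of_mem_cell hl hn
  exact hx (mem_iUnion₂.2 ⟨n, by
    rw [Set.Finite.mem_toFinset]; exact mem_fullCells_or_partialCells hy hxT, hn⟩)

end Cells

lemma abs_finsum_mem_le {ι : Type*} {S : Set ι} (hS : S.Finite) {f : ι → ℝ} {c : ℝ}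
    (h : ∀ i ∈ S, |f i| ≤ c) : |∑ᶠ i ∈ S, f i| ≤ S.ncard * c := by
  rw [finsum_mem_eq_finite_toFinset_sum _ hS, Set.ncard_eq_toFinset_card S hS]
  refine (Finset.abs_sum_le_sum_abs _ _).trans ((Finset.sum_le_card_nsmul _ _ c fun i hi => ?_).trans
    (by rw [nsmul_eq_mul]))
  exact h i (by simpa using hi)

/-! ### Expansion of cell integrals -/

/-- The first-order Taylor expansion of a `C¹` function is uniform on balls. -/
lemma exists_taylor_bound {E : Type*} [NormedAddCommGroup E] [NormedSpace ℝ E] [ProperSpace E]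
    {V : E → ℝ} (hV : ContDiff ℝ 1 V) (R : ℝ) {ε : ℝ} (hε : 0 < ε) :
    ∃ δ > 0, ∀ p q : E, ‖p‖ ≤ R → ‖q‖ ≤ R → ‖q - p‖ < δ →
      |V q - V p - fderiv ℝ V p (q - p)| ≤ ε * ‖q - p‖ := by
  have huc := (isCompact_closedBall (0 : E) R).uniformContinuousOn_of_continuous
    (hV.continuous_fderiv (by norm_num)).continuousOn
  obtain ⟨δ, hδ, h⟩ := Metric.uniformContinuousOn_iff.1 huc ε hε
  refine ⟨δ, hδ, fun p q hp hq hpq => ?_⟩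
  have hp' : p ∈ Metric.closedBall (0 : E) R := mem_closedBall_zero_iff.2 hp
  have hconv : Convex ℝ (Metric.closedBall (0 : E) R ∩ Metric.ball p δ) :=
    (convex_closedBall _ _).inter (convex_ball _ _)
  exact hconv.norm_image_sub_le_of_norm_hasFDerivWithin_le' (f' := fderiv ℝ V)
    (fun x _ => (hV.differentiable (by norm_num) x).hasFDerivAt.hasFDerivWithinAt)
    (fun x hx => by
      rw [← dist_eq_norm]
      exact (h x hx.1 p hp' hx.2).le)
    ⟨hp', Metric.mem_ball_self hδ⟩
    ⟨mem_closedBall_zero_iff.2 hq, by rwa [mem_ball_iff_norm]⟩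

/-- The integral of a density on the slab over the vertical segment at `x`. -/
def verticalCharge (g : E2 × ℝ → ℝ) (x : E2) : ℝ := ∫ z in Ioo (-1 : ℝ) 1, g (x, z)

/-- The first vertical moment of a density on the slab. -/
def verticalMoment (g : E2 × ℝ → ℝ) (x : E2) : ℝ := ∫ z in Ioo (-1 : ℝ) 1, z * g (x, z)

/-- The integral of a density on the slab of thickness `h` against a function. -/
def verticalPairing (g V : E2 × ℝ → ℝ) (h : ℝ) (x : E2) : ℝ :=
  ∫ z in Ioo (-1 : ℝ) 1, g (x, z) * V (x, h * z)

/-! ### Vertical moments of densities on the slab. -/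

section Vertical

variable {g V : E2 × ℝ → ℝ} {K : ℝ}

lemma measurable_verticalIntegral {f : E2 × ℝ → ℝ} (hf : Measurable f) :
    Measurable fun x => ∫ z in Ioo (-1 : ℝ) 1, f (x, z) :=
  (StronglyMeasurable.integral_prod_right (f := fun x z => f (x, z))
    hf.stronglyMeasurable).measurable

lemma measurable_verticalCharge (hg : Measurable g) : Measurable (verticalCharge g) :=
  measurable_verticalIntegral hg

lemma measurable_verticalMoment (hg : Measurable g) : Measurable (verticalMoment g) :=
  measurable_verticalIntegral (measurable_snd.mul hg)

lemma measurable_verticalPairing (hg : Measurable g) (hV : Continuous V) (h : ℝ) :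
    Measurable (verticalPairing g V h) := by
  have : Continuous fun p : E2 × ℝ => V (p.1, h * p.2) := by fun_prop
  exact measurable_verticalIntegral (hg.mul this.measurable)

lemma abs_verticalIntegral_le {f : ℝ → ℝ} (hf : ∀ z ∈ Ioo (-1 : ℝ) 1, |f z| ≤ K) :
    |∫ z in Ioo (-1 : ℝ) 1, f z| ≤ 2 * K := by
  have := norm_setIntegral_le_of_norm_le_const (μ := volume) (s := Ioo (-1 : ℝ) 1)
    (f := f) (by simp) hf
  rw [Real.volume_real_Ioo_of_le (by norm_num)] at this
  rw [Real.norm_eq_abs] at this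
  linarith

lemma abs_verticalCharge_le (hK : ∀ p, |g p| ≤ K) (x : E2) : |verticalCharge g x| ≤ 2 * K :=
  abs_verticalIntegral_le fun _ _ => hK _

lemma abs_mul_le_of_mem (hK : ∀ p, |g p| ≤ K) {x : E2} {z : ℝ} (hz : z ∈ Ioo (-1 : ℝ) 1) :
    |z * g (x, z)| ≤ K := by
  rw [abs_mul]
  have h1 : |z| ≤ 1 := (_root_.abs_lt.2 hz).le
  calc |z| * |g (x, z)| ≤ 1 * K := by
        gcongr
        exact hK _
    _ = K := one_mul K

lemma abs_verticalMoment_le (hK : ∀ p, |g p| ≤ K) (x : E2) : |verticalMoment g x| ≤ 2 * K :=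
  abs_verticalIntegral_le fun _ hz => abs_mul_le_of_mem hK hz

lemma integrableOn_of_bounded {f : ℝ → ℝ} (hf : Measurable f)
    (hK : ∀ z ∈ Ioo (-1 : ℝ) 1, |f z| ≤ K) : IntegrableOn f (Ioo (-1 : ℝ) 1) :=
  Measure.integrableOn_of_bounded (by simp) hf.aestronglyMeasurable
    ((ae_restrict_iff' measurableSet_Ioo).2 (Eventually.of_forall hK))

/-- The factor `2` is the length of the vertical segment. The coefficients `c₀`, `c₁` are free, so
`c₀` may depend on `x` and absorb the in-plane part of the expansion. -/
lemma abs_verticalPairing_sub_le (hg : Measurable g) (hK : ∀ p, |g p| ≤ K) (hV : Continuous V)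
    {h c₀ c₁ ε : ℝ} {x : E2} (hε : ∀ z ∈ Ioo (-1 : ℝ) 1, |V (x, h * z) - c₀ - h * z * c₁| ≤ ε) :
    |verticalPairing g V h x - c₀ * verticalCharge g x - h * c₁ * verticalMoment g x| ≤
      2 * (K * ε) := by
  have hgx : Measurable fun z : ℝ => g (x, z) := by fun_prop
  have hK0 : 0 ≤ K := (abs_nonneg _).trans (hK 0)
  have i0 : IntegrableOn (fun z => g (x, z)) (Ioo (-1 : ℝ) 1) :=
    integrableOn_of_bounded hgx fun _ _ => hK _
  have i1 : IntegrableOn (fun z => z * g (x, z)) (Ioo (-1 : ℝ) 1) :=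
    integrableOn_of_bounded (measurable_id.mul hgx) fun _ hz => abs_mul_le_of_mem hK hz
  have hb : ∀ z ∈ Ioo (-1 : ℝ) 1, |g (x, z) * (V (x, h * z) - c₀ - h * z * c₁)| ≤ K * ε :=
    fun z hz => by
      rw [abs_mul]
      exact mul_le_mul (hK _) (hε z hz) (abs_nonneg _) hK0
  have i2 : IntegrableOn (fun z => g (x, z) * (V (x, h * z) - c₀ - h * z * c₁)) (Ioo (-1 : ℝ) 1) :=
    integrableOn_of_bounded (by fun_prop) hb
  have key : verticalPairing g V h x - c₀ * verticalCharge g x - h * c₁ * verticalMoment g x =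
      ∫ z in Ioo (-1 : ℝ) 1, g (x, z) * (V (x, h * z) - c₀ - h * z * c₁) := by
    have e1 : verticalPairing g V h x = ∫ z in Ioo (-1 : ℝ) 1,
        (g (x, z) * (V (x, h * z) - c₀ - h * z * c₁) + (c₀ * g (x, z) + h * c₁ * (z * g (x, z)))) :=
      integral_congr_ae (Eventually.of_forall fun z => by simp only; ring)
    have i3 : IntegrableOn (fun z => c₀ * g (x, z) + h * c₁ * (z * g (x, z))) (Ioo (-1 : ℝ) 1) :=
      (i0.const_mul _).add (i1.const_mul _)
    rw [e1, integral_add i2 i3,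
      integral_add (i0.const_mul _) (i1.const_mul _), integral_const_mul, integral_const_mul,
      verticalCharge, verticalMoment]
    ring
  rw [key]
  exact abs_verticalIntegral_le hb

end Vertical

/-! ### Integration of the expansion over one cell. -/

section CellIntegral

variable {g V : E2 × ℝ → ℝ} {K : ℝ} {e : Module.Basis (Fin 2) ℝ E2} {B : Set E2}

lemma IsUnitCell.integrableOn_of_bounded {X : Type*} [NormedAddCommGroup X] {f : E2 → X} {c : ℝ}
    (hB : IsUnitCell e B) (hf : AEStronglyMeasurable f volume) (hc : ∀ y ∈ B, ‖f y‖ ≤ c) : IntegrableOn f B :=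
  Measure.integrableOn_of_bounded (by simp [hB.area]) hf
    ((ae_restrict_iff' hB.measurableSet).2 (Eventually.of_forall hc))

lemma IsUnitCell.norm_setIntegral_le {X : Type*} [NormedAddCommGroup X] [NormedSpace ℝ X] {f : E2 → X}
    {c : ℝ} (hB : IsUnitCell e B) (hc : ∀ y ∈ B, ‖f y‖ ≤ c) : ‖∫ y in B, f y‖ ≤ c := by
  have := norm_setIntegral_le_of_norm_le_const (μ := volume) (s := B) (by simp [hB.area]) hc
  simpa [Measure.real, hB.area] using this

/-- First-order expansion of the integral over a full cell. -/
lemma abs_cell_sub_le (hB : IsUnitCell e B) (hg : Measurable g) (hK : ∀ p, |g p| ≤ K)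
    (hV : Continuous V) {l h ε : ℝ} {x : E2} {D : E2 × ℝ →L[ℝ] ℝ}
    (hε : ∀ y ∈ B, ∀ z ∈ Ioo (-1 : ℝ) 1,
      |V (x + l • y, h * z) - V (x, 0) - D (l • y, h * z)| ≤ ε) :
    |(∫ y in B, verticalPairing g V h (x + l • y)) -
      (V (x, 0) * (∫ y in B, verticalCharge g (x + l • y)) +
        l * D (∫ y in B, verticalCharge g (x + l • y) • y, 0) +
        h * (D (0, 1) * ∫ y in B, verticalMoment g (x + l • y)))| ≤ 2 * (K * ε) := by
  obtain ⟨b, hb0, hb⟩ := hB.isBounded.exists_pos_norm_le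
  have hK0 : 0 ≤ K := (abs_nonneg _).trans (hK 0)
  have hm : Measurable fun y : E2 => x + l • y := by fun_prop
  have m0 := (measurable_verticalCharge hg).comp hm
  have m1 := (measurable_verticalMoment hg).comp hm
  have i0 : IntegrableOn (fun y => verticalCharge g (x + l • y)) B :=
    hB.integrableOn_of_bounded m0.aestronglyMeasurable fun y _ => abs_verticalCharge_le hK _
  have i1 : IntegrableOn (fun y => verticalMoment g (x + l • y)) B :=
    hB.integrableOn_of_bounded m1.aestronglyMeasurable fun y _ => abs_verticalMoment_le hK _
  have i2 : IntegrableOn (fun y => verticalCharge g (x + l • y) • y) B := by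
    refine hB.integrableOn_of_bounded (c := 2 * K * b)
      (m0.smul measurable_id).aestronglyMeasurable fun y hy => ?_
    rw [norm_smul]
    exact mul_le_mul (abs_verticalCharge_le hK _) (hb y hy) (norm_nonneg _) (by positivity)
  -- The in-plane part of `D` produces the dipole moment and its vertical part the moment in `z`.
  -- The map `D` is arbitrary: the derivative of `V` for full cells, zero for partial ones.
  let D₁ : E2 →L[ℝ] ℝ := D ∘L ContinuousLinearMap.inl ℝ E2 ℝ
  have hD : ∀ y : E2, ∀ z : ℝ, D (l • y, h * z) = l * D₁ y + h * z * D (0, 1) := by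
    intro y z
    have : ((l • y, h * z) : E2 × ℝ) = l • (y, 0) + (h * z) • (0, 1) := by
      ext <;> simp
    rw [this, map_add, map_smul, map_smul]
    simp [D₁]
  have i3 : IntegrableOn (fun y => verticalCharge g (x + l • y) * D₁ y) B := by
    have := D₁.integrable_comp i2
    simpa using! this
  have e3 : D (∫ y in B, verticalCharge g (x + l • y) • y, 0) =
      ∫ y in B, verticalCharge g (x + l • y) * D₁ y := by
    have := D₁.integral_comp_comm i2
    simp only [map_smul, smul_eq_mul] at this
    rw [this]; rfl
  have hbound : ∀ y ∈ B, |verticalPairing g V h (x + l • y) -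
      (V (x, 0) + l * D₁ y) * verticalCharge g (x + l • y) -
        h * D (0, 1) * verticalMoment g (x + l • y)| ≤ 2 * (K * ε) := by
    intro y hy
    refine abs_verticalPairing_sub_le hg hK hV fun z hz => ?_
    have := hε y hy z hz
    rw [hD] at this
    rwa [sub_sub, add_assoc, ← sub_sub]
  have i4 : IntegrableOn (fun y => verticalPairing g V h (x + l • y) -
      (V (x, 0) + l * D₁ y) * verticalCharge g (x + l • y) -
        h * D (0, 1) * verticalMoment g (x + l • y)) B :=
    hB.integrableOn_of_bounded ((((measurable_verticalPairing hg hV h).comp hm).sub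
      ((measurable_const.add (D₁.measurable.const_mul l)).mul m0)).sub
        (m1.const_mul _)).aestronglyMeasurable hbound
  have i5 : IntegrableOn (fun y => V (x, 0) * verticalCharge g (x + l • y) +
      l * (verticalCharge g (x + l • y) * D₁ y)) B := (i0.const_mul _).add (i3.const_mul _)
  have i6 : IntegrableOn (fun y => V (x, 0) * verticalCharge g (x + l • y) +
      l * (verticalCharge g (x + l • y) * D₁ y) +
      h * D (0, 1) * verticalMoment g (x + l • y)) B := i5.add (i1.const_mul _)
  have key : (∫ y in B, verticalPairing g V h (x + l • y)) =
      (∫ y in B, (verticalPairing g V h (x + l • y) -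
        (V (x, 0) + l * D₁ y) * verticalCharge g (x + l • y) -
        h * D (0, 1) * verticalMoment g (x + l • y))) +
      (V (x, 0) * (∫ y in B, verticalCharge g (x + l • y)) +
        l * (∫ y in B, verticalCharge g (x + l • y) * D₁ y) +
        h * D (0, 1) * ∫ y in B, verticalMoment g (x + l • y)) := by
    rw [← integral_const_mul, ← integral_const_mul, ← integral_const_mul,
      ← integral_add (i0.const_mul _) (i3.const_mul _),
      ← integral_add i5 (i1.const_mul _),
      ← integral_add i4 i6]
    exact integral_congr_ae (Eventually.of_forall fun y => by simp only; ring)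
  rw [e3, key, ← mul_assoc, add_sub_cancel_right]
  exact hB.norm_setIntegral_le (f := fun y => verticalPairing g V h (x + l • y) -
    (V (x, 0) + l * D₁ y) * verticalCharge g (x + l • y) -
    h * D (0, 1) * verticalMoment g (x + l • y)) hbound

end CellIntegral

/-! ### Expansion of integrals over the slab -/

section Sums

variable (e : Module.Basis (Fin 2) ℝ E2) (B T : Set E2) (l : ℝ) (g V : E2 × ℝ → ℝ)

/-- The contribution of the total charges of the full cells. -/
def chargeSum : ℝ := ∑ᶠ n ∈ fullCells e B T l,
  l ^ 2 * (V (corner e l n, 0) * ∫ y in B, verticalCharge g (corner e l n + l • y))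

/-- The contribution of the in-plane dipole moments of the full cells. -/
def planeSum : ℝ := ∑ᶠ n ∈ fullCells e B T l,
  l ^ 2 * fderiv ℝ V (corner e l n, 0) (∫ y in B, verticalCharge g (corner e l n + l • y) • y, 0)

/-- The contribution of the vertical dipole moments of the full cells. -/
def normalSum : ℝ := ∑ᶠ n ∈ fullCells e B T l,
  l ^ 2 * (fderiv ℝ V (corner e l n, 0) (0, 1) *
    ∫ y in B, verticalMoment g (corner e l n + l • y))

/-- The contribution of the total charges of the partial cells. -/
def edgeSum : ℝ := ∑ᶠ n ∈ partialCells e B T l,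
  l * (V (corner e l n, 0) * ∫ y in B, verticalCharge g (corner e l n + l • y))

end Sums

section Expansion

variable {e : Module.Basis (Fin 2) ℝ E2} {B T : Set E2}

lemma IsUnitCell.nonempty (hB : IsUnitCell e B) : B.Nonempty := by
  by_contra h
  rw [not_nonempty_iff_eq_empty] at h
  have := hB.area
  simp [h] at this

lemma exists_corner_add_mem (hB : IsUnitCell e B) {l : ℝ} {n : Fin 2 → ℤ}
    (hn : n ∈ fullCells e B T l ∪ partialCells e B T l) : ∃ y ∈ B, corner e l n + l • y ∈ T := by
  rcases hn with hn | hn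
  · obtain ⟨y, hy⟩ := hB.nonempty
    exact ⟨y, hy, hn y hy⟩
  · exact hn.1

lemma norm_corner_le (hB : IsUnitCell e B) {l b R : ℝ} (hl : 0 < l) (hl1 : l ≤ 1)
    (hb : ∀ y ∈ B, ‖y‖ ≤ b) (hR : ∀ x ∈ T, ‖x‖ ≤ R) {n : Fin 2 → ℤ}
    (hn : n ∈ fullCells e B T l ∪ partialCells e B T l) : ‖corner e l n‖ ≤ R + b := by
  obtain ⟨y, hy, hyT⟩ := exists_corner_add_mem hB hn
  have h1 := norm_sub_le (corner e l n + l • y) (l • y)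
  rw [add_sub_cancel_right, norm_smul, Real.norm_of_nonneg hl.le] at h1
  have h2 := hR _ hyT
  have h3 : l * ‖y‖ ≤ 1 * b := mul_le_mul hl1 (hb y hy) (norm_nonneg _) zero_le_one
  linarith

lemma norm_slab_le {l h b : ℝ} (hl : 0 < l) (hh : 0 < h) {y : E2} (hb : ‖y‖ ≤ b)
    {z : ℝ} (hz : z ∈ Ioo (-1 : ℝ) 1) : ‖((l • y, h * z) : E2 × ℝ)‖ ≤ (b + 1) * (l + h) := by
  have h1 : |z| ≤ 1 := (_root_.abs_lt.2 hz).le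
  have hb0 : 0 ≤ b := (norm_nonneg _).trans hb
  rw [Prod.norm_mk, norm_smul, Real.norm_of_nonneg hl.le, norm_mul, Real.norm_of_nonneg hh.le,
    Real.norm_eq_abs]
  apply max_le
  · nlinarith [mul_le_mul_of_nonneg_left hb hl.le, mul_nonneg hb0 hh.le]
  · nlinarith [mul_le_mul_of_nonneg_left h1 hh.le, mul_nonneg hb0 hh.le, mul_nonneg hb0 hl.le]

/-- The first-order expansion of the integral of a bounded density over the slab. -/
theorem eventually_abs_integral_sub_le (hB : IsUnitCell e B) (hT : IsC1Domain T)
    {l h : ℕ → ℝ} (hl : ∀ k, 0 < l k) (hh : ∀ k, 0 < h k) (hl0 : Tendsto l atTop (𝓝 0))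
    (hh0 : Tendsto h atTop (𝓝 0)) {g : ℕ → E2 × ℝ → ℝ} {K : ℝ}
    (hg : ∀ᶠ k in atTop, Measurable (g k) ∧ (∀ p, |g k p| ≤ K) ∧ ∀ x ∉ T, ∀ z, g k (x, z) = 0)
    {V : E2 × ℝ → ℝ} (hV : ContDiff ℝ 1 V) {ε : ℝ} (hε : 0 < ε) :
    ∀ᶠ k in atTop, |(∫ x, verticalPairing (g k) V (h k) x) -
      (chargeSum e B T (l k) (g k) V + l k * planeSum e B T (l k) (g k) V +
        h k * normalSum e B T (l k) (g k) V + l k * edgeSum e B T (l k) (g k) V)| ≤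
      ε * (l k + h k) := by
  obtain ⟨b, hb0, hb⟩ := hB.isBounded.exists_pos_norm_le
  obtain ⟨R, hR0, hR⟩ := hT.isBounded.exists_pos_norm_le
  obtain ⟨C, l₀, hC0, hl₀, hC⟩ := exists_ncard_partialCells_le hB hT
  -- The corner of a cell may lie outside `T`, but within distance `b`; adding `l • y` costs another
  -- `b`, and heights are at most one. This ball contains all points of the expansion.
  obtain ⟨L, hL⟩ := (isCompact_closedBall (0 : E2 × ℝ) (R + 2 * b + 1)).exists_bound_of_continuousOn
    (hV.continuous_fderiv (by norm_num)).continuousOn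
  have hL0 : 0 ≤ L := (norm_nonneg _).trans (hL 0 (Metric.mem_closedBall_self (by positivity)))
  obtain ⟨k₀, hk₀⟩ := hg.exists
  have hK0 : 0 ≤ K := (abs_nonneg _).trans (hk₀.2.1 0)
  have hvT : 0 ≤ volume.real T := measureReal_nonneg
  -- Chosen so that the Taylor errors of all full cells together, at most `volume T · 2 K (b + 1) ε₁
  -- (l + h)`, stay below half of the tolerance; the summand `1` avoids division by zero.
  let ε₁ : ℝ := ε / 2 / (volume.real T * (2 * K * (b + 1)) + 1)
  have hε₁ : 0 < ε₁ := by positivity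
  have hε₁' : volume.real T * (2 * K * (b + 1)) * ε₁ ≤ ε / 2 := by
    have : (volume.real T * (2 * K * (b + 1)) + 1) * ε₁ = ε / 2 := by
      simp only [ε₁]; field_simp
    nlinarith
  obtain ⟨δ₁, hδ₁, htay₁⟩ := exists_taylor_bound hV (R + 2 * b + 1) hε₁
  obtain ⟨δ₂, hδ₂, htay₂⟩ := exists_taylor_bound hV (R + 2 * b + 1) one_pos
  -- The errors of the partial cells add up to at most `l C₂ (l + h)`: they gain the factor `l` from
  -- `l²` times a number `O(1 / l)` of cells.
  let C₂ : ℝ := C * (2 * K * ((L + 1) * (b + 1)))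
  have hlh : Tendsto (fun k => (b + 1) * (l k + h k)) atTop (𝓝 0) := by
    simpa using (hl0.add hh0).const_mul (b + 1)
  have hlC : Tendsto (fun k => l k * C₂) atTop (𝓝 0) := by
    simpa using hl0.mul_const C₂
  filter_upwards [hg, hl0.eventually_le_const hl₀, hl0.eventually_le_const one_pos,
    hh0.eventually_le_const one_pos, hlh.eventually_lt_const hδ₁, hlh.eventually_lt_const hδ₂,
    hlC.eventually_le_const (half_pos hε)] with k ⟨hgm, hgK, hgT⟩ hk1 hk2 hk3 hk4 hk5 hk6
  have hl := hl k
  have hh := hh k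
  generalize l k = l at *
  generalize h k = h at *
  generalize g k = g at *
  obtain ⟨hFf, hFc⟩ := finite_fullCells hB hT.isBounded hl
  obtain ⟨hPf, hPc⟩ := hC l hl hk1
  have hWm := measurable_verticalPairing hgm hV.continuous h
  have hWT : ∀ x ∉ T, verticalPairing g V h x = 0 := fun x hx => by
    simp [verticalPairing, hgT x hx]
  obtain ⟨Vb, hVb⟩ := (isCompact_closedBall (0 : E2 × ℝ) (R + 2 * b + 1)).exists_bound_of_continuousOn
    hV.continuous.continuousOn
  have hmemR : ∀ x : E2, ‖x‖ ≤ R + 2 * b → ∀ z ∈ Ioo (-1 : ℝ) 1, ‖((x, h * z) : E2 × ℝ)‖ ≤ R + 2 * b + 1 := by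
    intro x hx z hz
    rw [Prod.norm_mk]
    refine max_le (by linarith) ?_
    rw [norm_mul, Real.norm_of_nonneg hh.le, Real.norm_eq_abs]
    have := (_root_.abs_lt.2 hz).le
    nlinarith [mul_le_mul hk3 this (abs_nonneg _) zero_le_one]
  have hWi : Integrable (verticalPairing g V h) := by
    have h1 : IntegrableOn (verticalPairing g V h) T := by
      refine Measure.integrableOn_of_bounded (M := 2 * (K * Vb)) hT.isBounded.measure_lt_top.ne
        hWm.aestronglyMeasurable ((ae_restrict_iff' hT.isOpen.measurableSet).2
          (Eventually.of_forall fun x hx => abs_verticalIntegral_le fun z hz => ?_))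
      rw [abs_mul]
      exact mul_le_mul (hgK _) (hVb _ (mem_closedBall_zero_iff.2
        (hmemR x ((hR x hx).trans (by linarith)) z hz))) (abs_nonneg _) hK0
    rwa [integrableOn_iff_integrable_of_support_subset] at h1
    exact fun x hx => by_contra fun h => hx (hWT x h)
  have hcorner : ∀ n ∈ fullCells e B T l ∪ partialCells e B T l, ∀ y ∈ B, ∀ z ∈ Ioo (-1 : ℝ) 1,
      ‖((corner e l n, 0) : E2 × ℝ)‖ ≤ R + 2 * b + 1 ∧
      ‖((corner e l n + l • y, h * z) : E2 × ℝ)‖ ≤ R + 2 * b + 1 ∧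
      ((corner e l n + l • y, h * z) - (corner e l n, 0) : E2 × ℝ) = (l • y, h * z) := by
    intro n hn y hy z hz
    have h1 := norm_corner_le hB hl hk2 hb hR hn
    refine ⟨?_, hmemR _ ?_ z hz, by simp⟩
    · rw [Prod.norm_mk, norm_zero]
      exact max_le (by linarith) (by positivity)
    · refine (norm_add_le _ _).trans ?_
      rw [norm_smul, Real.norm_of_nonneg hl.le]
      have h3 : l * ‖y‖ ≤ 1 * b := mul_le_mul hk2 (hb y hy) (norm_nonneg _) zero_le_one
      linarith
  have hfull : ∀ n ∈ fullCells e B T l,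
      |l ^ 2 * (∫ y in B, verticalPairing g V h (corner e l n + l • y)) -
        l ^ 2 * (V (corner e l n, 0) * (∫ y in B, verticalCharge g (corner e l n + l • y)) +
          l * fderiv ℝ V (corner e l n, 0) (∫ y in B, verticalCharge g (corner e l n + l • y) • y, 0) +
          h * (fderiv ℝ V (corner e l n, 0) (0, 1) *
            ∫ y in B, verticalMoment g (corner e l n + l • y)))| ≤
        l ^ 2 * (2 * (K * (ε₁ * ((b + 1) * (l + h))))) := by
    intro n hn
    rw [← mul_sub, abs_mul, abs_of_nonneg (sq_nonneg l)]
    refine mul_le_mul_of_nonneg_left (abs_cell_sub_le hB hgm hgK hV.continuous fun y hy z hz => ?_)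
      (sq_nonneg l)
    obtain ⟨h1, h2, h3⟩ := hcorner n (Or.inl hn) y hy z hz
    have h4 := norm_slab_le hl hh (hb y hy) hz
    have h5 := htay₁ _ _ h1 h2 (by rw [h3]; exact h4.trans_lt hk4)
    rw [h3] at h5
    exact h5.trans (mul_le_mul_of_nonneg_left h4 hε₁.le)
  have hpart : ∀ n ∈ partialCells e B T l,
      |l ^ 2 * (∫ y in B, verticalPairing g V h (corner e l n + l • y)) -
        l ^ 2 * (V (corner e l n, 0) * (∫ y in B, verticalCharge g (corner e l n + l • y)))| ≤
        l ^ 2 * (2 * (K * ((L + 1) * ((b + 1) * (l + h))))) := by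
    intro n hn
    rw [← mul_sub, abs_mul, abs_of_nonneg (sq_nonneg l)]
    -- Expansion to order zero. The Lipschitz constant `L + 1` comes from the bound `L` of the
    -- derivative and a Taylor remainder with constant one.
    have := abs_cell_sub_le (l := l) (h := h) (x := corner e l n) (D := 0)
      (ε := (L + 1) * ((b + 1) * (l + h))) hB hgm hgK hV.continuous fun y hy z hz => by
        obtain ⟨h1, h2, h3⟩ := hcorner n (Or.inr hn) y hy z hz
        have h4 := norm_slab_le hl hh (hb y hy) hz
        have h5 := htay₂ _ _ h1 h2 (by rw [h3]; exact h4.trans_lt hk5)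
        rw [h3, one_mul] at h5
        have h6 := (fderiv ℝ V (corner e l n, 0)).le_of_opNorm_le (hL _ (mem_closedBall_zero_iff.2 h1))
          (l • y, h * z)
        rw [Real.norm_eq_abs] at h6
        have h7 := abs_add_le (V (corner e l n + l • y, h * z) - V (corner e l n, 0) -
          fderiv ℝ V (corner e l n, 0) (l • y, h * z)) (fderiv ℝ V (corner e l n, 0) (l • y, h * z))
        rw [sub_add_cancel] at h7
        rw [zero_apply, sub_zero]
        nlinarith
    refine mul_le_mul_of_nonneg_left ?_ (sq_nonneg l)
    simpa using this
  have e1 : chargeSum e B T l g V + l * planeSum e B T l g V + h * normalSum e B T l g V =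
      ∑ᶠ n ∈ fullCells e B T l,
        l ^ 2 * (V (corner e l n, 0) * (∫ y in B, verticalCharge g (corner e l n + l • y)) +
          l * fderiv ℝ V (corner e l n, 0) (∫ y in B, verticalCharge g (corner e l n + l • y) • y, 0) +
          h * (fderiv ℝ V (corner e l n, 0) (0, 1) *
            ∫ y in B, verticalMoment g (corner e l n + l • y))) := by
    rw [chargeSum, planeSum, normalSum, mul_finsum_mem, mul_finsum_mem,
      ← finsum_mem_add_distrib hFf, ← finsum_mem_add_distrib hFf]
    exact finsum_mem_congr rfl fun n _ => by ring
  have e2 : l * edgeSum e B T l g V = ∑ᶠ n ∈ partialCells e B T l,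
        l ^ 2 * (V (corner e l n, 0) * (∫ y in B, verticalCharge g (corner e l n + l • y))) := by
    rw [edgeSum, mul_finsum_mem]
    exact finsum_mem_congr rfl fun n _ => by ring
  rw [e1, e2, integral_eq_sum_cells hB hl hFf hPf hWi hWT, add_sub_add_comm,
    ← finsum_mem_sub_distrib _ _ hFf, ← finsum_mem_sub_distrib _ _ hPf]
  refine (abs_add_le _ _).trans ((add_le_add (abs_finsum_mem_le hFf hfull)
    (abs_finsum_mem_le hPf hpart)).trans ?_)
  have hlh0 : 0 ≤ l + h := by positivity
  have f1 : ((fullCells e B T l).ncard : ℝ) * (l ^ 2 * (2 * (K * (ε₁ * ((b + 1) * (l + h)))))) ≤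
      ε / 2 * (l + h) := by
    calc _ = ((fullCells e B T l).ncard * l ^ 2) * (2 * K * (b + 1) * ε₁ * (l + h)) := by ring
      _ ≤ volume.real T * (2 * K * (b + 1) * ε₁ * (l + h)) := by gcongr
      _ = volume.real T * (2 * K * (b + 1)) * ε₁ * (l + h) := by ring
      _ ≤ _ := by gcongr
  have f2 : ((partialCells e B T l).ncard : ℝ) *
      (l ^ 2 * (2 * (K * ((L + 1) * ((b + 1) * (l + h)))))) ≤ ε / 2 * (l + h) := by
    calc _ = ((partialCells e B T l).ncard * l) *
          (l * (2 * K * ((L + 1) * (b + 1))) * (l + h)) := by ring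
      _ ≤ C * (l * (2 * K * ((L + 1) * (b + 1))) * (l + h)) := by gcongr
      _ = l * C₂ * (l + h) := by simp only [C₂]; ring
      _ ≤ _ := by gcongr
  linarith

/-- The sums in the expansion are bounded. -/
theorem exists_bound_sums (hB : IsUnitCell e B) (hT : IsC1Domain T)
    {l : ℕ → ℝ} (hl : ∀ k, 0 < l k) (hl0 : Tendsto l atTop (𝓝 0))
    {g : ℕ → E2 × ℝ → ℝ} {K : ℝ} (hg : ∀ᶠ k in atTop, ∀ p, |g k p| ≤ K)
    {V : E2 × ℝ → ℝ} (hV : ContDiff ℝ 1 V) :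
    ∃ C : ℝ, ∀ᶠ k in atTop, |planeSum e B T (l k) (g k) V| ≤ C ∧
      |normalSum e B T (l k) (g k) V| ≤ C ∧ |edgeSum e B T (l k) (g k) V| ≤ C := by
  obtain ⟨b, hb0, hb⟩ := hB.isBounded.exists_pos_norm_le
  obtain ⟨R, hR0, hR⟩ := hT.isBounded.exists_pos_norm_le
  obtain ⟨C, l₀, hC0, hl₀, hC⟩ := exists_ncard_partialCells_le hB hT
  obtain ⟨L, hL⟩ := (isCompact_closedBall (0 : E2 × ℝ) (R + b)).exists_bound_of_continuousOn
    (hV.continuous_fderiv (by norm_num)).continuousOn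
  obtain ⟨L', hL'⟩ := (isCompact_closedBall (0 : E2 × ℝ) (R + b)).exists_bound_of_continuousOn
    hV.continuous.continuousOn
  have h0 : (0 : E2 × ℝ) ∈ Metric.closedBall (0 : E2 × ℝ) (R + b) :=
    Metric.mem_closedBall_self (by positivity)
  have hL0 : 0 ≤ L := (norm_nonneg _).trans (hL 0 h0)
  have hL0' : 0 ≤ L' := (norm_nonneg _).trans (hL' 0 h0)
  obtain ⟨k₀, hk₀⟩ := hg.exists
  have hK0 : 0 ≤ K := (abs_nonneg _).trans (hk₀ 0)
  let C₁ := volume.real T * (L * (2 * K * b))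
  let C₂ := volume.real T * (L * (2 * K))
  let C₃ := C * (L' * (2 * K))
  refine ⟨max C₁ (max C₂ C₃), ?_⟩
  filter_upwards [hg, hl0.eventually_le_const hl₀, hl0.eventually_le_const one_pos] with k hgK hk1 hk2
  have hl := hl k
  generalize l k = l at *
  generalize g k = g at *
  obtain ⟨hFf, hFc⟩ := finite_fullCells hB hT.isBounded hl
  obtain ⟨hPf, hPc⟩ := hC l hl hk1
  have hcorner : ∀ n ∈ fullCells e B T l ∪ partialCells e B T l,
      ((corner e l n, 0) : E2 × ℝ) ∈ Metric.closedBall (0 : E2 × ℝ) (R + b) := by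
    intro n hn
    rw [mem_closedBall_zero_iff, Prod.norm_mk, norm_zero]
    exact max_le (norm_corner_le hB hl hk2 hb hR hn) (by positivity)
  have hcharge : ∀ x : E2, |∫ y in B, verticalCharge g (x + l • y)| ≤ 2 * K := fun x =>
    hB.norm_setIntegral_le (f := fun y => verticalCharge g (x + l • y))
      fun y _ => abs_verticalCharge_le hgK _
  have hmoment : ∀ x : E2, |∫ y in B, verticalMoment g (x + l • y)| ≤ 2 * K := fun x =>
    hB.norm_setIntegral_le (f := fun y => verticalMoment g (x + l • y))
      fun y _ => abs_verticalMoment_le hgK _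
  have hplane : ∀ x : E2, ‖∫ y in B, verticalCharge g (x + l • y) • y‖ ≤ 2 * K * b := fun x =>
    hB.norm_setIntegral_le fun y hy => by
      rw [norm_smul]
      exact mul_le_mul (abs_verticalCharge_le hgK _) (hb y hy) (norm_nonneg _) (by positivity)
  refine ⟨le_max_of_le_left ?_, le_max_of_le_right (le_max_of_le_left ?_),
    le_max_of_le_right (le_max_of_le_right ?_)⟩
  · refine (abs_finsum_mem_le hFf (c := l ^ 2 * (L * (2 * K * b))) fun n hn => ?_).trans ?_
    · rw [abs_mul, abs_of_nonneg (sq_nonneg l)]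
      refine mul_le_mul_of_nonneg_left ?_ (sq_nonneg l)
      refine ((fderiv ℝ V (corner e l n, 0)).le_of_opNorm_le (hL _ (hcorner n (Or.inl hn))) _).trans ?_
      refine mul_le_mul_of_nonneg_left ?_ hL0
      rw [Prod.norm_mk, norm_zero]
      exact max_le (hplane _) (by positivity)
    · rw [← mul_assoc]
      exact mul_le_mul_of_nonneg_right hFc (by positivity)
  · refine (abs_finsum_mem_le hFf (c := l ^ 2 * (L * (2 * K))) fun n hn => ?_).trans ?_
    · rw [abs_mul, abs_of_nonneg (sq_nonneg l), abs_mul]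
      refine mul_le_mul_of_nonneg_left (mul_le_mul ?_ (hmoment _) (abs_nonneg _) hL0) (sq_nonneg l)
      refine ((fderiv ℝ V (corner e l n, 0)).le_of_opNorm_le (hL _ (hcorner n (Or.inl hn))) _).trans ?_
      simp [Prod.norm_mk]
    · rw [← mul_assoc]
      exact mul_le_mul_of_nonneg_right hFc (by positivity)
  · refine (abs_finsum_mem_le hPf (c := l * (L' * (2 * K))) fun n hn => ?_).trans ?_
    · rw [abs_mul, abs_of_nonneg hl.le, abs_mul]
      exact mul_le_mul_of_nonneg_left (mul_le_mul (hL' _ (hcorner n (Or.inr hn))) (hcharge _)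
        (abs_nonneg _) hL0') hl.le
    · rw [← mul_assoc]
      exact mul_le_mul_of_nonneg_right hPc (by positivity)

end Expansion

/-! ### The density on the rescaled slab -/

/-- The charge density of the film, times the volume Jacobian, on the slab rescaled to thickness one
and extended by zero. -/
def slabDensity (ψ : E3 → E3) (T : Set E2) (ρ : E3 → ℝ) (h : ℝ) : E2 × ℝ → ℝ :=
  (T ×ˢ Ioo (-1 : ℝ) 1).indicator fun p => ρ (ψ (pt p.1 (h * p.2))) * J ψ (pt p.1 (h * p.2))

lemma continuous_J {ψ : E3 → E3} (hψ : ContDiff ℝ 1 ψ) : Continuous (J ψ) :=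
  (ContinuousLinearMap.continuous_det.comp (hψ.continuous_fderiv (by norm_num))).abs

lemma IsFilmChart.continuous_J0 {ψ ν : E3 → E3} {T : Set E2} (hψ : IsFilmChart ψ T ν) :
    Continuous (J0 ψ) := by
  have h1 : Continuous (D0 ψ) := hψ.contDiff_mid.continuous_fderiv (by norm_num)
  have h2 : Continuous fun x => ContinuousLinearMap.adjoint (D0 ψ x) :=
    (ContinuousLinearMap.adjoint (𝕜 := ℝ) (E := E2) (F := E3)).continuous.comp h1
  exact (ContinuousLinearMap.continuous_det.comp (h2.clm_comp h1)).sqrt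

lemma continuous_pt_mul (h : ℝ) : Continuous fun p : E2 × ℝ => pt p.1 (h * p.2) :=
  (contDiff_pt (n := 0)).continuous.comp (continuous_fst.prodMk (continuous_const.mul continuous_snd))

lemma mul_mem_Ioo {h z : ℝ} (hh : 0 < h) (hz : z ∈ Ioo (-1 : ℝ) 1) : h * z ∈ Ioo (-h) h :=
  ⟨by nlinarith [hz.1], by nlinarith [hz.2]⟩

lemma mem_film {ψ : E3 → E3} {T : Set E2} {h : ℝ} (hh : 0 < h) {x : E2} (hx : x ∈ T) {z : ℝ}
    (hz : z ∈ Ioo (-1 : ℝ) 1) : ψ (pt x (h * z)) ∈ film ψ T h :=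
  ⟨x, hx, h * z, mul_mem_Ioo hh hz, rfl⟩

section SlabDensity

variable {ψ : E3 → E3} {T : Set E2} {ρ : E3 → ℝ} {h : ℝ}

lemma slabDensity_of_mem {x : E2} (hx : x ∈ T) {z : ℝ} (hz : z ∈ Ioo (-1 : ℝ) 1) :
    slabDensity ψ T ρ h (x, z) = ρ (ψ (pt x (h * z))) * J ψ (pt x (h * z)) := by
  rw [slabDensity, indicator_of_mem (show (x, z) ∈ T ×ˢ Ioo (-1 : ℝ) 1 from ⟨hx, hz⟩)]

lemma slabDensity_of_notMem {x : E2} (hx : x ∉ T) (z : ℝ) : slabDensity ψ T ρ h (x, z) = 0 :=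
  indicator_of_notMem (fun h => hx h.1) _

lemma measurable_slabDensity (hT : IsOpen T) (hψ : ContDiff ℝ 1 ψ) (hh : 0 < h)
    (hρ : ContinuousOn ρ (film ψ T h)) : Measurable (slabDensity ψ T ρ h) := by
  classical
  rw [slabDensity, ← piecewise_eq_indicator]
  refine ContinuousOn.measurable_piecewise ?_ continuousOn_const
    (hT.prod isOpen_Ioo).measurableSet
  have h1 := hψ.continuous.comp (continuous_pt_mul h)
  refine ContinuousOn.mul (hρ.comp h1.continuousOn fun p hp => mem_film hh hp.1 hp.2) ?_
  exact ((continuous_J hψ).comp (continuous_pt_mul h)).continuousOn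

lemma exists_bound_slab (hT : Bornology.IsBounded T) {f : E3 → ℝ} (hf : Continuous f) :
    ∃ C, 0 ≤ C ∧ ∀ x ∈ T, ∀ t ∈ Icc (-1 : ℝ) 1, |f (pt x t)| ≤ C := by
  have hc : IsCompact (closure T ×ˢ Icc (-1 : ℝ) 1) := hT.isCompact_closure.prod isCompact_Icc
  obtain ⟨C, hC⟩ := hc.exists_bound_of_continuousOn
    (f := fun p : E2 × ℝ => f (pt p.1 p.2)) (hf.comp (contDiff_pt (n := 0)).continuous).continuousOn
  refine ⟨max C 0, le_max_right _ _, fun x hx t ht => ?_⟩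
  exact (hC (x, t) ⟨subset_closure hx, ht⟩).trans (le_max_left _ _)

lemma exists_bound_slabDensity (hT : Bornology.IsBounded T) (hψ : ContDiff ℝ 1 ψ) (M : ℝ) :
    ∃ K, ∀ (h : ℝ) (ρ : E3 → ℝ), 0 < h → h ≤ 1 → (∀ r ∈ film ψ T h, |ρ r| ≤ M) →
      ∀ p, |slabDensity ψ T ρ h p| ≤ K := by
  obtain ⟨C, hC0, hC⟩ := exists_bound_slab hT (continuous_J hψ)
  -- If `T` is empty, nothing forces `M` to be nonnegative; hence the absolute value.
  refine ⟨|M| * C, fun h ρ hh hh1 hM ⟨x, z⟩ => ?_⟩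
  by_cases hp : (x, z) ∈ T ×ˢ Ioo (-1 : ℝ) 1
  · rw [slabDensity_of_mem hp.1 hp.2, abs_mul]
    have h2 := mul_mem_Ioo hh hp.2
    exact mul_le_mul ((hM _ (mem_film hh hp.1 hp.2)).trans (le_abs_self M))
      (hC x hp.1 _ ⟨by linarith [h2.1], by linarith [h2.2]⟩) (abs_nonneg _) (abs_nonneg _)
  · rw [slabDensity, indicator_of_notMem hp, abs_zero]
    positivity

/-! ### Change of variables -/

/-- The splitting of `Fin 3` at its last index puts the vertical coordinate first, hence the swap of
the factors. -/
lemma measurePreserving_pt : MeasurePreserving (fun p : E2 × ℝ => pt p.1 p.2) := by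
  have h1 : MeasurePreserving (fun p : E2 × ℝ => (p.2, WithLp.ofLp p.1)) :=
    ((MeasurePreserving.id volume).prod (PiLp.volume_preserving_ofLp (Fin 2))).comp
      Measure.measurePreserving_swap
  have h2 := (volume_preserving_piFinSuccAbove (fun _ : Fin 3 => ℝ) (Fin.last 2)).symm
  have h3 := (PiLp.volume_preserving_toLp (Fin 3)).comp (h2.comp h1)
  convert h3 using 1
  ext p i
  fin_cases i <;> rfl

lemma injective_pt : Function.Injective fun p : E2 × ℝ => pt p.1 p.2 := by
  rintro ⟨x, t⟩ ⟨y, s⟩ hxy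
  have h0 := congrArg (fun v : E3 => v 0) hxy
  have h1 := congrArg (fun v : E3 => v 1) hxy
  have h2 := congrArg (fun v : E3 => v 2) hxy
  simp [pt] at h0 h1 h2
  ext i
  · fin_cases i
    · exact h0
    · exact h1
  · exact h2

lemma measurableEmbedding_pt : MeasurableEmbedding fun p : E2 × ℝ => pt p.1 p.2 :=
  (contDiff_pt (n := 0)).continuous.measurableEmbedding injective_pt

lemma film_eq_image : film ψ T h = ψ '' ((fun p : E2 × ℝ => pt p.1 p.2) '' (T ×ˢ Ioo (-h) h)) := by
  rw [image_image, film]; exact (image_prod _).symm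

lemma measurableSet_pt_image (hT : IsOpen T) :
    MeasurableSet ((fun p : E2 × ℝ => pt p.1 p.2) '' (T ×ˢ Ioo (-h) h)) :=
  measurableEmbedding_pt.measurableSet_image' (hT.prod isOpen_Ioo).measurableSet

end SlabDensity

lemma setIntegral_film {ψ ν : E3 → E3} {T : Set E2} (hT : IsOpen T) (hψ : IsFilmChart ψ T ν) {h : ℝ}
    (hinj : InjOn (fun z : E2 × ℝ => ψ (pt z.1 z.2)) (T ×ˢ Ioo (-h) h)) (f : E3 → ℝ) :
    ∫ r in film ψ T h, f r =
      ∫ p in T ×ˢ Ioo (-h) h, J ψ (pt p.1 p.2) * f (ψ (pt p.1 p.2)) := by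
  have hinj' : InjOn ψ ((fun p : E2 × ℝ => pt p.1 p.2) '' (T ×ˢ Ioo (-h) h)) := by
    rintro _ ⟨p, hp, rfl⟩ _ ⟨q, hq, rfl⟩ hpq
    rw [hinj hp hq hpq]
  rw [film_eq_image, integral_image_eq_integral_abs_det_fderiv_smul volume (measurableSet_pt_image hT)
    (fun x _ => (hψ.contDiff.differentiable (by norm_num) x).hasFDerivAt.hasFDerivWithinAt) hinj',
    measurePreserving_pt.setIntegral_image_emb measurableEmbedding_pt]
  rfl

/-- The source of a film, as an integral over the rescaled slab. -/
lemma volumeSource_film {ψ ν : E3 → E3} {T : Set E2} (hT : IsC1Domain T) (hψ : IsFilmChart ψ T ν)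
    {h : ℝ} (hh : 0 < h) (hh1 : h ≤ 1)
    (hinj : InjOn (fun z : E2 × ℝ => ψ (pt z.1 z.2)) (T ×ˢ Ioo (-h) h)) {ρ : E3 → ℝ} {M : ℝ}
    (hρ : ContinuousOn ρ (film ψ T h)) (hM : ∀ r ∈ film ψ T h, |ρ r| ≤ M) (c : ℝ) {u : E3 → ℝ}
    (hu : Continuous u) :
    volumeSource ((film ψ T h).indicator fun r => ρ r / c) u =
      h / c * ∫ x, verticalPairing (slabDensity ψ T ρ h) (fun p => u (ψ (pt p.1 p.2))) h x := by
  have hfm : MeasurableSet (film ψ T h) := by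
    rw [film_eq_image]
    refine (measurableSet_pt_image hT.isOpen).image_of_continuousOn_injOn
      hψ.contDiff.continuous.continuousOn ?_
    rintro _ ⟨p, hp, rfl⟩ _ ⟨q, hq, rfl⟩ hpq
    rw [hinj hp hq hpq]
  let f : E2 × ℝ → ℝ := (T ×ˢ Ioo (-h) h).indicator
    fun p => J ψ (pt p.1 p.2) * (ρ (ψ (pt p.1 p.2)) * u (ψ (pt p.1 p.2)))
  have hmeas := (hT.isOpen.prod (isOpen_Ioo (a := -h) (b := h))).measurableSet
  have e1 : volumeSource ((film ψ T h).indicator fun r => ρ r / c) u = c⁻¹ * ∫ p, f p := by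
    rw [integral_indicator hmeas, ← setIntegral_film hT.isOpen hψ hinj fun r => ρ r * u r,
      ← integral_const_mul, ← integral_indicator hfm, volumeSource]
    congr 1
    ext r
    by_cases hr : r ∈ film ψ T h
    · simp only [indicator_of_mem hr]; ring
    · simp only [indicator_of_notMem hr, zero_mul]
  have hfi : Integrable f := by
    obtain ⟨C, hC0, hC⟩ := exists_bound_slab hT.isBounded (continuous_J hψ.contDiff)
    obtain ⟨C', hC0', hC'⟩ := exists_bound_slab hT.isBounded (hu.comp hψ.contDiff.continuous)
    have hpt := (contDiff_pt (n := 0)).continuous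
    have hfmeas : Measurable f := by
      classical
      simp only [f]
      rw [← piecewise_eq_indicator]
      have h1 := hψ.contDiff.continuous.comp hpt
      refine ContinuousOn.measurable_piecewise ?_ continuousOn_const hmeas
      exact ((continuous_J hψ.contDiff).comp hpt).continuousOn.mul
        ((hρ.comp h1.continuousOn fun p hp => ⟨_, hp.1, _, hp.2, rfl⟩).mul
          (hu.comp h1).continuousOn)
    rw [← integrableOn_iff_integrable_of_support_subset (s := T ×ˢ Ioo (-h) h)
      support_indicator_subset]
    refine Measure.integrableOn_of_bounded (M := C * (|M| * C')) ?_ ?_ ?_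
    · exact (hT.isBounded.prod (Metric.isBounded_Ioo _ _)).measure_lt_top.ne
    · exact hfmeas.aestronglyMeasurable
    · refine (ae_restrict_iff' hmeas).2 (Eventually.of_forall fun p hp => ?_)
      have ht : p.2 ∈ Icc (-1 : ℝ) 1 := ⟨by linarith [hp.2.1], by linarith [hp.2.2]⟩
      rw [indicator_of_mem hp, norm_mul, norm_mul]
      refine mul_le_mul (hC _ hp.1 _ ht) (mul_le_mul ?_ (hC' _ hp.1 _ ht) (norm_nonneg _)
        (abs_nonneg _)) (by positivity) hC0
      exact (hM _ ⟨_, hp.1, _, hp.2, rfl⟩).trans (le_abs_self M)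
  have e2 : ∀ x, ∫ t, f (x, t) =
      h * verticalPairing (slabDensity ψ T ρ h) (fun p => u (ψ (pt p.1 p.2))) h x := by
    intro x
    -- The substitution `t = h z` produces the factor `h` in the prefactor `h / c`.
    have h1 := Measure.integral_comp_mul_left (fun t => f (x, t)) h
    rw [abs_of_pos (inv_pos.2 hh), smul_eq_mul, eq_inv_mul_iff_mul_eq₀ hh.ne'] at h1
    rw [← h1, verticalPairing, ← integral_indicator measurableSet_Ioo]
    congr 2
    ext z
    have hz : h * z ∈ Ioo (-h) h ↔ z ∈ Ioo (-1 : ℝ) 1 :=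
      ⟨fun hz => ⟨by nlinarith [hz.1], by nlinarith [hz.2]⟩, mul_mem_Ioo hh⟩
    by_cases hx : x ∈ T
    · by_cases hz1 : z ∈ Ioo (-1 : ℝ) 1
      · rw [indicator_of_mem hz1, slabDensity_of_mem hx hz1]
        simp only [f]
        rw [indicator_of_mem (show (x, h * z) ∈ T ×ˢ Ioo (-h) h from ⟨hx, hz.2 hz1⟩)]
        ring
      · rw [indicator_of_notMem hz1]
        exact indicator_of_notMem (fun h' => hz1 (hz.1 h'.2)) _
    · have : f (x, h * z) = 0 := indicator_of_notMem (fun h' => hx h'.1) _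
      rw [this]
      simp [slabDensity_of_notMem hx]
  rw [e1, Measure.volume_eq_prod, integral_prod _ hfi]
  simp only [e2]
  rw [integral_const_mul]
  ring

/-! ### Limits of the cell sums -/

section CellMoments

variable {ψ : E3 → E3} {e : Module.Basis (Fin 2) ℝ E2} {B T : Set E2} {ρ : E3 → ℝ} {l h : ℝ}
  {n : Fin 2 → ℤ}

lemma pulled_eq_slabDensity {x y : E2} (hxy : x + l • y ∈ T) {z : ℝ} (hz : z ∈ Ioo (-1 : ℝ) 1) :
    pulled ψ ρ l h x y z = slabDensity ψ T ρ h (x + l • y, z) := by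
  rw [slabDensity_of_mem hxy hz, pulled]

lemma setIntegral_pulled_of_full (hB : MeasurableSet B) (hn : n ∈ fullCells e B T l) :
    ∫ y in B, ∫ z in Ioo (-1 : ℝ) 1, pulled ψ ρ l h (corner e l n) y z =
      ∫ y in B, verticalCharge (slabDensity ψ T ρ h) (corner e l n + l • y) :=
  setIntegral_congr_fun hB fun y hy => setIntegral_congr_fun measurableSet_Ioo fun _ hz =>
    pulled_eq_slabDensity (hn y hy) hz

lemma setIntegral_pulled_smul_of_full (hB : MeasurableSet B) (hn : n ∈ fullCells e B T l) :
    ∫ y in B, ∫ z in Ioo (-1 : ℝ) 1, pulled ψ ρ l h (corner e l n) y z • y =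
      ∫ y in B, verticalCharge (slabDensity ψ T ρ h) (corner e l n + l • y) • y :=
  setIntegral_congr_fun hB fun y hy => by
    simp only [integral_smul_const]
    congr 1
    exact setIntegral_congr_fun measurableSet_Ioo fun z hz => pulled_eq_slabDensity (hn y hy) hz

lemma setIntegral_mul_pulled_of_full (hB : MeasurableSet B) (hn : n ∈ fullCells e B T l) :
    ∫ y in B, ∫ z in Ioo (-1 : ℝ) 1, z * pulled ψ ρ l h (corner e l n) y z =
      ∫ y in B, verticalMoment (slabDensity ψ T ρ h) (corner e l n + l • y) :=
  setIntegral_congr_fun hB fun y hy => setIntegral_congr_fun measurableSet_Ioo fun z hz => by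
    simp only [pulled_eq_slabDensity (hn y hy) hz]

/-- The slab density vanishes outside `T`, so the edge charge of a partial cell can be integrated
over all of `B`, in the same form as for full cells. -/
lemma setIntegral_pulled_inter (hB : MeasurableSet B) (hT : IsOpen T) (x : E2) :
    ∫ y in {y | y ∈ B ∧ x + l • y ∈ T}, ∫ z in Ioo (-1 : ℝ) 1, pulled ψ ρ l h x y z =
      ∫ y in B, verticalCharge (slabDensity ψ T ρ h) (x + l • y) := by
  have hc : Continuous fun y : E2 => x + l • y := by fun_prop
  have hm : MeasurableSet {y | y ∈ B ∧ x + l • y ∈ T} :=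
    hB.inter (hT.preimage hc).measurableSet
  rw [setIntegral_eq_of_subset_of_forall_sdiff_eq_zero (s := {y | y ∈ B ∧ x + l • y ∈ T}) hB
    (fun y hy => hy.1)
    (f := fun y => verticalCharge (slabDensity ψ T ρ h) (x + l • y)) fun y hy => ?_]
  · exact setIntegral_congr_fun hm fun y hy => setIntegral_congr_fun measurableSet_Ioo fun z hz =>
      pulled_eq_slabDensity hy.2 hz
  · have : x + l • y ∉ T := fun h => hy.2 ⟨hy.1, h⟩
    simp [verticalCharge, slabDensity_of_notMem this]

end CellMoments

/-- The cell quantities contain `J0⁻¹` at the corner, which may lie outside `closure T`, where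
immersivity is not assumed. By compactness `J0` is positive on a thickening of `closure T`, and
small cells have their corners there. -/
lemma eventually_J0_corner_pos {ψ ν : E3 → E3} {T : Set E2} (hT : IsC1Domain T)
    (hψ : IsFilmChart ψ T ν) {e : Module.Basis (Fin 2) ℝ E2} {B : Set E2} (hB : IsUnitCell e B)
    {l : ℕ → ℝ} (hl : ∀ k, 0 < l k) (hl0 : Tendsto l atTop (𝓝 0)) :
    ∀ᶠ k in atTop, ∀ n ∈ fullCells e B T (l k) ∪ partialCells e B T (l k),
      0 < J0 ψ (corner e (l k) n) := by
  obtain ⟨b, hb0, hb⟩ := hB.isBounded.exists_pos_norm_le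
  have hU : IsOpen {x | 0 < J0 ψ x} := isOpen_lt continuous_const hψ.continuous_J0
  obtain ⟨δ, hδ, hδU⟩ := hT.isCompact_closure.exists_thickening_subset_open hU
    fun x hx => J0_pos (hψ.immersion x hx)
  have hlb : Tendsto (fun k => l k * b) atTop (𝓝 0) := by simpa using hl0.mul_const b
  filter_upwards [hlb.eventually_lt_const hδ] with k hk n hn
  obtain ⟨y, hy, hyT⟩ := exists_corner_add_mem hB hn
  refine hδU (Metric.mem_thickening_iff.2 ⟨_, subset_closure hyT, ?_⟩)
  rw [dist_eq_norm, sub_add_cancel_left, norm_neg, norm_smul, Real.norm_of_nonneg (hl k).le]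
  exact (mul_le_mul_of_nonneg_left (hb y hy) (hl k).le).trans_lt hk

section Limits

variable {ψ ν : E3 → E3} {T B : Set E2} {e : Module.Basis (Fin 2) ℝ E2} {l h : ℕ → ℝ}
  {ρ : ℕ → E3 → ℝ} {u : E3 → ℝ}

lemma IsFilmChart.contDiff_comp_slab (hψ : IsFilmChart ψ T ν) (hu : ContDiff ℝ 1 u) :
    ContDiff ℝ 1 fun p : E2 × ℝ => u (ψ (pt p.1 p.2)) :=
  hu.comp hψ.contDiff_slab

lemma tendsto_chargeSum (hT : IsC1Domain T) (hψ : IsFilmChart ψ T ν) (hB : IsUnitCell e B)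
    (hl : ∀ k, 0 < l k) (hl0 : Tendsto l atTop (𝓝 0)) {a b : ℕ} {q : E2 → ℝ}
    (hq : BulkLimit ψ e B T l (fun k => freeCharge ψ B a b (ρ k) (l k) (h k)) q)
    (hu : Continuous u) :
    Tendsto (fun k => (l k ^ a * h k ^ b)⁻¹ * chargeSum e B T (l k) (slabDensity ψ T (ρ k) (h k))
      fun p => u (ψ (pt p.1 p.2))) atTop (𝓝 (∫ x in T, u (mid ψ x) * J0 ψ x * q x)) := by
  refine (hq (fun x => u (mid ψ x)) (hu.comp hψ.contDiff_mid.continuous)).congr' ?_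
  filter_upwards [eventually_J0_corner_pos hT hψ hB hl hl0] with k hk
  rw [chargeSum, mul_finsum_mem]
  refine finsum_mem_congr rfl fun n hn => ?_
  have hJ := (hk n (Or.inl hn)).ne'
  rw [freeCharge, setIntegral_pulled_of_full hB.measurableSet hn, smul_eq_mul]
  simp only [mid]
  field_simp

lemma fderiv_slab_plane (hψ : IsFilmChart ψ T ν) (hu : ContDiff ℝ 1 u) (x w : E2) :
    fderiv ℝ (fun p : E2 × ℝ => u (ψ (pt p.1 p.2))) (x, 0) (w, 0) =
      fderiv ℝ (fun x => u (mid ψ x)) x w := by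
  have h1 := ((hψ.contDiff_comp_slab hu).differentiable (by norm_num) (x, 0)).hasFDerivAt
  have h2 : HasFDerivAt (fun x : E2 => (x, (0 : ℝ))) (ContinuousLinearMap.inl ℝ E2 ℝ) x :=
    hasFDerivAt_prodMk_left x 0
  have h3 := h1.comp x h2
  have h4 : HasFDerivAt (fun x => u (mid ψ x)) _ x := h3
  rw [h4.fderiv]
  simp

lemma fderiv_slab_vertical (hψ : IsFilmChart ψ T ν) (hu : ContDiff ℝ 1 u) {x : E2}
    (hx : x ∈ closure T) :
    fderiv ℝ (fun p : E2 × ℝ => u (ψ (pt p.1 p.2))) (x, 0) (0, 1) =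
      fderiv ℝ u (mid ψ x) (ν (mid ψ x)) := by
  have h1 := ((hψ.contDiff_comp_slab hu).differentiable (by norm_num) (x, 0)).hasFDerivAt
  have h2 : HasDerivAt (fun t : ℝ => (x, t)) ((0, 1) : E2 × ℝ) 0 :=
    (hasDerivAt_const _ _).prodMk (hasDerivAt_id _)
  have h3 : HasDerivAt (fun t : ℝ => u (ψ (pt x t))) _ 0 := h1.comp_hasDerivAt 0 h2
  have h4 : HasDerivAt (fun t : ℝ => u (ψ (pt x t))) _ 0 :=
    (hu.differentiable (by norm_num) (mid ψ x)).hasFDerivAt.comp_hasDerivAt 0 (hψ.vertical x hx)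
  exact h3.unique h4

/-- The test function in the hypothesis has to be continuous on the whole plane, whereas `ν` is
controlled only over `closure T`. The vertical derivative of `u ∘ ψ ∘ pt` is continuous everywhere
and equals the normal derivative of `u` on `T`. -/
lemma tendsto_normalSum (hT : IsC1Domain T) (hψ : IsFilmChart ψ T ν) (hB : IsUnitCell e B)
    (hl : ∀ k, 0 < l k) (hl0 : Tendsto l atTop (𝓝 0)) {q : E2 → ℝ}
    (hq : BulkLimit ψ e B T l (fun k => normalPol ψ B (ρ k) (l k) (h k)) q)
    (hu : ContDiff ℝ 1 u) :
    Tendsto (fun k => normalSum e B T (l k) (slabDensity ψ T (ρ k) (h k))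
      fun p => u (ψ (pt p.1 p.2))) atTop
      (𝓝 (∫ x in T, fderiv ℝ u (mid ψ x) (ν (mid ψ x)) * J0 ψ x * q x)) := by
  have hc : Continuous fun x : E2 =>
      fderiv ℝ (fun p : E2 × ℝ => u (ψ (pt p.1 p.2))) (x, 0) (0, 1) :=
    (((hψ.contDiff_comp_slab hu).continuous_fderiv (by norm_num)).comp
      (continuous_id.prodMk continuous_const)).clm_apply continuous_const
  have hlim := hq _ hc
  rw [setIntegral_congr_fun (g := fun x => fderiv ℝ u (mid ψ x) (ν (mid ψ x)) * J0 ψ x * q x)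
    hT.isOpen.measurableSet fun x hx => by
      simp only [smul_eq_mul, fderiv_slab_vertical hψ hu (subset_closure hx)]] at hlim
  refine hlim.congr' ?_
  filter_upwards [eventually_J0_corner_pos hT hψ hB hl hl0] with k hk
  rw [normalSum]
  refine finsum_mem_congr rfl fun n hn => ?_
  have hJ := (hk n (Or.inl hn)).ne'
  rw [normalPol, setIntegral_mul_pulled_of_full hB.measurableSet hn, smul_eq_mul]
  field_simp

lemma tendsto_edgeSum (hT : IsC1Domain T) (hψ : IsFilmChart ψ T ν) (hB : IsUnitCell e B)
    (hl : ∀ k, 0 < l k) (hl0 : Tendsto l atTop (𝓝 0)) {σ : E3 → ℝ}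
    (hσ : EdgeLimit ψ e B T l (fun k => edgeCharge ψ B T (ρ k) (l k) (h k)) σ)
    (hu : Continuous u) :
    Tendsto (fun k => edgeSum e B T (l k) (slabDensity ψ T (ρ k) (h k))
      fun p => u (ψ (pt p.1 p.2))) atTop (𝓝 (∫ r in surfaceBoundary ψ T, u r * σ r ∂μH[1])) := by
  refine (hσ u hu).congr' ?_
  filter_upwards [eventually_J0_corner_pos hT hψ hB hl hl0] with k hk
  rw [edgeSum]
  refine finsum_mem_congr rfl fun n hn => ?_
  have hJ := (hk n (Or.inr hn)).ne'
  rw [edgeCharge, setIntegral_pulled_inter hB.measurableSet hT.isOpen]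
  simp only [mid]
  field_simp

lemma apply_eq_sum_single (L : E2 →L[ℝ] ℝ) (w : E2) :
    L w = ∑ i : Fin 2, L (EuclideanSpace.single i 1) * w i := by
  conv_lhs => rw [eq_single_add_single w]
  rw [map_add, map_smul, map_smul, Fin.sum_univ_two]
  simp [mul_comm]

/-- The hypothesis is vector-valued with scalar test functions. It is used with each partial
derivative of `u ∘ mid ψ`, and the matching coordinates of the limits are added. Continuity of `J0 •
P` gives the integrability needed to take coordinates under the integral. -/
lemma tendsto_planeSum (hT : IsC1Domain T) (hψ : IsFilmChart ψ T ν) (hB : IsUnitCell e B)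
    (hl : ∀ k, 0 < l k) (hl0 : Tendsto l atTop (𝓝 0)) {P : E2 → E2}
    (hP : BulkLimit ψ e B T l (fun k => planePol ψ B (ρ k) (l k) (h k)) P)
    (hPc : ContinuousOn (fun x => J0 ψ x • P x) (closure T)) (hu : ContDiff ℝ 1 u) :
    Tendsto (fun k => planeSum e B T (l k) (slabDensity ψ T (ρ k) (h k))
      fun p => u (ψ (pt p.1 p.2))) atTop
      (𝓝 (∫ x in T, fderiv ℝ (fun x => u (mid ψ x)) x (J0 ψ x • P x))) := by
  have hU : ContDiff ℝ 1 fun x => u (mid ψ x) := hu.comp hψ.contDiff_mid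
  let φ : Fin 2 → E2 → ℝ := fun i x =>
    fderiv ℝ (fun x => u (mid ψ x)) x (EuclideanSpace.single i 1)
  have hφ : ∀ i, Continuous (φ i) := fun i =>
    (hU.continuous_fderiv (by norm_num)).clm_apply continuous_const
  let π : Fin 2 → E2 →L[ℝ] ℝ := fun i => EuclideanSpace.proj i
  have hint : ∀ i, IntegrableOn (fun x => (φ i x * J0 ψ x) • P x) T := fun i => by
    have h1 : ContinuousOn (fun x => φ i x • (J0 ψ x • P x)) (closure T) :=
      (hφ i).continuousOn.smul hPc
    have h2 := (h1.integrableOn_compact (μ := volume) hT.isCompact_closure).mono_set subset_closure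
    simpa only [smul_smul] using h2
  have hlim := tendsto_finsetSum Finset.univ fun i _ =>
    ((π i).continuous.tendsto _).comp (hP (φ i) (hφ i))
  have e1 : ∑ i, π i (∫ x in T, (φ i x * J0 ψ x) • P x) =
      ∫ x in T, fderiv ℝ (fun x => u (mid ψ x)) x (J0 ψ x • P x) := by
    simp only [← (π _).integral_comp_comm (hint _)]
    rw [← integral_finsetSum _ fun i _ => (π i).integrable_comp (hint i)]
    refine integral_congr_ae (Eventually.of_forall fun x => ?_)
    simp only
    rw [apply_eq_sum_single]
    refine Finset.sum_congr rfl fun i _ => ?_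
    simp [π, φ, mul_assoc]
  rw [e1] at hlim
  refine hlim.congr' ?_
  filter_upwards [eventually_J0_corner_pos hT hψ hB hl hl0] with k hk
  obtain ⟨hF, -⟩ := finite_fullCells hB hT.isBounded (hl k)
  simp only [Function.comp_apply, planeSum]
  simp only [finsum_mem_eq_finite_toFinset_sum _ hF, map_sum]
  rw [Finset.sum_comm]
  refine Finset.sum_congr rfl fun n hn => ?_
  rw [Set.Finite.mem_toFinset] at hn
  have hJ := (hk n (Or.inl hn)).ne'
  rw [fderiv_slab_plane hψ hu, apply_eq_sum_single, Finset.mul_sum]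
  refine Finset.sum_congr rfl fun i _ => ?_
  rw [planePol, setIntegral_pulled_smul_of_full hB.measurableSet hn, smul_smul, map_smul]
  simp only [π, φ, PiLp.proj_apply, smul_eq_mul]
  field_simp

end Limits

/-! ### Potentials of the sources -/

lemma HasPotential.congr {C : Set E3} {S S' : (E3 → ℝ) → ℝ} {Φ : E3 → ℝ} (h : HasPotential C S Φ)
    (hS : ∀ φ, S φ = S' φ) : HasPotential C S' Φ := by
  rwa [← show S = S' from funext hS]

lemma exists_isCompact_iUnion_of_isOpen {X : Type*} [PseudoMetricSpace X] [ProperSpace X] {U : Set X}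
    (hU : IsOpen U) (hb : Bornology.IsBounded U) :
    ∃ F : ℕ → Set X, (∀ k, IsCompact (F k)) ∧ ⋃ k, F k = U := by
  obtain ⟨F, hF, hFU, hU', -⟩ := hU.exists_iUnion_isClosed
  exact ⟨F, fun k => Metric.isCompact_of_isClosed_isBounded (hF k) (hb.subset (hFU k)), hU'⟩

section Sources

variable {ψ ν : E3 → E3} {T : Set E2}

/-- Solvability is required for every `k`, also when the film is too thick for `ψ` to be injective
on it, so injectivity is not available. The film is a continuous image of a countable union of
compact sets. -/
lemma measurableSet_film (hT : IsC1Domain T) (hψ : ContDiff ℝ 1 ψ) (h : ℝ) :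
    MeasurableSet (film ψ T h) := by
  obtain ⟨F, hF, hFU⟩ := exists_isCompact_iUnion_of_isOpen (hT.isOpen.prod (isOpen_Ioo (a := -h) (b := h)))
    (hT.isBounded.prod (Metric.isBounded_Ioo _ _))
  rw [film_eq_image, ← hFU, image_iUnion, image_iUnion]
  exact MeasurableSet.iUnion fun k => (((hF k).image (contDiff_pt (n := 0)).continuous).image
    hψ.continuous).measurableSet

lemma isBounded_film (hT : IsC1Domain T) (hψ : ContDiff ℝ 1 ψ) (h : ℝ) :
    Bornology.IsBounded (film ψ T h) := by
  have hc := ((hT.isCompact_closure.prod (isCompact_Icc (a := -h) (b := h))).image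
    (contDiff_pt (n := 0)).continuous).image hψ.continuous
  refine hc.isBounded.subset ?_
  rw [film_eq_image]
  exact image_mono (image_mono (prod_mono subset_closure Ioo_subset_Icc_self))

lemma exists_hasPotential_film (hT : IsC1Domain T) (hψ : ContDiff ℝ 1 ψ) (h : ℝ) {f : E3 → ℝ} {M : ℝ}
    (hf : ContinuousOn f (film ψ T h)) (hM : ∀ r ∈ film ψ T h, |f r| ≤ M) (c : ℝ) :
    ∃ Φ, HasPotential (film ψ T h)
      (volumeSource ((film ψ T h).indicator fun r => f r / c)) Φ := by
  have hm := measurableSet_film hT hψ h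
  have hb := isBounded_film hT hψ h
  have hi : IntegrableOn (fun r => f r / c) (film ψ T h) := by
    refine Integrable.div_const ?_ c
    refine Integrable.mono' (integrableOn_const (C := M) hb.measure_lt_top.ne)
      (hf.aestronglyMeasurable hm) ((ae_restrict_iff' hm).2 (Eventually.of_forall hM))
  refine ⟨_, (hasPotential_integral (lam := volume.restrict (film ψ T h)) measurable_id hb
    (ae_restrict_mem hm) hi (integrable_zero _ E3 _)).congr fun φ => ?_⟩
  rw [volumeSource, ← integral_indicator hm]
  congr 1
  ext r
  by_cases hr : r ∈ film ψ T h
  · simp [indicator_of_mem hr]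
  · simp [indicator_of_notMem hr]

lemma isBounded_closure_surface (hT : IsC1Domain T) (hψ : IsFilmChart ψ T ν) :
    Bornology.IsBounded (closure (surface ψ T)) :=
  ((hT.isCompact_closure.image hψ.contDiff_mid.continuous).isBounded.subset
    (image_mono subset_closure)).closure

lemma exists_hasPotential_surfaceSource (hT : IsC1Domain T) (hψ : IsFilmChart ψ T ν) {f : E2 → ℝ}
    (hf : IntegrableOn (fun x => f x * J0 ψ x) T) :
    ∃ Φ, HasPotential (closure (surface ψ T)) (surfaceSource ψ T f) Φ := by
  refine ⟨_, (hasPotential_integral (lam := volume.restrict T)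
    hψ.contDiff_mid.continuous.measurable (isBounded_closure_surface hT hψ)
    ((ae_restrict_iff' hT.isOpen.measurableSet).2
      (Eventually.of_forall fun x hx => subset_closure (mem_image_of_mem _ hx))) hf
    (integrable_zero _ E3 _)).congr fun φ => ?_⟩
  rw [surfaceSource]
  refine integral_congr_ae (Eventually.of_forall fun x => ?_)
  simp only [Pi.zero_apply, map_zero, add_zero]
  ring

lemma surfaceBoundary_subset_closure (hψ : IsFilmChart ψ T ν) :
    surfaceBoundary ψ T ⊆ closure (surface ψ T) :=
  (image_mono frontier_subset_closure).trans
    (image_closure_subset_closure_image hψ.contDiff_mid.continuous)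

lemma exists_hasPotential_lineSource (hT : IsC1Domain T) (hψ : IsFilmChart ψ T ν) {f : E3 → ℝ}
    (hf : IntegrableOn f (surfaceBoundary ψ T) μH[1]) :
    ∃ Φ, HasPotential (closure (surface ψ T)) (lineSource ψ T f) Φ := by
  -- Finite length supplies the `SFinite` instance that the potential of a parametrized source
  -- requires.
  have hfin : IsFiniteMeasure ((μH[1] : Measure E3).restrict (surfaceBoundary ψ T)) :=
    ⟨by rw [Measure.restrict_apply_univ]; exact hT.hausdorffMeasure_surfaceBoundary_lt_top hψ⟩
  refine ⟨_, (hasPotential_integral (lam := (μH[1] : Measure E3).restrict (surfaceBoundary ψ T))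
    measurable_id (isBounded_closure_surface hT hψ)
    ((ae_restrict_iff' (hT.isCompact_surfaceBoundary hψ).measurableSet).2
      (Eventually.of_forall fun x hx => surfaceBoundary_subset_closure hψ hx)) hf
    (integrable_zero _ E3 _)).congr fun φ => ?_⟩
  rw [lineSource]
  refine integral_congr_ae (Eventually.of_forall fun x => ?_)
  simp

/-- The field `ν` carries no regularity assumption of its own. It is replaced by the vertical
derivative `N` of the chart, which is continuous on the plane and equals `ν ∘ mid ψ` on `T`. -/
lemma exists_hasPotential_doubleLayer (hT : IsC1Domain T) (hψ : IsFilmChart ψ T ν) {f : E3 → ℝ}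
    (hf : IntegrableOn (fun x => f (mid ψ x)) T) :
    ∃ Φ, HasPotential (closure (surface ψ T)) (doubleLayer ψ T ν f) Φ := by
  let N : E2 → E3 := fun x => fderiv ℝ (fun p : E2 × ℝ => ψ (pt p.1 p.2)) (x, 0) (0, 1)
  have hN : Continuous N := ((hψ.contDiff_slab.continuous_fderiv (by norm_num)).comp
      (continuous_id.prodMk continuous_const)).clm_apply continuous_const
  have hNν : ∀ x ∈ T, N x = ν (mid ψ x) := fun x hx => by
    have h1 := (hψ.contDiff_slab.differentiable (by norm_num) (x, 0)).hasFDerivAt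
    have h2 : HasDerivAt (fun t : ℝ => (x, t)) ((0, 1) : E2 × ℝ) 0 :=
      (hasDerivAt_const _ _).prodMk (hasDerivAt_id _)
    have h3 : HasDerivAt (fun t : ℝ => ψ (pt x t)) _ 0 := h1.comp_hasDerivAt 0 h2
    exact h3.unique (hψ.vertical x (subset_closure hx))
  have hb : IntegrableOn (fun x => f (mid ψ x) • (-J0 ψ x • N x)) T :=
    hf.smul_continuousOn_of_subset (hψ.continuous_J0.neg.smul hN).continuousOn
      hT.isOpen.measurableSet hT.isCompact_closure subset_closure
  refine ⟨_, (hasPotential_integral (lam := volume.restrict T)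
    hψ.contDiff_mid.continuous.measurable (isBounded_closure_surface hT hψ)
    ((ae_restrict_iff' hT.isOpen.measurableSet).2
      (Eventually.of_forall fun x hx => subset_closure (mem_image_of_mem _ hx)))
    (integrable_zero _ ℝ _) hb).congr fun φ => ?_⟩
  rw [doubleLayer, ← integral_neg]
  refine setIntegral_congr_fun hT.isOpen.measurableSet fun x hx => ?_
  simp only [hNν x hx, map_smul, smul_eq_mul, Pi.zero_apply, zero_mul, zero_add]
  ring

/-- Films of small thickness stay away from points outside the closed surface. -/
lemma exists_eventually_disjoint_film (hT : IsC1Domain T) (hψ : ContDiff ℝ 1 ψ) {h : ℕ → ℝ}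
    (hh0 : Tendsto h atTop (𝓝 0)) {r : E3} (hr : r ∉ closure (surface ψ T)) :
    ∃ δ > 0, ∀ᶠ k in atTop, Disjoint (film ψ T (h k)) (Metric.ball r δ) := by
  obtain ⟨δ, hδ, hball⟩ := Metric.isOpen_iff.1 isClosed_closure.isOpen_compl r hr
  have hc : IsCompact (closure T ×ˢ Icc (-1 : ℝ) 1) := hT.isCompact_closure.prod isCompact_Icc
  have huc := hc.uniformContinuousOn_of_continuous (f := fun p : E2 × ℝ => ψ (pt p.1 p.2))
    (hψ.continuous.comp (contDiff_pt (n := 0)).continuous).continuousOn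
  obtain ⟨η, hη, hunif⟩ := Metric.uniformContinuousOn_iff.1 huc (δ / 2) (by positivity)
  refine ⟨δ / 2, by positivity, ?_⟩
  filter_upwards [hh0.eventually_lt_const hη, hh0.eventually_le_const one_pos] with k hk hk1
  rw [Set.disjoint_left]
  rintro _ ⟨x, hx, t, ht, rfl⟩ hxr
  have h1 := hunif (x, 0) ⟨subset_closure hx, by norm_num⟩ (x, t)
    ⟨subset_closure hx, by linarith [ht.1], by linarith [ht.2]⟩ (by
      rw [Prod.dist_eq, dist_self, Real.dist_eq, zero_sub, abs_neg]
      exact max_lt hη ((_root_.abs_lt.2 ht).trans hk))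
  have h2 : mid ψ x ∈ Metric.ball r δ := by
    have h3 := dist_triangle (mid ψ x) (ψ (pt x t)) r
    rw [Metric.mem_ball] at hxr ⊢
    simp only [mid] at h1 h3 ⊢
    linarith
  exact hball h2 (subset_closure (mem_image_of_mem _ hx))

/-! ### Polarization charges -/

variable {n p : E3 → E3} {P : E2 → E2} {U : Set E2}

lemma fluxDensity_smul_J0 (hψ : IsFilmChart ψ T ν)
    (hp : ∀ x ∈ closure T, p (mid ψ x) = D0 ψ x (P x)) (u : E3 → ℝ) {r : E3}
    (hr : r ∈ surfaceBoundary ψ T) :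
    fluxDensity ψ T n (fun x => u (mid ψ x) • (J0 ψ x • P x)) r = u r * ⟪p r, n r⟫ := by
  obtain ⟨x, hx, rfl⟩ := hr
  have hxc := frontier_subset_closure hx
  have hJ := (J0_pos (hψ.immersion x hxc)).ne'
  rw [fluxDensity, hψ.param_mid hxc, map_smul, map_smul, inner_smul_left, inner_smul_left, hp x hxc]
  simp only [conj_trivial]
  field_simp

lemma contDiffOn_smul (hψ : IsFilmChart ψ T ν) (hP : ContDiffOn ℝ 1 (fun x => J0 ψ x • P x) U)
    {u : E3 → ℝ} (hu : ContDiff ℝ 1 u) :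
    ContDiffOn ℝ 1 (fun x => u (mid ψ x) • (J0 ψ x • P x)) U :=
  (hu.comp hψ.contDiff_mid).contDiffOn.smul hP

/-- The divergence theorem with the constant test function `1`. It also avoids any measurability
assumption on `p` and `n`, since the flux density is identified along the patches. -/
lemma integrableOn_edgePolarization (hT : IsC1Domain T) (hψ : IsFilmChart ψ T ν)
    (hn : ∀ x ∈ frontier T, IsOutwardConormal ψ T x (n (mid ψ x)))
    (hp : ∀ x ∈ closure T, p (mid ψ x) = D0 ψ x (P x)) (hU : IsOpen U) (hTU : closure T ⊆ U)
    (hP : ContDiffOn ℝ 1 (fun x => J0 ψ x • P x) U) :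
    IntegrableOn (fun r => ⟪p r, n r⟫) (surfaceBoundary ψ T) μH[1] := by
  have h := (setIntegral_planarDiv hT hψ hn hU hTU
    (contDiffOn_smul hψ hP (contDiff_const (c := (1 : ℝ))))).1
  refine (integrableOn_congr_fun (fun r hr => ?_)
    (hT.isCompact_surfaceBoundary hψ).measurableSet).1 h
  have := fluxDensity_smul_J0 (n := n) hψ hp (fun _ => 1) hr
  simp only [one_mul] at this
  exact this

lemma integrableOn_planarDiv (hT : IsC1Domain T) (hU : IsOpen U) (hTU : closure T ⊆ U) {F : E2 → E2}
    (hF : ContDiffOn ℝ 1 F U) : IntegrableOn (planarDiv F) T := by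
  have h1 := hF.continuousOn_fderiv_of_isOpen hU (by norm_num)
  have h2 : ContinuousOn (planarDiv F) (closure T) := by
    unfold planarDiv
    refine continuousOn_finsetSum _ fun i _ => ?_
    have h3 : ContinuousOn (fun x => fderiv ℝ F x (EuclideanSpace.single i 1)) (closure T) :=
      (h1.mono hTU).clm_apply continuousOn_const
    exact (EuclideanSpace.proj i : E2 →L[ℝ] ℝ).continuous.comp_continuousOn h3
  exact (h2.integrableOn_compact hT.isCompact_closure).mono_set subset_closure

lemma planarDiv_smul {f : E2 → ℝ} {F : E2 → E2} {x : E2} (hf : DifferentiableAt ℝ f x)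
    (hF : DifferentiableAt ℝ F x) :
    planarDiv (fun y => f y • F y) x = f x * planarDiv F x + fderiv ℝ f x (F x) := by
  have h := (hf.hasFDerivAt.smul hF.hasFDerivAt).fderiv
  change fderiv ℝ (fun y => f y • F y) x = _ at h
  rw [planarDiv, h, apply_eq_sum_single, planarDiv]
  simp only [Fin.sum_univ_two]
  simp
  ring

/-- Integration by parts for the polarization: the surface polarization charge and the edge
polarization charge. -/
lemma setIntegral_fderiv_polarization (hT : IsC1Domain T) (hψ : IsFilmChart ψ T ν)
    (hn : ∀ x ∈ frontier T, IsOutwardConormal ψ T x (n (mid ψ x)))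
    (hp : ∀ x ∈ closure T, p (mid ψ x) = D0 ψ x (P x)) (hU : IsOpen U) (hTU : closure T ⊆ U)
    (hP : ContDiffOn ℝ 1 (fun x => J0 ψ x • P x) U) {u : E3 → ℝ} (hu : ContDiff ℝ 1 u) :
    ∫ x in T, fderiv ℝ (fun x => u (mid ψ x)) x (J0 ψ x • P x) =
      (∫ r in surfaceBoundary ψ T, u r * ⟪p r, n r⟫ ∂μH[1]) -
        ∫ x in T, u (mid ψ x) * planarDiv (fun y => J0 ψ y • P y) x := by
  have hU1 : ContDiff ℝ 1 fun x => u (mid ψ x) := hu.comp hψ.contDiff_mid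
  have hF := contDiffOn_smul hψ hP hu
  have h1 := (setIntegral_planarDiv hT hψ hn hU hTU hF).2
  rw [setIntegral_congr_fun (hT.isCompact_surfaceBoundary hψ).measurableSet
    fun r hr => fluxDensity_smul_J0 hψ hp u hr] at h1
  have i1 := integrableOn_planarDiv hT hU hTU hF
  have i2 : IntegrableOn (fun x => u (mid ψ x) * planarDiv (fun y => J0 ψ y • P y) x) T :=
    (integrableOn_planarDiv hT hU hTU hP).continuousOn_mul_of_subset hU1.continuous.continuousOn
      hT.isCompact_closure hT.isOpen.measurableSet subset_closure
  rw [← h1, ← integral_sub i1 i2]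
  refine setIntegral_congr_fun hT.isOpen.measurableSet fun x hx => ?_
  have hxU := hU.mem_nhds (hTU (subset_closure hx))
  rw [planarDiv_smul (hU1.differentiable (by norm_num) x)
    ((hP.contDiffAt hxU).differentiableAt (by norm_num))]
  ring

lemma mul_surfaceDiv (hψ : IsFilmChart ψ T ν) {x : E2} (hx : x ∈ closure T) :
    surfaceDiv ψ P x * J0 ψ x = planarDiv (fun y => J0 ψ y • P y) x := by
  rw [surfaceDiv, mul_comm, mul_inv_cancel_left₀ (J0_pos (hψ.immersion x hx)).ne']

lemma integrableOn_mul_J0 (hT : IsC1Domain T) (hψ : IsFilmChart ψ T ν) {f : E2 → ℝ}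
    (hf : IntegrableOn f T) : IntegrableOn (fun x => f x * J0 ψ x) T :=
  hf.mul_continuousOn_of_subset hψ.continuous_J0.continuousOn hT.isOpen.measurableSet
    hT.isCompact_closure subset_closure

lemma integrableOn_sub_surfaceDiv (hT : IsC1Domain T) (hψ : IsFilmChart ψ T ν) (hU : IsOpen U)
    (hTU : closure T ⊆ U) (hP : ContDiffOn ℝ 1 (fun x => J0 ψ x • P x) U) {f : E2 → ℝ}
    (hf : IntegrableOn f T) : IntegrableOn (fun x => (f x - surfaceDiv ψ P x) * J0 ψ x) T := by
  refine ((integrableOn_mul_J0 hT hψ hf).sub (integrableOn_planarDiv hT hU hTU hP)).congr_fun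
    (fun x hx => ?_) hT.isOpen.measurableSet
  simp only [Pi.sub_apply, sub_mul, mul_surfaceDiv hψ (subset_closure hx)]

/-- The limits of the charges of the cells, in terms of the homogenized surface and line charges. -/
lemma surfaceSource_add_lineSource (hT : IsC1Domain T) (hψ : IsFilmChart ψ T ν)
    (hn : ∀ x ∈ frontier T, IsOutwardConormal ψ T x (n (mid ψ x)))
    (hp : ∀ x ∈ closure T, p (mid ψ x) = D0 ψ x (P x)) (hU : IsOpen U) (hTU : closure T ⊆ U)
    (hP : ContDiffOn ℝ 1 (fun x => J0 ψ x • P x) U) {f : E2 → ℝ} (hf : IntegrableOn f T)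
    {σ : E3 → ℝ} (hσ : IntegrableOn σ (surfaceBoundary ψ T) μH[1]) {u : E3 → ℝ}
    (hu : ContDiff ℝ 1 u) :
    surfaceSource ψ T (fun x => f x - surfaceDiv ψ P x) u +
        lineSource ψ T (fun r => σ r + ⟪p r, n r⟫) u =
      (∫ x in T, u (mid ψ x) * J0 ψ x * f x) +
        (∫ x in T, fderiv ℝ (fun x => u (mid ψ x)) x (J0 ψ x • P x)) +
        ∫ r in surfaceBoundary ψ T, u r * σ r ∂μH[1] := by
  have hU1 : Continuous fun x => u (mid ψ x) := hu.continuous.comp hψ.contDiff_mid.continuous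
  have hc := hT.isCompact_surfaceBoundary hψ
  have i1 : IntegrableOn (fun x => u (mid ψ x) * J0 ψ x * f x) T :=
    hf.continuousOn_mul_of_subset (hU1.mul hψ.continuous_J0).continuousOn
      hT.isCompact_closure hT.isOpen.measurableSet subset_closure
  have i2 : IntegrableOn (fun x => u (mid ψ x) * planarDiv (fun y => J0 ψ y • P y) x) T :=
    (integrableOn_planarDiv hT hU hTU hP).continuousOn_mul_of_subset hU1.continuousOn
      hT.isCompact_closure hT.isOpen.measurableSet subset_closure
  have i3 : IntegrableOn (fun r => u r * σ r) (surfaceBoundary ψ T) μH[1] :=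
    hσ.continuousOn_mul hu.continuous.continuousOn hc
  have i4 : IntegrableOn (fun r => u r * ⟪p r, n r⟫) (surfaceBoundary ψ T) μH[1] :=
    (integrableOn_edgePolarization hT hψ hn hp hU hTU hP).continuousOn_mul
      hu.continuous.continuousOn hc
  have e1 : surfaceSource ψ T (fun x => f x - surfaceDiv ψ P x) u =
      (∫ x in T, u (mid ψ x) * J0 ψ x * f x) -
        ∫ x in T, u (mid ψ x) * planarDiv (fun y => J0 ψ y • P y) x := by
    rw [← integral_sub i1 i2, surfaceSource]
    refine setIntegral_congr_fun hT.isOpen.measurableSet fun x hx => ?_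
    simp only [← mul_surfaceDiv hψ (subset_closure hx)]
    ring
  have e2 : lineSource ψ T (fun r => σ r + ⟪p r, n r⟫) u =
      (∫ r in surfaceBoundary ψ T, u r * σ r ∂μH[1]) +
        ∫ r in surfaceBoundary ψ T, u r * ⟪p r, n r⟫ ∂μH[1] := by
    rw [← integral_add i3 i4, lineSource]
    exact integral_congr_ae (Eventually.of_forall fun r => by simp only; ring)
  rw [e1, e2, setIntegral_fderiv_polarization hT hψ hn hp hU hTU hP hu]
  ring

end Sources

/-! ### Homogenization -/

/-- The integral of the charge density of a film against a function, on the rescaled slab. -/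
def slabIntegral (ψ : E3 → E3) (T : Set E2) (ρ : E3 → ℝ) (h : ℝ) (u : E3 → ℝ) : ℝ :=
  ∫ x, verticalPairing (slabDensity ψ T ρ h) (fun p => u (ψ (pt p.1 p.2))) h x

lemma tendsto_div_of_eventually_le {R s d : ℕ → ℝ} {c : ℝ} (hs : ∀ k, 0 < s k)
    (hR : ∀ ε > 0, ∀ᶠ k in atTop, |R k| ≤ ε * s k)
    (hsd : Tendsto (fun k => s k / d k) atTop (𝓝 c)) : Tendsto (fun k => R k / d k) atTop (𝓝 0) := by
  have h1 : R =o[atTop] s := Asymptotics.isLittleO_iff.2 fun ε hε => by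
    filter_upwards [hR ε hε] with k hk
    rwa [Real.norm_eq_abs, Real.norm_of_nonneg (hs k).le]
  have h2 := h1.tendsto_div_nhds_zero.mul hsd
  rw [zero_mul] at h2
  refine h2.congr fun k => ?_
  rw [div_mul_div_cancel₀ (hs k).ne']

lemma tendsto_mul_of_tendsto_zero {a b : ℕ → ℝ} {C : ℝ} (ha : Tendsto a atTop (𝓝 0))
    (hb : ∀ᶠ k in atTop, |b k| ≤ C) : Tendsto (fun k => a k * b k) atTop (𝓝 0) :=
  ha.zero_mul_isBoundedUnder_le ⟨C, eventually_map.2 hb⟩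

/-! ### From the expansion to the limits of the sources. -/

section Film

variable {ψ ν : E3 → E3} {T B : Set E2} {e : Module.Basis (Fin 2) ℝ E2} {l h : ℕ → ℝ}
  {ρ : ℕ → E3 → ℝ} {M : ℝ} {u : E3 → ℝ}

/-- The change of variables holds only for large `k`, when `h k` is below the thickness on which `ψ`
is injective. -/
lemma eventually_volumeSource_eq (hT : IsC1Domain T) (hψ : IsFilmChart ψ T ν)
    (hh : ∀ k, 0 < h k) (hh0 : Tendsto h atTop (𝓝 0))
    (hρ : ∀ k, ContinuousOn (ρ k) (film ψ T (h k)))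
    (hM : ∀ k, ∀ r ∈ film ψ T (h k), |ρ k r| ≤ M) (c : ℕ → ℝ) (hu : Continuous u) :
    ∀ᶠ k in atTop, volumeSource ((film ψ T (h k)).indicator fun r => ρ k r / c k) u =
      h k / c k * slabIntegral ψ T (ρ k) (h k) u := by
  obtain ⟨h₀, hh₀, hinj⟩ := hψ.injOn
  filter_upwards [hh0.eventually_le_const one_pos, hh0.eventually_le_const hh₀] with k hk1 hk0
  refine volumeSource_film hT hψ (hh k) hk1 (hinj.mono ?_) (hρ k) (hM k) (c k) hu
  exact prod_mono subset_closure fun t ht => ⟨by linarith [ht.1], by linarith [ht.2]⟩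

/-- Convergence of the sources, tested with `C¹` functions, implies convergence of the problems. -/
lemma homogenizesTo_film (hT : IsC1Domain T) (hψ : IsFilmChart ψ T ν)
    (hh : ∀ k, 0 < h k) (hh0 : Tendsto h atTop (𝓝 0))
    (hρ : ∀ k, ContinuousOn (ρ k) (film ψ T (h k)))
    (hM : ∀ k, ∀ r ∈ film ψ T (h k), |ρ k r| ≤ M) (c : ℕ → ℝ) {S₀ : (E3 → ℝ) → ℝ}
    (hS₀ : ∃ Φ, HasPotential (closure (surface ψ T)) S₀ Φ)
    (hS : ∀ u, ContDiff ℝ 1 u →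
      Tendsto (fun k => h k / c k * slabIntegral ψ T (ρ k) (h k) u) atTop (𝓝 (S₀ u))) :
    HomogenizesTo (surface ψ T)
      (fun k => volumeSource ((film ψ T (h k)).indicator fun r => ρ k r / c k)) S₀ := by
  obtain ⟨Ψ₀, hΨ₀⟩ := hS₀
  choose Ψ hΨ using fun k => exists_hasPotential_film hT hψ.contDiff (h k) (hρ k) (hM k) (c k)
  refine homogenizesTo_of_tendsto hΨ hΨ₀ subset_rfl
    (fun r hr => exists_eventually_disjoint_film hT hψ.contDiff hh0 hr) fun u hu => ?_
  refine (hS u hu).congr' ?_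
  filter_upwards [eventually_volumeSource_eq hT hψ hh hh0 hρ hM c hu.continuous] with k hk
  rw [hk]

lemma exists_eventually_slabDensity (hT : IsC1Domain T) (hψ : IsFilmChart ψ T ν)
    (hh : ∀ k, 0 < h k) (hh0 : Tendsto h atTop (𝓝 0))
    (hρ : ∀ k, ContinuousOn (ρ k) (film ψ T (h k)))
    (hM : ∀ k, ∀ r ∈ film ψ T (h k), |ρ k r| ≤ M) :
    ∃ K, ∀ᶠ k in atTop, Measurable (slabDensity ψ T (ρ k) (h k)) ∧
      (∀ p, |slabDensity ψ T (ρ k) (h k) p| ≤ K) ∧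
        ∀ x ∉ T, ∀ z, slabDensity ψ T (ρ k) (h k) (x, z) = 0 := by
  obtain ⟨K, hK⟩ := exists_bound_slabDensity hT.isBounded hψ.contDiff M
  refine ⟨K, ?_⟩
  filter_upwards [hh0.eventually_le_const one_pos] with k hk
  exact ⟨measurable_slabDensity hT.isOpen hψ.contDiff (hh k) (hρ k), hK _ _ (hh k) hk (hM k),
    fun x hx z => slabDensity_of_notMem hx z⟩

/-- The sources divided by the cell size, when the thickness is at most comparable to it. -/
lemma tendsto_slabIntegral_div_l (hT : IsC1Domain T) (hψ : IsFilmChart ψ T ν) (hB : IsUnitCell e B)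
    (hl : ∀ k, 0 < l k) (hh : ∀ k, 0 < h k) (hl0 : Tendsto l atTop (𝓝 0))
    (hh0 : Tendsto h atTop (𝓝 0)) (hρ : ∀ k, ContinuousOn (ρ k) (film ψ T (h k)))
    (hM : ∀ k, ∀ r ∈ film ψ T (h k), |ρ k r| ≤ M) {α : ℝ}
    (hα : Tendsto (fun k => h k / l k) atTop (𝓝 α)) (hu : ContDiff ℝ 1 u) {a₀ a₁ a₂ a₃ : ℝ}
    (h₀ : Tendsto (fun k => (l k)⁻¹ * chargeSum e B T (l k) (slabDensity ψ T (ρ k) (h k))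
      fun p => u (ψ (pt p.1 p.2))) atTop (𝓝 a₀))
    (h₁ : Tendsto (fun k => planeSum e B T (l k) (slabDensity ψ T (ρ k) (h k))
      fun p => u (ψ (pt p.1 p.2))) atTop (𝓝 a₁))
    (h₂ : Tendsto (fun k => h k / l k * normalSum e B T (l k) (slabDensity ψ T (ρ k) (h k))
      fun p => u (ψ (pt p.1 p.2))) atTop (𝓝 a₂))
    (h₃ : Tendsto (fun k => edgeSum e B T (l k) (slabDensity ψ T (ρ k) (h k))
      fun p => u (ψ (pt p.1 p.2))) atTop (𝓝 a₃)) :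
    Tendsto (fun k => slabIntegral ψ T (ρ k) (h k) u / l k) atTop (𝓝 (a₀ + a₁ + a₂ + a₃)) := by
  obtain ⟨K, hK⟩ := exists_eventually_slabDensity hT hψ hh hh0 hρ hM
  -- The remainder is `o(l + h)`, and `(l + h) / l` tends to `1 + α`, so it is negligible against
  -- `l`.
  have hR := tendsto_div_of_eventually_le (d := l) (c := 1 + α) (fun k => add_pos (hl k) (hh k))
    (fun ε hε => eventually_abs_integral_sub_le hB hT hl hh hl0 hh0 hK (hψ.contDiff_comp_slab hu) hε)
    ((tendsto_const_nhds.add hα).congr fun k => by rw [add_div, div_self (hl k).ne'])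
  have := ((((h₀.add h₁).add h₂).add h₃).add hR)
  rw [add_zero] at this
  refine this.congr fun k => ?_
  have := (hl k).ne'
  rw [slabIntegral]
  field_simp
  ring

/-- The sources divided by the thickness, when the cell size is much smaller. -/
lemma tendsto_slabIntegral_div_h (hT : IsC1Domain T) (hψ : IsFilmChart ψ T ν) (hB : IsUnitCell e B)
    (hl : ∀ k, 0 < l k) (hh : ∀ k, 0 < h k) (hl0 : Tendsto l atTop (𝓝 0))
    (hh0 : Tendsto h atTop (𝓝 0)) (hρ : ∀ k, ContinuousOn (ρ k) (film ψ T (h k)))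
    (hM : ∀ k, ∀ r ∈ film ψ T (h k), |ρ k r| ≤ M)
    (hα : Tendsto (fun k => l k / h k) atTop (𝓝 0)) (hu : ContDiff ℝ 1 u) {a₀ a₂ : ℝ}
    (h₀ : Tendsto (fun k => (h k)⁻¹ * chargeSum e B T (l k) (slabDensity ψ T (ρ k) (h k))
      fun p => u (ψ (pt p.1 p.2))) atTop (𝓝 a₀))
    (h₂ : Tendsto (fun k => normalSum e B T (l k) (slabDensity ψ T (ρ k) (h k))
      fun p => u (ψ (pt p.1 p.2))) atTop (𝓝 a₂)) :
    Tendsto (fun k => slabIntegral ψ T (ρ k) (h k) u / h k) atTop (𝓝 (a₀ + a₂)) := by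
  obtain ⟨K, hK⟩ := exists_eventually_slabDensity hT hψ hh hh0 hρ hM
  obtain ⟨C, hC⟩ := exists_bound_sums hB hT hl hl0 (hK.mono fun k hk => hk.2.1)
    (hψ.contDiff_comp_slab hu)
  -- Relative to `h`, the in-plane and edge contributions carry the factor `l / h → 0`. Boundedness
  -- of the sums is enough, and no limits of these quantities are assumed.
  have h₁ := tendsto_mul_of_tendsto_zero hα (hC.mono fun k hk => hk.1)
  have h₃ := tendsto_mul_of_tendsto_zero hα (hC.mono fun k hk => hk.2.2)
  have hR := tendsto_div_of_eventually_le (d := h) (c := 0 + 1) (fun k => add_pos (hl k) (hh k))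
    (fun ε hε => eventually_abs_integral_sub_le hB hT hl hh hl0 hh0 hK (hψ.contDiff_comp_slab hu) hε)
    ((hα.add tendsto_const_nhds).congr fun k => by rw [add_div, div_self (hh k).ne'])
  have := ((((h₀.add h₁).add h₂).add h₃).add hR)
  simp only [add_zero] at this
  refine this.congr fun k => ?_
  have := (hh k).ne'
  rw [slabIntegral]
  field_simp
  ring

lemma neg_doubleLayer (p₃ : E3 → ℝ) (u : E3 → ℝ) : -doubleLayer ψ T ν p₃ u =
    ∫ x in T, fderiv ℝ u (mid ψ x) (ν (mid ψ x)) * J0 ψ x * p₃ (mid ψ x) := by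
  rw [doubleLayer, neg_neg]
  exact integral_congr_ae (Eventually.of_forall fun x => by simp only; ring)

lemma surfaceSource_eq (f : E2 → ℝ) (u : E3 → ℝ) :
    surfaceSource ψ T f u = ∫ x in T, u (mid ψ x) * J0 ψ x * f x :=
  integral_congr_ae (Eventually.of_forall fun x => by simp only; ring)

end Film

/-! ### The three regimes of the ratio of thickness to cell size. -/

section Regimes

variable {ψ ν n : E3 → E3} {T B U : Set E2} {e : Module.Basis (Fin 2) ℝ E2} {l h : ℕ → ℝ}
  {ρ : ℕ → E3 → ℝ} {M α : ℝ} {σ p₃ : E3 → ℝ} {p : E3 → E3} {P : E2 → E2} {f : E2 → ℝ}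

/-- Films much thinner than the cells. -/
theorem homogenizesTo_of_thin (hT : IsC1Domain T) (hψ : IsFilmChart ψ T ν)
    (hn : ∀ x ∈ frontier T, IsOutwardConormal ψ T x (n (mid ψ x))) (hB : IsUnitCell e B)
    (hl : ∀ k, 0 < l k) (hh : ∀ k, 0 < h k) (hl0 : Tendsto l atTop (𝓝 0))
    (hh0 : Tendsto h atTop (𝓝 0)) (hρ : ∀ k, ContinuousOn (ρ k) (film ψ T (h k)))
    (hM : ∀ k, ∀ r ∈ film ψ T (h k), |ρ k r| ≤ M)
    (hlh : Tendsto (fun k => h k / l k) atTop (𝓝 0)) (hf : IntegrableOn f T)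
    (hσ : IntegrableOn σ (surfaceBoundary ψ T) μH[1])
    (hp : ∀ x ∈ closure T, p (mid ψ x) = D0 ψ x (P x)) (hU : IsOpen U) (hTU : closure T ⊆ U)
    (hP : ContDiffOn ℝ 1 (fun x => J0 ψ x • P x) U)
    (hfl : BulkLimit ψ e B T l (fun k => freeCharge ψ B 1 0 (ρ k) (l k) (h k)) f)
    (hPl : BulkLimit ψ e B T l (fun k => planePol ψ B (ρ k) (l k) (h k)) P)
    (hσl : EdgeLimit ψ e B T l (fun k => edgeCharge ψ B T (ρ k) (l k) (h k)) σ) :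
    HomogenizesTo (surface ψ T)
      (fun k => volumeSource ((film ψ T (h k)).indicator fun r => ρ k r / (l k * h k)))
      (fun φ => surfaceSource ψ T (fun x => f x - surfaceDiv ψ P x) φ
        + lineSource ψ T (fun r => σ r + ⟪p r, n r⟫) φ) := by
  obtain ⟨_, hs⟩ := exists_hasPotential_surfaceSource hT hψ
    (integrableOn_sub_surfaceDiv hT hψ hU hTU hP hf)
  obtain ⟨_, hs'⟩ := exists_hasPotential_lineSource hT hψ
    (f := fun r => σ r + ⟪p r, n r⟫) (hσ.add (integrableOn_edgePolarization hT hψ hn hp hU hTU hP))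
  refine homogenizesTo_film hT hψ hh hh0 hρ hM (fun k => l k * h k) ⟨_, hs.add hs'⟩ fun u hu => ?_
  obtain ⟨K, hK⟩ := exists_eventually_slabDensity hT hψ hh hh0 hρ hM
  obtain ⟨C, hC⟩ := exists_bound_sums hB hT hl hl0 (hK.mono fun k hk => hk.2.1)
    (hψ.contDiff_comp_slab hu)
  have h0 := tendsto_chargeSum hT hψ hB hl hl0 hfl hu.continuous
  simp only [pow_one, pow_zero, mul_one] at h0
  have key := tendsto_slabIntegral_div_l hT hψ hB hl hh hl0 hh0 hρ hM hlh hu h0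
    (tendsto_planeSum hT hψ hB hl hl0 hPl (hP.continuousOn.mono hTU) hu)
    -- The vertical dipoles enter with the factor `h / l → 0` and are merely bounded, so their limit
    -- need not exist.
    (tendsto_mul_of_tendsto_zero hlh (hC.mono fun k hk => hk.2.1))
    (tendsto_edgeSum hT hψ hB hl hl0 hσl hu.continuous)
  rw [surfaceSource_add_lineSource hT hψ hn hp hU hTU hP hf hσ hu]
  rw [add_zero] at key
  refine key.congr fun k => ?_
  have h1 := (hl k).ne'
  have h2 := (hh k).ne'
  field_simp

/-- Films of thickness comparable to the cells, or thinner. -/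
theorem homogenizesTo_of_comparable (hT : IsC1Domain T) (hψ : IsFilmChart ψ T ν)
    (hn : ∀ x ∈ frontier T, IsOutwardConormal ψ T x (n (mid ψ x))) (hB : IsUnitCell e B)
    (hl : ∀ k, 0 < l k) (hh : ∀ k, 0 < h k) (hl0 : Tendsto l atTop (𝓝 0))
    (hh0 : Tendsto h atTop (𝓝 0)) (hρ : ∀ k, ContinuousOn (ρ k) (film ψ T (h k)))
    (hM : ∀ k, ∀ r ∈ film ψ T (h k), |ρ k r| ≤ M)
    (hlh : Tendsto (fun k => h k / l k) atTop (𝓝 α)) (hf : IntegrableOn f T)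
    (hp₃ : IntegrableOn (fun x => p₃ (mid ψ x)) T)
    (hσ : IntegrableOn σ (surfaceBoundary ψ T) μH[1])
    (hp : ∀ x ∈ closure T, p (mid ψ x) = D0 ψ x (P x)) (hU : IsOpen U) (hTU : closure T ⊆ U)
    (hP : ContDiffOn ℝ 1 (fun x => J0 ψ x • P x) U)
    (hfl : ∀ u, ContDiff ℝ 1 u →
      Tendsto (fun k => (l k)⁻¹ * chargeSum e B T (l k) (slabDensity ψ T (ρ k) (h k))
        fun p => u (ψ (pt p.1 p.2))) atTop (𝓝 (∫ x in T, u (mid ψ x) * J0 ψ x * f x)))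
    (hPl : BulkLimit ψ e B T l (fun k => planePol ψ B (ρ k) (l k) (h k)) P)
    (hp₃l : BulkLimit ψ e B T l (fun k => normalPol ψ B (ρ k) (l k) (h k)) fun x => p₃ (mid ψ x))
    (hσl : EdgeLimit ψ e B T l (fun k => edgeCharge ψ B T (ρ k) (l k) (h k)) σ) :
    HomogenizesTo (surface ψ T)
      (fun k => volumeSource ((film ψ T (h k)).indicator fun r => ρ k r / l k ^ 2))
      (fun φ => α * surfaceSource ψ T (fun x => f x - surfaceDiv ψ P x) φ
        - α ^ 2 * doubleLayer ψ T ν p₃ φ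
        + α * lineSource ψ T (fun r => σ r + ⟪p r, n r⟫) φ) := by
  obtain ⟨_, hs⟩ := exists_hasPotential_surfaceSource hT hψ
    (integrableOn_sub_surfaceDiv hT hψ hU hTU hP hf)
  obtain ⟨_, hs'⟩ := exists_hasPotential_lineSource hT hψ
    (f := fun r => σ r + ⟪p r, n r⟫) (hσ.add (integrableOn_edgePolarization hT hψ hn hp hU hTU hP))
  obtain ⟨_, hs''⟩ := exists_hasPotential_doubleLayer hT hψ hp₃
  refine homogenizesTo_film hT hψ hh hh0 hρ hM (fun k => l k ^ 2)
    ⟨_, (((hs.const_mul α).add (hs''.const_mul (-α ^ 2))).add (hs'.const_mul α)).congr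
      fun φ => by ring⟩ fun u hu => ?_
  have key := tendsto_slabIntegral_div_l hT hψ hB hl hh hl0 hh0 hρ hM hlh hu (hfl u hu)
    (tendsto_planeSum hT hψ hB hl hl0 hPl (hP.continuousOn.mono hTU) hu)
    (hlh.mul (tendsto_normalSum hT hψ hB hl hl0 hp₃l hu))
    (tendsto_edgeSum hT hψ hB hl hl0 hσl hu.continuous)
  -- The prefactor `h / l²` is `(h / l) · (1 / l)`: every term receives `α`, and the vertical
  -- dipoles, which already carry `h / l`, receive `α²`.
  have key' := hlh.mul key
  have hsrc := surfaceSource_add_lineSource hT hψ hn hp hU hTU hP hf hσ hu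
  rw [← neg_doubleLayer, add_right_comm _ _ (∫ r in surfaceBoundary ψ T, u r * σ r ∂μH[1]),
    ← hsrc] at key'
  convert key' using 2 with k
  · have h1 := (hl k).ne'
    field_simp
  · ring

/-- Films much thicker than the cells. -/
theorem homogenizesTo_of_thick (hT : IsC1Domain T) (hψ : IsFilmChart ψ T ν) (hB : IsUnitCell e B)
    (hl : ∀ k, 0 < l k) (hh : ∀ k, 0 < h k) (hl0 : Tendsto l atTop (𝓝 0))
    (hh0 : Tendsto h atTop (𝓝 0)) (hρ : ∀ k, ContinuousOn (ρ k) (film ψ T (h k)))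
    (hM : ∀ k, ∀ r ∈ film ψ T (h k), |ρ k r| ≤ M)
    (hlh : Tendsto (fun k => l k / h k) atTop (𝓝 0)) (hf : IntegrableOn f T)
    (hp₃ : IntegrableOn (fun x => p₃ (mid ψ x)) T)
    (hfl : BulkLimit ψ e B T l (fun k => freeCharge ψ B 0 1 (ρ k) (l k) (h k)) f)
    (hp₃l : BulkLimit ψ e B T l (fun k => normalPol ψ B (ρ k) (l k) (h k))
      fun x => p₃ (mid ψ x)) :
    HomogenizesTo (surface ψ T)
      (fun k => volumeSource ((film ψ T (h k)).indicator fun r => ρ k r / h k ^ 2))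
      (fun φ => surfaceSource ψ T f φ - doubleLayer ψ T ν p₃ φ) := by
  obtain ⟨_, hs⟩ := exists_hasPotential_surfaceSource hT hψ (integrableOn_mul_J0 hT hψ hf)
  obtain ⟨_, hs'⟩ := exists_hasPotential_doubleLayer hT hψ hp₃
  refine homogenizesTo_film hT hψ hh hh0 hρ hM (fun k => h k ^ 2)
    ⟨_, (hs.add (hs'.const_mul (-1))).congr fun φ => by ring⟩ fun u hu => ?_
  have h0 := tendsto_chargeSum hT hψ hB hl hl0 hfl hu.continuous
  simp only [pow_one, pow_zero, one_mul] at h0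
  have key := tendsto_slabIntegral_div_h hT hψ hB hl hh hl0 hh0 hρ hM hlh hu h0
    (tendsto_normalSum hT hψ hB hl hl0 hp₃l hu)
  rw [← neg_doubleLayer, ← surfaceSource_eq, ← sub_eq_add_neg] at key
  refine key.congr fun k => ?_
  have h1 := (hh k).ne'
  field_simp

end Regimes

end

end ThinFilm

theorem theorem5p1
    (T : Set E2) (hT : IsC1Domain T)
    (ψ ν : E3 → E3) (hψ : IsFilmChart ψ T ν)
    (n : E3 → E3) (hn : ∀ x ∈ frontier T, IsOutwardConormal ψ T x (n (mid ψ x)))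
    (e : Module.Basis (Fin 2) ℝ E2) (B : Set E2) (hB : IsUnitCell e B)
    (l h : ℕ → ℝ) (hl : ∀ k, 0 < l k) (hh : ∀ k, 0 < h k)
    (hl0 : Tendsto l atTop (𝓝 0)) (hh0 : Tendsto h atTop (𝓝 0))
    (ρ : ℕ → E3 → ℝ) (hρ : ∀ k, ContinuousOn (ρ k) (film ψ T (h k)))
    (M : ℝ) (hM : ∀ k, ∀ r ∈ film ψ T (h k), |ρ k r| ≤ M) :
    -- (1) `h / l → 0`, charge `ρ / (l h)`, free charge of order `(1, 0)`
    (∀ (q σ : E3 → ℝ) (p : E3 → E3) (P : E2 → E2),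
      Tendsto (fun k => h k / l k) atTop (𝓝 0) →
      IntegrableOn (fun x => q (mid ψ x)) T →
      IntegrableOn σ (surfaceBoundary ψ T) (μH[1]) →
      (∀ x ∈ closure T, p (mid ψ x) = D0 ψ x (P x)) →
      (∃ U, IsOpen U ∧ closure T ⊆ U ∧ ContDiffOn ℝ 1 (fun x => J0 ψ x • P x) U) →
      BulkLimit ψ e B T l (fun k => freeCharge ψ B 1 0 (ρ k) (l k) (h k)) (fun x => q (mid ψ x)) →
      BulkLimit ψ e B T l (fun k => planePol ψ B (ρ k) (l k) (h k)) P →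
      EdgeLimit ψ e B T l (fun k => edgeCharge ψ B T (ρ k) (l k) (h k)) σ →
      HomogenizesTo (surface ψ T)
        (fun k => volumeSource ((film ψ T (h k)).indicator fun r => ρ k r / (l k * h k)))
        (fun φ => surfaceSource ψ T (fun x => q (mid ψ x) - surfaceDiv ψ P x) φ
          + lineSource ψ T (fun r => σ r + ⟪p r, n r⟫) φ)) ∧
    -- (2) `h / l → α`, charge `ρ / l²`; the free charge has order `(1, 0)`, respectively `(0, 1)`
    (∀ (α : ℝ) (q p₃ σ : E3 → ℝ) (p : E3 → E3) (P : E2 → E2),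
      Tendsto (fun k => h k / l k) atTop (𝓝 α) →
      IntegrableOn (fun x => q (mid ψ x)) T →
      IntegrableOn (fun x => p₃ (mid ψ x)) T →
      IntegrableOn σ (surfaceBoundary ψ T) (μH[1]) →
      (∀ x ∈ closure T, p (mid ψ x) = D0 ψ x (P x)) →
      (∃ U, IsOpen U ∧ closure T ⊆ U ∧ ContDiffOn ℝ 1 (fun x => J0 ψ x • P x) U) →
      BulkLimit ψ e B T l (fun k => planePol ψ B (ρ k) (l k) (h k)) P →
      BulkLimit ψ e B T l (fun k => normalPol ψ B (ρ k) (l k) (h k)) (fun x => p₃ (mid ψ x)) →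
      EdgeLimit ψ e B T l (fun k => edgeCharge ψ B T (ρ k) (l k) (h k)) σ →
      (BulkLimit ψ e B T l (fun k => freeCharge ψ B 1 0 (ρ k) (l k) (h k))
          (fun x => q (mid ψ x)) →
        HomogenizesTo (surface ψ T)
          (fun k => volumeSource ((film ψ T (h k)).indicator fun r => ρ k r / l k ^ 2))
          (fun φ => α * surfaceSource ψ T (fun x => q (mid ψ x) - surfaceDiv ψ P x) φ
            - α ^ 2 * doubleLayer ψ T ν p₃ φ
            + α * lineSource ψ T (fun r => σ r + ⟪p r, n r⟫) φ)) ∧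
      (BulkLimit ψ e B T l (fun k => freeCharge ψ B 0 1 (ρ k) (l k) (h k))
          (fun x => q (mid ψ x)) →
        HomogenizesTo (surface ψ T)
          (fun k => volumeSource ((film ψ T (h k)).indicator fun r => ρ k r / l k ^ 2))
          (fun φ => α * surfaceSource ψ T (fun x => α * q (mid ψ x) - surfaceDiv ψ P x) φ
            - α ^ 2 * doubleLayer ψ T ν p₃ φ
            + α * lineSource ψ T (fun r => σ r + ⟪p r, n r⟫) φ))) ∧
    -- (3) `l / h → 0`, charge `ρ / h²`, free charge of order `(0, 1)`
    (∀ (q p₃ : E3 → ℝ),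
      Tendsto (fun k => l k / h k) atTop (𝓝 0) →
      IntegrableOn (fun x => q (mid ψ x)) T →
      IntegrableOn (fun x => p₃ (mid ψ x)) T →
      BulkLimit ψ e B T l (fun k => freeCharge ψ B 0 1 (ρ k) (l k) (h k)) (fun x => q (mid ψ x)) →
      BulkLimit ψ e B T l (fun k => normalPol ψ B (ρ k) (l k) (h k)) (fun x => p₃ (mid ψ x)) →
      HomogenizesTo (surface ψ T)
        (fun k => volumeSource ((film ψ T (h k)).indicator fun r => ρ k r / h k ^ 2))
        (fun φ => surfaceSource ψ T (fun x => q (mid ψ x)) φ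
          - doubleLayer ψ T ν p₃ φ)) := by
  refine ⟨?_, ?_, ?_⟩
  · rintro q σ p P hlh hq hσ hp ⟨U, hU, hTU, hP⟩ hql hPl hσl
    exact homogenizesTo_of_thin hT hψ hn hB hl hh hl0 hh0 hρ hM hlh hq hσ hp hU hTU hP hql hPl hσl
  · rintro α q p₃ σ p P hlh hq hp₃ hσ hp ⟨U, hU, hTU, hP⟩ hPl hp₃l hσl
    constructor
    · intro hql
      refine homogenizesTo_of_comparable hT hψ hn hB hl hh hl0 hh0 hρ hM hlh hq hp₃ hσ hp hU hTU hP
        (fun u hu => ?_) hPl hp₃l hσl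
      have h0 := tendsto_chargeSum hT hψ hB hl hl0 hql hu.continuous
      simpa only [pow_one, pow_zero, mul_one] using h0
    · intro hql
      refine homogenizesTo_of_comparable hT hψ hn hB hl hh hl0 hh0 hρ hM hlh (hq.const_mul α) hp₃ hσ
        hp hU hTU hP (fun u hu => ?_) hPl hp₃l hσl
      -- A charge of order `(0, 1)` divided by `l` equals `h / l` times the charge divided by `h`,
      -- so its limit density is `α q`.
      have h0 := hlh.mul (tendsto_chargeSum hT hψ hB hl hl0 hql hu.continuous)
      simp only [pow_one, pow_zero, one_mul] at h0
      rw [← integral_const_mul] at h0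
      convert h0 using 2 with k
      · have h1 := (hh k).ne'
        field_simp
      · exact integral_congr_ae (Eventually.of_forall fun x => by simp only; ring)
  · intro q p₃ hlh hq hp₃ hql hp₃l
    exact homogenizesTo_of_thick hT hψ hB hl hh hl0 hh0 hρ hM hlh hq hp₃ hql hp₃l
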